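/- **Setting.** Let $n\ge 2$, $q\ge 0$. Consider $$\dot x_i=\phi_i(x_1,\dots,x_i)^{\top}\theta(t)+x_{i+1}\ (1\le i\le n-1),\qquad \dot x_n=\phi_n(x)^{\top}\theta(t)+b(t)u,$$ with $\phi_i:\mathbb R^i\to\mathbb R^q$ smooth, $\phi_i(0)=0$. Here $\theta$ and $b$ are piecewise continuous on $[0,\infty)$; $\theta(t)\in\Theta_0$ for all $t\ge 0$, where $\Theta_0$ is compact and contained in some closed ball of known radius $\delta$ (with unknown centre); and for some $\ell_b$, $\operatorname{sgn}b(t)=\operatorname{sgn}\ell_b\ne0$ and $0<|\ell_b|\le|b(t)|$ for all $t\ge0$. The sign $\sigma=\operatorname{sgn}\ell_b$ is known. Let $\psi:\mathbb R\to(-1,1)$ be smooth with $\psi(0)=0$, $\psi'>0$ everywhere and $\psi(r)\to\pm1$ as $r\to\pm\infty$. Put $\psi^{-1}(y)=+\infty$ for $y\ge1$ and $-\infty$ for $y\le-1$. Let $\beta:[0,\infty)\to(0,1]$ be $C^{n-1}$, with an $n$-th derivative that exists except at finitely many times of each bounded interval and is piecewise continuous, $\beta^{(1)},\dots,\beta^{(n)}$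 bounded, $\beta(0)=1$ and $\lim_{t\to\infty}\beta(t)\in(0,1)$. Fix $k_1,\dots,k_n>0$, $\epsilon>0$, $\gamma_\rho>0$ and a symmetric positive definite $\Gamma\in\mathbb R^{q\times q}$. **Design.** The following are functions of $(x,\beta,\dot\beta,\dots,\beta^{(n)},\hat\theta)$, with the $\beta^{(j)}$ treated as independent variables, on the region $\beta>0$, $|\psi(x_1)|<\beta$. Put $$z_1=\frac{\beta\psi(x_1)}{\beta^2-\psi(x_1)^2},\quad \Pi=\frac{\partial z_1}{\partial x_1},\quad \Psi=\frac{\partial z_1}{\partial\beta}\dot\beta,\quad \phi_1=x_1\Phi_1,\quad x_1=W_1z_1,$$ $$\alpha_1=-\tfrac1\Pi(k_1+\zeta_1)z_1-\tfrac{\Psi}{\Pi}-\phi_1^\top\hat\theta,\quad \zeta_1=\tfrac12\Big(\tfrac1\epsilon+\delta\Pi|\Phi_1|^2W_1^2+\Pi\delta+(n-1)\delta\Big),\quad \tau_1=\Gamma z_1\Pi x_1\Phi_1 .$$ For $2\le i\le n$ put $$z_i=x_i-\alpha_{i-1},\quad w_i=\phi_i-\sum_{j<i}\frac{\partial\alpha_{i-1}}{\partial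 x_j}\phi_j,\quad \tau_i=\tau_{i-1}+\Gamma w_iz_i,\quad w_i=W_i^\top(z_1,\dots,z_i)^\top,$$ with $W_i(x_1,\dots,x_i,\beta,\dots,\beta^{(i-1)},\hat\theta)\in\mathbb R^{i\times q}$ smooth. For $2\le i\le n-1$ put $$\alpha_i=-\bar z_{i-1}-(k_i+\zeta_i)z_i-w_i^\top\hat\theta+\sum_{j=1}^{i-1}\frac{\partial\alpha_{i-1}}{\partial x_j}x_{j+1}+\sum_{j=0}^{i-1}\frac{\partial\alpha_{i-1}}{\partial\beta^{(j)}}\beta^{(j+1)}+\sum_{j=2}^{i-1}\frac{\partial\alpha_{j-1}}{\partial\hat\theta}\Gamma z_jw_i+\frac{\partial\alpha_{i-1}}{\partial\hat\theta}\tau_i,$$ where $\zeta_i=\frac12(\delta|W_i|_F^2+(n+1-i)\delta+\frac1\epsilon)$, $\bar z_1=\Pi z_1$ and $\bar z_j=z_j$ for $j\ge2$. Let $$\Omega=\bar z_{n-1}+w_n^\top\hat\theta-\frac{\partial\alpha_{n-1}}{\partial\hat\theta}\tau_n-\sum_{j=1}^{n-1}\frac{\partial\alpha_{n-1}}{\partial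 x_j}x_{j+1}-\sum_{j=0}^{n-1}\frac{\partial\alpha_{n-1}}{\partial\beta^{(j)}}\beta^{(j+1)}-\sum_{j=2}^{n-1}\frac{\partial\alpha_{j-1}}{\partial\hat\theta}\Gamma z_jw_n=\bar\Omega^\top z$$ with $z=(z_1,\dots,z_n)^\top$ and $\bar\Omega$ smooth. The controller is $$u=\hat\rho\,\bar u,\quad \bar u=-\kappa z_n,\quad \kappa=k_n+\tfrac12\big(\delta|W_n|_F^2+\delta+\tfrac1\epsilon+\epsilon|\bar\Omega|^2\big),\quad \dot{\hat\theta}=\tau_n,\quad \dot{\hat\rho}=-\gamma_\rho\,\sigma\,z_n\bar u .$$ **Claim.** Smooth factors $W_2,\dots,W_n,\bar\Omega$ as required exist. For every choice of them, and all $\beta,\theta,b$ as above: 1. For all $x(0)\in\mathbb R^n$, $\hat\theta(0)\in\mathbb R^q$ and $\hat\rho(0)$ with $\sigma\hat\rho(0)>0$, the closed loop has a solution on $[0,\infty)$ (continuous, satisfying the equations except at finitely many times of each bounded interval), and every solution on an interval $[0,T)$ with these initial data coincides with it there. Along it, $\psi^{-1}(-\beta(t))<x_1(t)<\psi^{-1}(\beta(t))$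 for all $t\ge0$, so $|x_1(t)|<\psi^{-1}(\beta(t))$ if $\psi$ is odd; $x(t)\to0$; $\hat\theta(t)$ and $\hat\rho(t)$ converge to finite limits; and $u$, $\dot{\hat\theta}=\tau_n$ and $\dot{\hat\rho}$ (as given by the laws) are bounded on $[0,\infty)$. 2. For every $\ell_\theta$ with $|\theta(t)-\ell_\theta|\le\delta$ for all $t\ge0$ and every $\ell_b$ as above, the equilibrium $(x,\hat\theta,\hat\rho)=(0,\ell_\theta,1/\ell_b)$ is Lyapunov stable (initial time $0$); together with $x(t)\to 0$ this is the asymptotic stability of the closed loop. 3. The limits of the estimates need not be $\ell_\theta$ and $1/\ell_b$: for all such $\ell_\theta,\ell_b$ there are admissible initial data for which $\lim\hat\rho\ne1/\ell_b$ and, if $q>0$, $\lim\hat\theta\ne\ell_\theta$. -/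

import Mathlib

open scoped ContDiff

noncomputable section

namespace Backstepping

/-! ### Signals on the half-line -/

/-- A set of times having finitely many points in every bounded interval. -/
def LocallyFiniteTimes (S : Set ℝ) : Prop := ∀ R : ℝ, (S ∩ Set.Icc 0 R).Finite

/-- Piecewise continuity on `[0, ∞)`: finitely many discontinuities in every bounded interval,
and finite one-sided limits everywhere. -/
def PiecewiseContinuous {E : Type*} [TopologicalSpace E] (f : ℝ → E) : Prop :=
  (∃ S : Set ℝ, LocallyFiniteTimes S ∧
    ∀ t ∈ Set.Ici (0 : ℝ) \ S, ContinuousWithinAt f (Set.Ici 0) t) ∧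
  (∀ t : ℝ, 0 ≤ t → ∃ l : E, Filter.Tendsto f (nhdsWithin t (Set.Ioi t)) (nhds l)) ∧
  (∀ t : ℝ, 0 < t → ∃ l : E, Filter.Tendsto f (nhdsWithin t (Set.Iio t)) (nhds l))

/-- The `j`-th derivative of `β` on `[0, ∞)` (one-sided at `0`). -/
def timeDeriv (β : ℝ → ℝ) (j : ℕ) (t : ℝ) : ℝ := iteratedDerivWithin j β (Set.Ici 0) t

/-- Generalized performance functions for a system of order `n`. The `n`-th derivative is allowed
to have jumps, so that profiles reaching their final value in finite time are included. -/
structure IsPerformanceFunction (n : ℕ) (β : ℝ → ℝ) : Prop where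
  contDiffOn : ContDiffOn ℝ ((n - 1 : ℕ) : WithTop ℕ∞) β (Set.Ici 0)
  differentiable_off : ∃ S : Set ℝ, LocallyFiniteTimes S ∧ ∀ t ∈ Set.Ici (0 : ℝ) \ S,
    DifferentiableWithinAt ℝ (timeDeriv β (n - 1)) (Set.Ici 0) t
  piecewiseContinuous : PiecewiseContinuous (timeDeriv β n)
  bounded_deriv : ∀ j : ℕ, 1 ≤ j → j ≤ n → ∃ C : ℝ, ∀ t : ℝ, 0 ≤ t → |timeDeriv β j t| ≤ C
  pos : ∀ t : ℝ, 0 ≤ t → 0 < β t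
  le_one : ∀ t : ℝ, 0 ≤ t → β t ≤ 1
  init : β 0 = 1
  limit : ∃ l : ℝ, 0 < l ∧ l < 1 ∧ Filter.Tendsto β Filter.atTop (nhds l)

/-- Generalized normalized functions. Strict monotonicity and the range `(-1, 1)` follow. -/
structure IsNormalizedFunction (ψ : ℝ → ℝ) : Prop where
  smooth : ContDiff ℝ ∞ ψ
  map_zero : ψ 0 = 0
  deriv_pos : ∀ r : ℝ, 0 < deriv ψ r
  limit_top : Filter.Tendsto ψ Filter.atTop (nhds 1)
  limit_bot : Filter.Tendsto ψ Filter.atBot (nhds (-1))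

/-- The inverse of an increasing bijection `ψ : ℝ → (-1, 1)`, extended by the value `+∞` at
arguments `≥ 1` and by `-∞` at arguments `≤ -1`. -/
def extInv (ψ : ℝ → ℝ) (y : ℝ) : EReal := sSup ((fun r : ℝ => (r : EReal)) '' {r | ψ r < y})

/-- `ℓ` is an admissible constant gain level: `sgn b(t) = sgn ℓ = σ` and `0 < |ℓ| ≤ |b(t)|`. -/
def IsGainLevel (σ : ℝ) (b : ℝ → ℝ) (ℓ : ℝ) : Prop :=
  0 < |ℓ| ∧ Real.sign ℓ = σ ∧ ∀ t : ℝ, 0 ≤ t → Real.sign (b t) = σ ∧ |ℓ| ≤ |b t|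

/-! ### Spaces -/

/-- The parameter space `ℝ^q` with its Euclidean norm. -/
abbrev Vec (q : ℕ) := EuclideanSpace ℝ (Fin q)

/-- Arguments `(x, (β, β', …, β⁽ⁿ⁾), θ̂)` of the design functions; the derivatives of `β` are
independent real variables here. -/
abbrev Pt (n q : ℕ) := (Fin n → ℝ) × (Fin (n + 1) → ℝ) × Vec q

/-- Arguments `((x₁, …, xᵢ), (β, …, β⁽ⁱ⁻¹⁾), θ̂)`. -/
abbrev Pt' (i q : ℕ) := (Fin i → ℝ) × (Fin i → ℝ) × Vec q

variable {n q : ℕ}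

/-- The state coordinate `x_j`, `1 ≤ j ≤ n`. -/
def xc (p : Pt n q) (j : ℕ) : ℝ := if h : j - 1 < n then p.1 ⟨j - 1, h⟩ else 0

/-- The coordinate `β⁽ʲ⁾`, `0 ≤ j ≤ n`. -/
def bc (p : Pt n q) (j : ℕ) : ℝ := if h : j < n + 1 then p.2.1 ⟨j, h⟩ else 0

/-- The vector `(x₁, …, xᵢ)`. -/
def xlow (p : Pt n q) (i : ℕ) : Fin i → ℝ := fun k => xc p (k.val + 1)

/-- The truncated argument `((x₁, …, xᵢ), (β, …, β⁽ⁱ⁻¹⁾), θ̂)`. -/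
def trunc (p : Pt n q) (i : ℕ) : Pt' i q := (xlow p i, fun k => bc p k.val, p.2.2)

/-- `∂f/∂x_j`. -/
def dx (j : ℕ) (f : Pt n q → ℝ) (p : Pt n q) : ℝ :=
  fderiv ℝ f p (fun k => if k.val + 1 = j then 1 else 0, 0, 0)

/-- `∂f/∂β⁽ʲ⁾`. -/
def db (j : ℕ) (f : Pt n q → ℝ) (p : Pt n q) : ℝ :=
  fderiv ℝ f p (0, fun k => if k.val = j then 1 else 0, 0)

/-- `(∂f/∂θ̂) v`. -/
def dth (f : Pt n q → ℝ) (p : Pt n q) (v : Vec q) : ℝ := fderiv ℝ f p (0, 0, v)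

/-! ### Design data -/

/-- Regressors, normalized function and design constants; `sgn` is the known sign of the input
gain. -/
structure DesignData (q : ℕ) where
  φ : (i : ℕ) → (Fin i → ℝ) → Vec q
  ψ : ℝ → ℝ
  k : ℕ → ℝ
  δ : ℝ
  ε : ℝ
  Γ : Matrix (Fin q) (Fin q) ℝ
  γ : ℝ
  sgn : ℝ

/-- The standing requirements on the design data of a system of order `n`. -/
structure DesignData.Valid (n : ℕ) (P : DesignData q) : Prop where
  φ_smooth : ∀ i : ℕ, 1 ≤ i → i ≤ n → ContDiff ℝ ∞ (P.φ i)
  φ_zero : ∀ i : ℕ, 1 ≤ i → i ≤ n → P.φ i 0 = 0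
  ψ_normalized : IsNormalizedFunction P.ψ
  k_pos : ∀ i : ℕ, 1 ≤ i → i ≤ n → 0 < P.k i
  ε_pos : 0 < P.ε
  Γ_posDef : P.Γ.PosDef
  γ_pos : 0 < P.γ

/-- The rows of the `i × q` matrices `Wᵢ`, `2 ≤ i ≤ n`. -/
abbrev Rows (q : ℕ) := (i : ℕ) → Pt' i q → Fin i → Vec q

/-- The region `β > 0`, `|ψ(x₁)| < β`, on which the design functions are defined. -/
def region (n : ℕ) (P : DesignData q) : Set (Pt n q) :=
  {p | 0 < bc p 0 ∧ |P.ψ (xc p 1)| < bc p 0}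

/-- The same region for truncated arguments. -/
def region' (i : ℕ) (P : DesignData q) : Set (Pt' i q) :=
  {r | ∀ h : 0 < i, 0 < r.2.1 ⟨0, h⟩ ∧ |P.ψ (r.1 ⟨0, h⟩)| < r.2.1 ⟨0, h⟩}

/-! ### The design functions -/

/-- The regressor `φᵢ(x₁, …, xᵢ)`. -/
def reg (P : DesignData q) (i : ℕ) (p : Pt n q) : Vec q := P.φ i (xlow p i)

/-- Multiplication by the adaptation gain. -/
def gain (P : DesignData q) (v : Vec q) : Vec q := Matrix.toEuclideanLin P.Γ v

/-- `z₁ = βψ(x₁) / (β² - ψ(x₁)²)`. -/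
def zOne (P : DesignData q) (p : Pt n q) : ℝ :=
  bc p 0 * P.ψ (xc p 1) / (bc p 0 ^ 2 - P.ψ (xc p 1) ^ 2)

/-- `Π = ∂z₁/∂x₁`. -/
def Pif (P : DesignData q) (p : Pt n q) : ℝ :=
  ((bc p 0 ^ 2 - P.ψ (xc p 1) ^ 2) * bc p 0 * deriv P.ψ (xc p 1)
    + 2 * P.ψ (xc p 1) ^ 2 * deriv P.ψ (xc p 1) * bc p 0)
    / (bc p 0 ^ 2 - P.ψ (xc p 1) ^ 2) ^ 2

/-- `Ψ = (∂z₁/∂β) β'`. -/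
def Psif (P : DesignData q) (p : Pt n q) : ℝ :=
  (bc p 1 * P.ψ (xc p 1) * (bc p 0 ^ 2 - P.ψ (xc p 1) ^ 2)
    - 2 * bc p 0 ^ 2 * bc p 1 * P.ψ (xc p 1))
    / (bc p 0 ^ 2 - P.ψ (xc p 1) ^ 2) ^ 2

/-- `Φ₁`, the smooth function with `φ₁(x₁) = x₁ Φ₁(x₁)`. -/
def PhiOne (P : DesignData q) (p : Pt n q) : Vec q :=
  dslope (fun s : ℝ => P.φ 1 (fun _ => s)) 0 (xc p 1)

/-- `W₁ = (β² - ψ²) / (β ψ(x₁)/x₁)`, the smooth function with `x₁ = W₁ z₁`. -/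
def WOne (P : DesignData q) (p : Pt n q) : ℝ :=
  (bc p 0 ^ 2 - P.ψ (xc p 1) ^ 2) / (bc p 0 * dslope P.ψ 0 (xc p 1))

/-- The damping gain `ζ₁`. -/
def zetaOne (P : DesignData q) (p : Pt n q) : ℝ :=
  (1 / 2) * (1 / P.ε + P.δ * Pif P p * ‖PhiOne P p‖ ^ 2 * WOne P p ^ 2 + Pif P p * P.δ
    + ((n : ℝ) - 1) * P.δ)

/-- The first virtual control `α₁`. -/
def alphaOne (P : DesignData q) (p : Pt n q) : ℝ :=
  -(1 / Pif P p) * (P.k 1 + zetaOne P p) * zOne P p - Psif P p / Pif P p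
    - inner ℝ (reg P 1 p) p.2.2

/-- `z₁` as above and `zᵢ = xᵢ - αᵢ₋₁` for `i ≥ 2`. -/
def zf (P : DesignData q) (a : ℕ → Pt n q → ℝ) (i : ℕ) (p : Pt n q) : ℝ :=
  if i = 1 then zOne P p else xc p i - a (i - 1) p

/-- `wᵢ = φᵢ - ∑_{j<i} (∂αᵢ₋₁/∂x_j) φ_j`. -/
def wf (P : DesignData q) (a : ℕ → Pt n q → ℝ) (i : ℕ) (p : Pt n q) : Vec q :=
  reg P i p - ∑ j ∈ Finset.Icc 1 (i - 1), dx j (a (i - 1)) p • reg P j p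

/-- The tuning functions: `τ₁ = Γ z₁ Π x₁ Φ₁`, `τᵢ = τᵢ₋₁ + Γ wᵢ zᵢ`. -/
def tau (P : DesignData q) (a : ℕ → Pt n q → ℝ) (i : ℕ) (p : Pt n q) : Vec q :=
  gain P ((zOne P p * Pif P p * xc p 1) • PhiOne P p
    + ∑ j ∈ Finset.Icc 2 i, zf P a j p • wf P a j p)

/-- The term cancelling the coupling with the previous step: `Π z₁` at step 2, and `zᵢ₋₁` at later
steps. -/
def zPrev (P : DesignData q) (a : ℕ → Pt n q → ℝ) (i : ℕ) (p : Pt n q) : ℝ :=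
  if i = 2 then Pif P p * zOne P p else zf P a (i - 1) p

/-- `|Wᵢ|_F²`. -/
def frobSq (W : Rows q) (i : ℕ) (p : Pt n q) : ℝ := ∑ k : Fin i, ‖W i (trunc p i) k‖ ^ 2

/-- The damping gains `ζᵢ`, `2 ≤ i ≤ n - 1`. -/
def zeta (P : DesignData q) (W : Rows q) (i : ℕ) (p : Pt n q) : ℝ :=
  (1 / 2) * (P.δ * frobSq W i p + ((n : ℝ) + 1 - i) * P.δ + 1 / P.ε)

/-- `αᵢ` for `i ≥ 2`, in terms of the virtual controls `a j = α_j` with `j < i`. -/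
def alphaNext (P : DesignData q) (W : Rows q) (a : ℕ → Pt n q → ℝ) (i : ℕ) (p : Pt n q) : ℝ :=
  -zPrev P a i p - (P.k i + zeta P W i p) * zf P a i p - inner ℝ (wf P a i p) p.2.2
    + ∑ j ∈ Finset.Icc 1 (i - 1), dx j (a (i - 1)) p * xc p (j + 1)
    + ∑ j ∈ Finset.range i, db j (a (i - 1)) p * bc p (j + 1)
    + ∑ j ∈ Finset.Icc 2 (i - 1), dth (a (j - 1)) p (gain P (zf P a j p • wf P a i p))
    + dth (a (i - 1)) p (tau P a i p)

/-- The list of virtual controls after `m` steps of the recursion. -/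
def table (P : DesignData q) (W : Rows q) : ℕ → ℕ → Pt n q → ℝ
  | 0 => fun _ _ => 0
  | m + 1 => Function.update (table P W m) (m + 1)
      (if m = 0 then alphaOne P else alphaNext P W (table P W m) (m + 1))

/-- The virtual controls `αᵢ`, `1 ≤ i ≤ n - 1`. -/
def alpha (P : DesignData q) (W : Rows q) (i : ℕ) : Pt n q → ℝ := table P W i i

/-- The lumped term `Ω` of the last step. -/
def Omega (P : DesignData q) (W : Rows q) (p : Pt n q) : ℝ :=
  zPrev P (alpha P W) n p + inner ℝ (wf P (alpha P W) n p) p.2.2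
    - dth (alpha P W (n - 1)) p (tau P (alpha P W) n p)
    - ∑ j ∈ Finset.Icc 1 (n - 1), dx j (alpha P W (n - 1)) p * xc p (j + 1)
    - ∑ j ∈ Finset.range n, db j (alpha P W (n - 1)) p * bc p (j + 1)
    - ∑ j ∈ Finset.Icc 2 (n - 1),
        dth (alpha P W (j - 1)) p (gain P (zf P (alpha P W) j p • wf P (alpha P W) n p))

/-- `W` and `Ωb` are smooth mappings with `wᵢ = Wᵢᵀ (z₁, …, zᵢ)` for `2 ≤ i ≤ n` and
`Ω = Ωbᵀ (z₁, …, zₙ)`. -/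
structure IsFactorization (n : ℕ) (P : DesignData q) (W : Rows q) (Ωb : Pt n q → Fin n → ℝ) :
    Prop where
  W_smooth : ∀ i : ℕ, 2 ≤ i → i ≤ n → ContDiffOn ℝ ∞ (W i) (region' i P)
  W_eq : ∀ i : ℕ, 2 ≤ i → i ≤ n → ∀ p ∈ region n P,
    wf P (alpha P W) i p = ∑ k : Fin i, zf P (alpha P W) (k.val + 1) p • W i (trunc p i) k
  Ω_smooth : ContDiffOn ℝ ∞ Ωb (region n P)
  Ω_eq : ∀ p ∈ region n P,
    Omega P W p = ∑ k : Fin n, Ωb p k * zf P (alpha P W) (k.val + 1) p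

/-- The gain `κ` of the last step. -/
def kappa (P : DesignData q) (W : Rows q) (Ωb : Pt n q → Fin n → ℝ) (p : Pt n q) : ℝ :=
  P.k n + (1 / 2) * (P.δ * frobSq W n p + P.δ + 1 / P.ε + P.ε * ∑ k : Fin n, Ωb p k ^ 2)

/-- `ū = -κ zₙ`. -/
def ubar (P : DesignData q) (W : Rows q) (Ωb : Pt n q → Fin n → ℝ) (p : Pt n q) : ℝ :=
  -kappa P W Ωb p * zf P (alpha P W) n p

/-! ### The closed loop -/

/-- Closed-loop states `(x, θ̂, ρ̂)`. -/
abbrev St (n q : ℕ) := (Fin n → ℝ) × Vec q × ℝ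

/-- The argument of the design functions at time `t` and closed-loop state `s`. -/
def pt (β : ℝ → ℝ) (t : ℝ) (s : St n q) : Pt n q :=
  (s.1, fun j => timeDeriv β j.val t, s.2.1)

/-- The control input `u = ρ̂ ū`. -/
def control (P : DesignData q) (W : Rows q) (Ωb : Pt n q → Fin n → ℝ) (β : ℝ → ℝ)
    (t : ℝ) (s : St n q) : ℝ := s.2.2 * ubar P W Ωb (pt β t s)

/-- The update law for `θ̂`. -/
def thetaLaw (P : DesignData q) (W : Rows q) (β : ℝ → ℝ) (t : ℝ) (s : St n q) : Vec q :=
  tau P (alpha P W) n (pt β t s)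

/-- The update law for `ρ̂`. -/
def rhoLaw (P : DesignData q) (W : Rows q) (Ωb : Pt n q → Fin n → ℝ) (β : ℝ → ℝ)
    (t : ℝ) (s : St n q) : ℝ :=
  -P.γ * P.sgn * zf P (alpha P W) n (pt β t s) * ubar P W Ωb (pt β t s)

/-- The right-hand side of the closed loop: the strict-feedback plant
`ẋᵢ = φᵢᵀθ + xᵢ₊₁` (`i < n`), `ẋₙ = φₙᵀθ + b u`, and the two update laws. -/
def field (P : DesignData q) (W : Rows q) (Ωb : Pt n q → Fin n → ℝ) (β : ℝ → ℝ)
    (θ : ℝ → Vec q) (b : ℝ → ℝ) (t : ℝ) (s : St n q) : St n q :=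
  (fun i => inner ℝ (reg P (i.val + 1) (pt β t s)) (θ t)
      + (if i.val + 1 < n then xc (pt β t s) (i.val + 2) else b t * control P W Ωb β t s),
    thetaLaw P W β t s,
    rhoLaw P W Ωb β t s)

/-- `X` solves the closed loop on `[0, T)`, `0 < T ≤ ∞`: it is continuous and satisfies the
differential equation except at finitely many times of each bounded interval. -/
def IsSolution (P : DesignData q) (W : Rows q) (Ωb : Pt n q → Fin n → ℝ) (β : ℝ → ℝ)
    (θ : ℝ → Vec q) (b : ℝ → ℝ) (T : EReal) (X : ℝ → St n q) : Prop :=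
  ContinuousOn X {t : ℝ | 0 ≤ t ∧ (t : EReal) < T} ∧
  ∃ S : Set ℝ, LocallyFiniteTimes S ∧ ∀ t : ℝ, 0 < t → (t : EReal) < T → t ∉ S →
    HasDerivAt X (field P W Ωb β θ b t (X t)) t

end Backstepping

end

/-!
The proof is tuning-function backstepping with "congelation of variables": the time-varying `θ(t)`
and `b(t)` are replaced in the Lyapunov function by constants `ℓ_θ`, `ℓ_b`, and the nonlinear damping
dominates what this replacement leaves over.

*Factorizations.* By induction on `i`, the virtual control `αᵢ` is smooth on the region, depends
only on `x₁, …, xᵢ`, on `β, …, β⁽ⁱ⁾` and on `θ̂`, and vanishes where `x₁ = … = xᵢ = 0`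
(`isVirtualControl_alphaNext`). Scaling `x` to `0` stays inside the region, so Hadamard's lemma writes
a smooth function with these zeros as a smooth combination of `x₁, …, xᵢ`; since
`x_j = z_j + α_{j-1}`, the coordinates `x_j` are in turn smooth combinations of the `z_j`. This gives
`Wᵢ` and `Ω̄` (`exists_isFactorization`).

*Dissipation.* For `V = ½ ∑ zᵢ² + ½ (θ̂ - ℓ_θ)ᵀ Γ⁻¹ (θ̂ - ℓ_θ) + |ℓ_b| (ρ̂ - 1/ℓ_b)² / (2 γ_ρ)` the
tuning-function couplings cancel by antisymmetry (`sum_zf_mul_coupling`), Young's inequality absorbs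
`θ(t) - ℓ_θ` and `Ω` into the damping gains, and `|b(t)| ≥ |ℓ_b|` suffices for the input term because
`ρ̂` keeps its sign. Hence `V' ≤ -∑ kᵢ zᵢ²` (`dissipation`).

*Existence and uniqueness.* A bound on `V` bounds `θ̂`, `ρ̂` and all `zᵢ`, and as `β` is bounded away
from zero this confines the arguments of the field to a compact part of the region
(`IsClosedLoop.exists_compact_of_lyapAt_le`). Near that part the field is replaced by one that is
bounded and Lipschitz in the state with a locally bounded constant, for which Picard iteration gives
a solution on `[0, ∞)`. As `V` does not increase, the solution never meets the modification. The
field is only piecewise continuous in time, so derivatives are controlled off locally finite sets of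
times throughout.

*Asymptotics.* `V` decreases and is nonnegative, so it converges. On a compact set `τ_n` is
quadratic in `z`, so `|τ_n|` is dominated by the dissipation, and `c θ̂ᵢ + V` is nonincreasing for
small `c > 0`: each `θ̂ᵢ` converges. `ρ̂` converges by monotonicity. Therefore `∑ zᵢ²`, the remaining
part of `V`, converges as well, and its limit is zero, as `V` would otherwise decrease linearly. A
small `z` in a compact part of the region means a small `x`, so `x → 0`. The same fact and `V ≤ V(0)`
give stability. At `x = 0` the closed loop is at rest for arbitrary `θ̂` and `ρ̂`, so constant
solutions show that the limits of the estimates need not be `ℓ_θ` and `1/ℓ_b`.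
-/

namespace Backstepping

open Set Filter Topology MeasureTheory Metric
open scoped Manifold

/-! ### Smooth parametric integrals and difference quotients -/

/-- Differentiation under the integral sign over `[0, 1]`: the integral of a smooth family is
smooth in the parameter. -/
theorem contDiffOn_integral_aux {E : Type} [NormedAddCommGroup E] [NormedSpace ℝ E] (m : ℕ) :
    ∀ {F : Type} [NormedAddCommGroup F] [NormedSpace ℝ F] {U : Set E} {O : Set (E × ℝ)}
      {H : E × ℝ → F}, IsOpen U → IsOpen O → U ×ˢ Icc (0 : ℝ) 1 ⊆ O → ContDiffOn ℝ ∞ H O →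
      ContDiffOn ℝ m (fun x => ∫ s in (0 : ℝ)..1, H (x, s)) U := by
  have key : ∀ {F : Type} [NormedAddCommGroup F] [NormedSpace ℝ F] {U : Set E} {O : Set (E × ℝ)}
      {H : E × ℝ → F}, IsOpen U → IsOpen O → U ×ˢ Icc (0 : ℝ) 1 ⊆ O → ContDiffOn ℝ ∞ H O →
      ∀ x ∈ U, HasFDerivAt (fun x => ∫ s in (0 : ℝ)..1, H (x, s))
        (∫ s in (0 : ℝ)..1, (fderiv ℝ H (x, s)).comp (ContinuousLinearMap.inl ℝ E ℝ)) x := by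
    intro F _ _ U O H hU hO hUO hH x hx
    have hfd : ContinuousOn (fun y => (fderiv ℝ H y).comp (ContinuousLinearMap.inl ℝ E ℝ)) O :=
      ((hH.continuousOn_fderiv_of_isOpen hO (by simp))).clm_comp continuousOn_const
    -- a uniform bound for the derivative near the compact segment `{x} × [0, 1]`
    obtain ⟨C, hC⟩ : ∃ C, ∀ s ∈ Icc (0 : ℝ) 1,
        ‖(fderiv ℝ H (x, s)).comp (ContinuousLinearMap.inl ℝ E ℝ)‖ ≤ C := by
      have : ContinuousOn (fun s : ℝ => (fderiv ℝ H (x, s)).comp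
          (ContinuousLinearMap.inl ℝ E ℝ)) (Icc 0 1) :=
        hfd.comp (by fun_prop) fun s hs => hUO ⟨hx, hs⟩
      exact isCompact_Icc.exists_bound_of_continuousOn this
    set N : Set (E × ℝ) := {y | y ∈ O ∧
      ‖(fderiv ℝ H y).comp (ContinuousLinearMap.inl ℝ E ℝ)‖ < C + 1} with hN
    have hNo : IsOpen N := by
      have := hfd.norm.isOpen_inter_preimage hO (isOpen_Iio (a := C + 1))
      exact this
    have hsub : {x} ×ˢ Icc (0 : ℝ) 1 ⊆ N := by
      rintro ⟨y, s⟩ ⟨hy, hs⟩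
      rw [mem_singleton_iff] at hy
      simp only at hy hs
      subst hy
      exact ⟨hUO ⟨hx, hs⟩, lt_of_le_of_lt (hC s hs) (by linarith)⟩
    obtain ⟨u, v, hu, -, hxu, hv, huv⟩ :=
      generalized_tube_lemma isCompact_singleton isCompact_Icc hNo hsub
    have hxu' : x ∈ u := hxu rfl
    have hline : ∀ y ∈ U, ContinuousOn (fun s : ℝ => H (y, s)) (Icc 0 1) := fun y hy =>
      hH.continuousOn.comp (by fun_prop) fun s hs => hUO ⟨hy, hs⟩
    have h01 : uIoc (0 : ℝ) 1 ⊆ Icc 0 1 := by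
      rw [uIoc_of_le zero_le_one]; exact Ioc_subset_Icc_self
    refine intervalIntegral.hasFDerivAt_integral_of_dominated_of_fderiv_le
      (F' := fun y s => (fderiv ℝ H (y, s)).comp (ContinuousLinearMap.inl ℝ E ℝ))
      (s := U ∩ u) (bound := fun _ => C + 1) ((hU.inter hu).mem_nhds ⟨hx, hxu'⟩) ?_ ?_ ?_ ?_ ?_ ?_
    · filter_upwards [hU.mem_nhds hx] with y hy
      exact ((hline y hy).mono h01).aestronglyMeasurable measurableSet_uIoc
    · exact (hline x hx).intervalIntegrable_of_Icc zero_le_one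
    · have : ContinuousOn (fun s : ℝ => (fderiv ℝ H (x, s)).comp
          (ContinuousLinearMap.inl ℝ E ℝ)) (Icc 0 1) :=
        hfd.comp (by fun_prop) fun s hs => hUO ⟨hx, hs⟩
      exact (this.mono h01).aestronglyMeasurable measurableSet_uIoc
    · refine Eventually.of_forall fun s hs y hy => ?_
      exact (huv (show (y, s) ∈ u ×ˢ v from ⟨hy.2, hv (h01 hs)⟩)).2.le
    · exact intervalIntegrable_const
    · refine Eventually.of_forall fun s hs y hy => ?_
      have hd : DifferentiableAt ℝ H (y, s) :=
        (hH.contDiffAt (hO.mem_nhds (hUO ⟨hy.1, h01 hs⟩))).differentiableAt (by simp)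
      exact hd.hasFDerivAt.comp y (hasFDerivAt_prodMk_left y s)
  induction m with
  | zero =>
    intro F _ _ U O H hU hO hUO hH
    exact contDiffOn_zero.2 fun x hx => (key hU hO hUO hH x hx).continuousAt.continuousWithinAt
  | succ m ih =>
    intro F _ _ U O H hU hO hUO hH
    have : ((m + 1 : ℕ) : WithTop ℕ∞) = (m : WithTop ℕ∞) + 1 := by norm_cast
    rw [this, contDiffOn_succ_iff_fderiv_of_isOpen hU]
    refine ⟨fun x hx => (key hU hO hUO hH x hx).differentiableAt.differentiableWithinAt,
      by simp, ?_⟩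
    have h1 : ContDiffOn ℝ ∞
        (fun y => (fderiv ℝ H y).comp (ContinuousLinearMap.inl ℝ E ℝ)) O :=
      (hH.fderiv_of_isOpen hO (by simp)).clm_comp contDiffOn_const
    refine (ih hU hO hUO h1).congr fun x hx => (key hU hO hUO hH x hx).fderiv

theorem contDiffOn_integral {E F : Type} [NormedAddCommGroup E] [NormedSpace ℝ E]
    [NormedAddCommGroup F] [NormedSpace ℝ F] {U : Set E} {O : Set (E × ℝ)}
    {H : E × ℝ → F} (hU : IsOpen U) (hO : IsOpen O) (hUO : U ×ˢ Icc (0 : ℝ) 1 ⊆ O)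
    (hH : ContDiffOn ℝ ∞ H O) : ContDiffOn ℝ ∞ (fun x => ∫ s in (0 : ℝ)..1, H (x, s)) U :=
  contDiffOn_infty.2 fun m => contDiffOn_integral_aux m hU hO hUO hH

theorem dslope_zero_eq_integral {F : Type} [NormedAddCommGroup F] [NormedSpace ℝ F]
    [CompleteSpace F] {f : ℝ → F} (hf : ContDiff ℝ ∞ f) (x : ℝ) :
    dslope f 0 x = ∫ s in (0 : ℝ)..1, deriv f (x * s) := by
  rcases eq_or_ne x 0 with rfl | hx
  · simp
  · rw [dslope_of_ne _ hx, slope_def_module, sub_zero,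
      intervalIntegral.integral_comp_mul_left _ hx, mul_zero, mul_one,
      intervalIntegral.integral_deriv_eq_sub
        (fun y _ => (hf.differentiable (by simp)).differentiableAt)
        ((hf.continuous_deriv (by simp)).intervalIntegrable _ _)]

/-- The difference quotient of a smooth function at `0` is smooth, including at `0`. -/
theorem contDiff_dslope_zero {F : Type} [NormedAddCommGroup F] [NormedSpace ℝ F]
    [CompleteSpace F] {f : ℝ → F} (hf : ContDiff ℝ ∞ f) : ContDiff ℝ ∞ (dslope f 0) := by
  have h1 : ContDiff ℝ ∞ (deriv f) := (contDiff_infty_iff_deriv.1 hf).2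
  have : ContDiff ℝ ∞ fun y : ℝ × ℝ => deriv f (y.1 * y.2) :=
    h1.comp (contDiff_fst.mul contDiff_snd)
  rw [funext (dslope_zero_eq_integral hf), ← contDiffOn_univ]
  exact contDiffOn_integral isOpen_univ isOpen_univ (subset_univ _) this.contDiffOn

/-! ### Differential inequalities with finite exceptional sets -/

/-- A continuous function whose derivative exists and is nonpositive off a finite set is
nonincreasing. -/
theorem le_of_deriv_nonpos_off_finite {S : Set ℝ} (hS : S.Finite) :
    ∀ {f f' : ℝ → ℝ} {a b : ℝ}, a ≤ b → ContinuousOn f (Icc a b) →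
      (∀ t ∈ Ioo a b, t ∉ S → HasDerivAt f (f' t) t ∧ f' t ≤ 0) → f b ≤ f a := by
  induction S, hS using Set.Finite.induction_on with
  | empty =>
    intro f f' a b hab hc hd
    refine antitoneOn_of_deriv_nonpos (convex_Icc a b) hc ?_ ?_ (left_mem_Icc.2 hab)
      (right_mem_Icc.2 hab) hab
    · intro t ht
      rw [interior_Icc] at ht
      exact (hd t ht (notMem_empty t)).1.differentiableAt.differentiableWithinAt
    · intro t ht
      rw [interior_Icc] at ht
      rw [(hd t ht (notMem_empty t)).1.deriv]
      exact (hd t ht (notMem_empty t)).2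
  | @insert c S _ _ ih =>
    intro f f' a b hab hc hd
    by_cases hcab : c ∈ Ioo a b
    · have h1 : f c ≤ f a := by
        refine ih (f' := f') hcab.1.le (hc.mono (Icc_subset_Icc_right hcab.2.le)) fun t ht htS => ?_
        exact hd t ⟨ht.1, ht.2.trans hcab.2⟩ (by simp [htS, ht.2.ne])
      have h2 : f b ≤ f c := by
        refine ih (f' := f') hcab.2.le (hc.mono (Icc_subset_Icc_left hcab.1.le)) fun t ht htS => ?_
        exact hd t ⟨hcab.1.trans ht.1, ht.2⟩ (by simp [htS, ht.1.ne'])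
      exact h2.trans h1
    · refine ih (f' := f') hab hc fun t ht htS => hd t ht ?_
      rintro (rfl | h)
      · exact hcab ht
      · exact htS h

/-- Uniqueness for a linear differential inequality with a finite exceptional set. -/
theorem eq_zero_of_norm_deriv_le_off_finite {E : Type*} [NormedAddCommGroup E] [NormedSpace ℝ E]
    [FiniteDimensional ℝ E] {S : Set ℝ} (hS : S.Finite) {h h' : ℝ → E} {a b L : ℝ} (hab : a ≤ b)
    (hL : 0 ≤ L) (hc : ContinuousOn h (Icc a b))
    (hd : ∀ t ∈ Ioo a b, t ∉ S → HasDerivAt h (h' t) t ∧ ‖h' t‖ ≤ L * ‖h t‖) (ha : h a = 0) :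
    h b = 0 := by
  -- an equivalent Euclidean norm, whose square is differentiable
  set e := toEuclidean (E := E) with he
  set e₁ := e.toContinuousLinearMap with he₁
  set e₂ := e.symm.toContinuousLinearMap with he₂
  set C : ℝ := 2 * (‖e₁‖ * (L * ‖e₂‖)) with hC
  have hle : ∀ v : E, ‖e v‖ ≤ ‖e₁‖ * ‖v‖ := fun v => e₁.le_opNorm v
  have hle' : ∀ v : E, ‖v‖ ≤ ‖e₂‖ * ‖e v‖ := fun v => by
    simpa [he₂] using e₂.le_opNorm (e v)
  have hcont : ContinuousOn (fun t => Real.exp (-C * t) * ‖e (h t)‖ ^ 2) (Icc a b) := by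
    refine ContinuousOn.mul (by fun_prop) ?_
    exact ((e.continuous.comp_continuousOn hc).norm.pow 2)
  have key := le_of_deriv_nonpos_off_finite hS hab hcont
    (f' := fun t => Real.exp (-C * t) * (-C * 1) * ‖e (h t)‖ ^ 2
      + Real.exp (-C * t) * (2 * inner ℝ (e (h t)) (e (h' t)))) ?_
  · have h0 : Real.exp (-C * a) * ‖e (h a)‖ ^ 2 = 0 := by simp [ha]
    rw [h0] at key
    have : ‖e (h b)‖ ^ 2 ≤ 0 := by
      by_contra hcon
      push Not at hcon
      have := mul_pos (Real.exp_pos (-C * b)) hcon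
      linarith
    have : ‖e (h b)‖ = 0 := by nlinarith [norm_nonneg (e (h b))]
    simpa using this
  · intro t ht htS
    obtain ⟨h1, h2⟩ := hd t ht htS
    refine ⟨?_, ?_⟩
    · have h3 : HasDerivAt (fun t => e (h t)) (e (h' t)) t :=
        e.hasFDerivAt.comp_hasDerivAt t h1
      exact (((hasDerivAt_id t).const_mul (-C)).exp).mul h3.norm_sq
    · have h4 : inner ℝ (e (h t)) (e (h' t)) ≤ ‖e (h t)‖ * (‖e₁‖ * (L * (‖e₂‖ * ‖e (h t)‖))) := by
        refine (real_inner_le_norm _ _).trans ?_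
        gcongr
        refine (hle _).trans ?_
        gcongr
        refine h2.trans ?_
        gcongr
        exact hle' _
      have h5 := Real.exp_pos (-C * t)
      have h6 : 2 * inner ℝ (e (h t)) (e (h' t)) ≤ C * ‖e (h t)‖ ^ 2 := by
        rw [hC]; nlinarith [h4]
      nlinarith [mul_le_mul_of_nonneg_left h6 h5.le]

theorem LocallyFiniteTimes.union {S T : Set ℝ} (hS : LocallyFiniteTimes S)
    (hT : LocallyFiniteTimes T) : LocallyFiniteTimes (S ∪ T) := fun R => by
  rw [union_inter_distrib_right]; exact (hS R).union (hT R)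

theorem LocallyFiniteTimes.countable {S : Set ℝ} (hS : LocallyFiniteTimes S) :
    (S ∩ Ici 0).Countable := by
  have : S ∩ Ici 0 = ⋃ k : ℕ, S ∩ Icc 0 (k : ℝ) := by
    ext t
    simp only [mem_inter_iff, mem_Ici, mem_iUnion, mem_Icc]
    constructor
    · rintro ⟨h1, h2⟩
      obtain ⟨k, hk⟩ := exists_nat_ge t
      exact ⟨k, h1, h2, hk⟩
    · rintro ⟨k, h1, h2, -⟩
      exact ⟨h1, h2⟩
  rw [this]
  exact countable_iUnion fun k => (hS k).countable

theorem PiecewiseContinuous.exists_bound {E : Type*} [SeminormedAddCommGroup E] {f : ℝ → E}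
    (hf : PiecewiseContinuous f) (R : ℝ) : ∃ C, ∀ t ∈ Icc 0 R, ‖f t‖ ≤ C := by
  refine isCompact_Icc.induction_on (p := fun s => ∃ C, ∀ t ∈ s, ‖f t‖ ≤ C) ⟨0, by simp⟩
    (fun s t hst ⟨C, hC⟩ => ⟨C, fun x hx => hC x (hst hx)⟩)
    (fun s t ⟨C, hC⟩ ⟨D, hD⟩ => ⟨max C D, fun x hx => hx.elim
      (fun h => (hC x h).trans (le_max_left _ _)) fun h => (hD x h).trans (le_max_right _ _)⟩) ?_
  intro t ht
  obtain ⟨-, hr, hl⟩ := hf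
  obtain ⟨l, hl1⟩ := hr t ht.1
  have e1 : ∀ᶠ x in 𝓝[>] t, ‖f x‖ ≤ ‖l‖ + 1 :=
    (hl1.norm.eventually_lt_const (lt_add_one _)).mono fun x hx => hx.le
  have e2 : ∃ D, ∀ᶠ x in 𝓝[Icc 0 R ∩ Iio t] t, ‖f x‖ ≤ D := by
    rcases ht.1.eq_or_lt with h0 | h0
    · refine ⟨0, ?_⟩
      have : Icc 0 R ∩ Iio t = ∅ := by
        ext x; simp only [mem_inter_iff, mem_Icc, mem_Iio, mem_empty_iff_false, iff_false]
        rintro ⟨⟨h, -⟩, h'⟩; linarith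
      rw [this]; simp
    · obtain ⟨l', hl'⟩ := hl t h0
      refine ⟨‖l'‖ + 1, ?_⟩
      have := (hl'.norm.eventually_lt_const (lt_add_one _)).mono fun x hx => hx.le
      exact this.filter_mono (nhdsWithin_mono _ inter_subset_right)
  obtain ⟨D, e2⟩ := e2
  rw [eventually_nhdsWithin_iff] at e1 e2
  have e3 : ∀ᶠ x in 𝓝 t, x ∈ Icc 0 R → ‖f x‖ ≤ max (max (‖l‖ + 1) D) ‖f t‖ := by
    filter_upwards [e1, e2] with x h1 h2 hxI
    rcases lt_trichotomy x t with h | rfl | h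
    · exact (h2 ⟨hxI, h⟩).trans ((le_max_right _ _).trans (le_max_left _ _))
    · exact le_max_right _ _
    · exact (h1 h).trans ((le_max_left _ _).trans (le_max_left _ _))
  exact ⟨_, eventually_nhdsWithin_iff.2 e3, _, fun x hx => hx⟩

theorem PiecewiseContinuous.continuousAt_off {E : Type*} [TopologicalSpace E] {f : ℝ → E}
    (hf : PiecewiseContinuous f) : ∃ S : Set ℝ, LocallyFiniteTimes S ∧
      ∀ t, 0 < t → t ∉ S → ContinuousAt f t := by
  obtain ⟨⟨S, hS, h⟩, -⟩ := hf
  exact ⟨S, hS, fun t ht htS => (h t ⟨ht.le, htS⟩).continuousAt (Ici_mem_nhds ht)⟩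

/-! ### Global solutions of differential equations with piecewise continuous time dependence -/

theorem aestronglyMeasurable_of_continuousAt_off_countable {E : Type*} [NormedAddCommGroup E]
    {S : Set ℝ} (hS : S.Countable) {g : ℝ → E} (hg : ∀ t, t ∉ S → ContinuousAt g t) :
    AEStronglyMeasurable g volume := by
  have h1 : ContinuousOn g Sᶜ := fun t ht => (hg t ht).continuousWithinAt
  have h2 := h1.aestronglyMeasurable (μ := volume) hS.measurableSet.compl
  rwa [Measure.restrict_eq_self_of_ae_mem] at h2
  exact (hS.ae_notMem volume)

theorem intervalIntegrable_of_bound_off_countable {E : Type*} [NormedAddCommGroup E]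
    {S : Set ℝ} (hS : S.Countable) {g : ℝ → E} (hg : ∀ t, t ∉ S → ContinuousAt g t)
    (hb : ∀ R, ∃ C, ∀ t, t ≤ R → ‖g t‖ ≤ C) (a b : ℝ) : IntervalIntegrable g volume a b := by
  obtain ⟨C, hC⟩ := hb (max a b)
  refine (intervalIntegrable_const (c := C)).mono_fun
    (aestronglyMeasurable_of_continuousAt_off_countable hS hg).restrict ?_
  refine (ae_restrict_mem measurableSet_uIoc).mono fun t ht => ?_
  have : ‖g t‖ ≤ C := hC t ht.2
  exact this.trans (le_abs_self C)

theorem continuousAt_comp_of_lipschitz {E : Type*} [NormedAddCommGroup E]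
    {f : ℝ → E → E} {L : ℝ → ℝ} {y : ℝ → E} {t : ℝ} (hL : ContinuousAt L t)
    (hf : ContinuousAt (fun s => f s (y t)) t) (hy : ContinuousAt y t)
    (hlip : ∀ s y y', ‖f s y - f s y'‖ ≤ L s * ‖y - y'‖) :
    ContinuousAt (fun s => f s (y s)) t := by
  have h1 : Tendsto (fun s => f s (y s) - f s (y t)) (𝓝 t) (𝓝 0) := by
    have : Tendsto (fun s => L s * ‖y s - y t‖) (𝓝 t) (𝓝 (L t * ‖y t - y t‖)) :=
      hL.mul (hy.sub_const _).norm
    rw [sub_self, norm_zero, mul_zero] at this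
    exact squeeze_zero_norm (fun s => hlip s _ _) this
  have h2 := h1.add hf
  simpa [ContinuousAt] using h2

/-- Global existence on the line for a bounded field, Lipschitz in the state with a locally bounded
constant `L t`, continuous in time off a countable set and vanishing for `t ≤ 0`. The Picard
operator is a contraction for the weight `exp (-2 ∫ L)`. -/
theorem exists_integral_solution {E : Type*} [NormedAddCommGroup E] [NormedSpace ℝ E]
    [CompleteSpace E] {f : ℝ → E → E} {L : ℝ → ℝ} {S : Set ℝ} (hS : S.Countable)
    (hLc : ∀ t, t ∉ S → ContinuousAt L t) (hLb : ∀ R, ∃ C, ∀ t, t ≤ R → ‖L t‖ ≤ C)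
    (hL0 : ∀ t, 0 ≤ L t) (hLneg : ∀ t ≤ 0, L t = 0)
    (hfc : ∀ y t, t ∉ S → ContinuousAt (fun s => f s y) t)
    (hlip : ∀ t y y', ‖f t y - f t y'‖ ≤ L t * ‖y - y'‖)
    (hfb : ∀ t y, ‖f t y‖ ≤ L t) (y₀ : E) :
    ∃ X : ℝ → E, X 0 = y₀ ∧ Continuous X ∧ ∀ t, t ∉ S → HasDerivAt X (f t (X t)) t := by
  have hLi : ∀ a b, IntervalIntegrable L volume a b :=
    intervalIntegrable_of_bound_off_countable hS hLc hLb
  have hcomp : ∀ y : ℝ → E, Continuous y → ∀ t, t ∉ S → ContinuousAt (fun s => f s (y s)) t :=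
    fun y hy t ht => continuousAt_comp_of_lipschitz (hLc t ht) (hfc _ t ht) hy.continuousAt hlip
  have hint : ∀ y : ℝ → E, Continuous y → ∀ a b,
      IntervalIntegrable (fun s => f s (y s)) volume a b := fun y hy =>
    intervalIntegrable_of_bound_off_countable hS (hcomp y hy) fun R => by
      obtain ⟨C, hC⟩ := hLb R
      exact ⟨C, fun t ht => (hfb _ _).trans ((le_abs_self _).trans (hC t ht))⟩
  set I : ℝ → ℝ := fun t => ∫ s in (0 : ℝ)..t, L s with hI
  have hIc : Continuous I := intervalIntegral.continuous_primitive hLi 0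
  have hI0 : ∀ t, 0 ≤ t → 0 ≤ I t := fun t ht =>
    intervalIntegral.integral_nonneg ht fun s _ => hL0 s
  have hIneg : ∀ t ≤ 0, I t = 0 := fun t ht => by
    have : EqOn L (fun _ => 0) (uIcc 0 t) := fun s hs => by
      rw [uIcc_of_ge ht] at hs; exact hLneg s hs.2
    simp only [hI]; rw [intervalIntegral.integral_congr this]; simp
  have hId : ∀ t, t ∉ S → HasDerivAt I (L t) t := fun t ht =>
    intervalIntegral.integral_hasDerivAt_right (hLi 0 t)
      ((aestronglyMeasurable_of_continuousAt_off_countable hS hLc).stronglyMeasurableAtFilter)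
      (hLc t ht)
  have hexp : ∀ t, 0 ≤ t → ∫ s in (0 : ℝ)..t, L s * Real.exp (2 * I s)
      = (Real.exp (2 * I t) - 1) / 2 := fun t ht => by
    have hc : Continuous fun s => Real.exp (2 * I s) / 2 := by fun_prop
    have := integral_eq_of_hasDerivAt_off_countable_of_le
      (fun s => Real.exp (2 * I s) / 2) (fun s => L s * Real.exp (2 * I s)) ht hS hc.continuousOn
      (fun s hs => ((((hId s hs.2).const_mul 2).exp).div_const 2).congr_deriv (by ring))
      ((hLi 0 t).mul_continuousOn (by fun_prop))
    rw [this]; simp [hI]; ring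
  have hpicc : ∀ y : ℝ → E, Continuous y →
      Continuous fun t => y₀ + ∫ s in (0 : ℝ)..t, f s (y s) := fun y hy =>
    continuous_const.add (intervalIntegral.continuous_primitive (hint y hy) 0)
  have hzero : ∀ y : ℝ → E, ∀ t ≤ 0, ∫ s in (0 : ℝ)..t, f s (y s) = 0 := fun y t ht => by
    have : EqOn (fun s => f s (y s)) (fun _ => 0) (uIcc 0 t) := fun s hs => by
      rw [uIcc_of_ge ht] at hs
      have := hfb s (y s)
      rw [hLneg s hs.2] at this
      simpa using this
    rw [intervalIntegral.integral_congr this]; simp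
  have hw : ∀ u : BoundedContinuousFunction ℝ E,
      Continuous fun s => Real.exp (2 * I s) • u s := fun u => by
    have := u.continuous; fun_prop
  have hIexp : ∀ t, Real.exp (-(2 * I t)) * I t ≤ 1 := fun t => by
    have h1 := Real.add_one_le_exp (2 * I t)
    have h2 : 0 ≤ I t := by
      rcases le_total 0 t with h | h
      · exact hI0 t h
      · rw [hIneg t h]
    rw [Real.exp_neg, inv_mul_le_iff₀ (Real.exp_pos _)]; linarith
  have hGb : ∀ (u : BoundedContinuousFunction ℝ E) t, ‖Real.exp (-(2 * I t)) •
      (y₀ + ∫ s in (0 : ℝ)..t, f s (Real.exp (2 * I s) • u s))‖ ≤ ‖y₀‖ + 1 := fun u t => by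
    have hI00 : 0 ≤ I t := by
      rcases le_total 0 t with h | h
      · exact hI0 t h
      · rw [hIneg t h]
    have hle : ‖∫ s in (0 : ℝ)..t, f s (Real.exp (2 * I s) • u s)‖ ≤ I t := by
      rcases le_total 0 t with h | h
      · exact intervalIntegral.norm_integral_le_of_norm_le h
          (Eventually.of_forall fun s _ => hfb s _) (hLi 0 t)
      · rw [hzero _ t h, norm_zero]; exact hI00
    rw [norm_smul, Real.norm_eq_abs, Real.abs_exp]
    have h1 : Real.exp (-(2 * I t)) ≤ 1 := Real.exp_le_one_iff.2 (by linarith)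
    calc _ ≤ Real.exp (-(2 * I t)) * (‖y₀‖ + I t) := by
          gcongr; exact (norm_add_le _ _).trans (by gcongr)
      _ ≤ _ := by
          rw [mul_add]
          have := mul_le_of_le_one_left (norm_nonneg y₀) h1
          linarith [hIexp t]
  -- the Picard operator for `y = exp (2 I) u`; the unknown `u` is bounded
  set G : BoundedContinuousFunction ℝ E → BoundedContinuousFunction ℝ E := fun u =>
    BoundedContinuousFunction.ofNormedAddCommGroup
      (fun t => Real.exp (-(2 * I t)) • (y₀ + ∫ s in (0 : ℝ)..t, f s (Real.exp (2 * I s) • u s)))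
      ((by fun_prop : Continuous fun t => Real.exp (-(2 * I t))).smul (hpicc _ (hw u)))
      (‖y₀‖ + 1) (hGb u) with hG
  have hcontr : ContractingWith (1 / 2) G := by
    refine ⟨by rw [← NNReal.coe_lt_coe]; norm_num, LipschitzWith.of_dist_le_mul fun u v => ?_⟩
    rw [BoundedContinuousFunction.dist_le (by positivity)]
    intro t
    simp only [hG, BoundedContinuousFunction.coe_ofNormedAddCommGroup, dist_eq_norm]
    rw [← smul_sub, add_sub_add_left_eq_sub,
      ← intervalIntegral.integral_sub (hint _ (hw u) _ _) (hint _ (hw v) _ _)]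
    rcases le_total 0 t with h | h
    · have h1 : ‖∫ s in (0 : ℝ)..t, (f s (Real.exp (2 * I s) • u s)
          - f s (Real.exp (2 * I s) • v s))‖
          ≤ ∫ s in (0 : ℝ)..t, (L s * Real.exp (2 * I s)) * ‖u - v‖ := by
        refine intervalIntegral.norm_integral_le_of_norm_le h
          (Eventually.of_forall fun s _ => ?_)
          (((hLi 0 t).mul_continuousOn (by fun_prop)).mul_const _)
        refine (hlip _ _ _).trans ?_
        rw [← smul_sub, norm_smul, Real.norm_eq_abs, Real.abs_exp, ← mul_assoc]
        have := hL0 s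
        gcongr
        exact (u - v).norm_coe_le_norm s
      rw [intervalIntegral.integral_mul_const, hexp t h] at h1
      rw [norm_smul, Real.norm_eq_abs, Real.abs_exp]
      calc _ ≤ Real.exp (-(2 * I t)) * ((Real.exp (2 * I t) - 1) / 2 * ‖u - v‖) := by gcongr
        _ = (1 - Real.exp (-(2 * I t))) / 2 * ‖u - v‖ := by
            rw [Real.exp_neg]; field_simp
        _ ≤ _ := by
            push_cast
            have := Real.exp_pos (-(2 * I t))
            gcongr
            linarith
    · rw [intervalIntegral.integral_sub (hint _ (hw u) _ _) (hint _ (hw v) _ _), hzero _ t h,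
        hzero _ t h]
      simp only [sub_self, smul_zero, norm_zero]
      positivity
  obtain ⟨u, hu⟩ : ∃ u, G u = u := ⟨_, hcontr.fixedPoint_isFixedPt⟩
  have hfix : ∀ t, Real.exp (2 * I t) • u t
      = y₀ + ∫ s in (0 : ℝ)..t, f s (Real.exp (2 * I s) • u s) := fun t => by
    conv_lhs => rw [← hu]
    simp only [hG, BoundedContinuousFunction.coe_ofNormedAddCommGroup]
    rw [smul_smul, ← Real.exp_add, add_neg_cancel, Real.exp_zero, one_smul]
  refine ⟨fun t => Real.exp (2 * I t) • u t, ?_, hw u, fun t ht => ?_⟩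
  · simp only; rw [hfix 0]; simp
  · have h1 : HasDerivAt (fun t => y₀ + ∫ s in (0 : ℝ)..t, f s (Real.exp (2 * I s) • u s))
        (f t (Real.exp (2 * I t) • u t)) t :=
      (intervalIntegral.integral_hasDerivAt_right (hint _ (hw u) 0 t)
        ((aestronglyMeasurable_of_continuousAt_off_countable hS
          (hcomp _ (hw u))).stronglyMeasurableAtFilter) (hcomp _ (hw u) t ht)).const_add _
    exact h1.congr_of_eventuallyEq (Eventually.of_forall hfix)

theorem continuousAt_ite_pos {F : Type*} [NormedAddCommGroup F] {g : ℝ → F} {S : Set ℝ}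
    (hg : ∀ t, 0 < t → t ∉ S → ContinuousAt g t) (t : ℝ) (ht : t ∉ S ∩ Ici 0 ∪ {0}) :
    ContinuousAt (fun s => if 0 < s then g s else 0) t := by
  have ht0 : t ≠ 0 := fun h => ht (Or.inr h)
  rcases ht0.lt_or_gt with h | h
  · refine (continuousAt_const (y := (0 : F))).congr ?_
    filter_upwards [Iio_mem_nhds h] with s hs
    rw [if_neg (not_lt.2 (le_of_lt hs))]
  · refine (hg t h fun hts => ht (Or.inl ⟨hts, h.le⟩)).congr ?_
    filter_upwards [Ioi_mem_nhds h] with s hs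
    rw [if_pos (mem_Ioi.1 hs)]

/-- Global existence on `[0, ∞)` for a field that is bounded by, and Lipschitz in the state with,
a locally bounded `L t`, and continuous in time off a locally finite set. -/
theorem exists_halfline_solution {E : Type*} [NormedAddCommGroup E] [NormedSpace ℝ E]
    [CompleteSpace E] {f : ℝ → E → E} {L : ℝ → ℝ} {S : Set ℝ} (hS : (S ∩ Ici 0).Countable)
    (hLc : ∀ t, 0 < t → t ∉ S → ContinuousAt L t) (hLb : ∀ R, ∃ C, ∀ t ∈ Icc 0 R, ‖L t‖ ≤ C)
    (hL0 : ∀ t, 0 ≤ t → 0 ≤ L t)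
    (hfc : ∀ y t, 0 < t → t ∉ S → ContinuousAt (fun s => f s y) t)
    (hlip : ∀ t, 0 ≤ t → ∀ y y', ‖f t y - f t y'‖ ≤ L t * ‖y - y'‖)
    (hfb : ∀ t, 0 ≤ t → ∀ y, ‖f t y‖ ≤ L t) (y₀ : E) :
    ∃ X : ℝ → E, X 0 = y₀ ∧ Continuous X ∧ ∀ t, 0 < t → t ∉ S → HasDerivAt X (f t (X t)) t := by
  have hS' : (S ∩ Ici 0 ∪ {0}).Countable := hS.union (countable_singleton 0)
  have hb : ∀ R, ∃ C, ∀ t, t ≤ R → ‖if 0 < t then L t else 0‖ ≤ C := fun R => by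
    obtain ⟨C, hC⟩ := hLb R
    refine ⟨max C 0, fun t ht => ?_⟩
    split_ifs with h
    · exact (hC t ⟨h.le, ht⟩).trans (le_max_left _ _)
    · simp
  have h0 : ∀ t, 0 ≤ if 0 < t then L t else 0 := fun t => by
    split_ifs with h
    exacts [hL0 t h.le, le_rfl]
  obtain ⟨X, h1, h2, h3⟩ := exists_integral_solution (f := fun t y => if 0 < t then f t y else 0)
    hS' (continuousAt_ite_pos hLc) hb h0 (fun t ht => if_neg (not_lt.2 ht))
    (fun y => continuousAt_ite_pos (hfc y))
    (fun t y y' => by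
      split_ifs with h
      · exact hlip t h.le y y'
      · simp)
    (fun t y => by
      split_ifs with h
      · exact hfb t h.le y
      · simp) y₀
  refine ⟨X, h1, h2, fun t ht htS => ?_⟩
  have := h3 t (by rintro (h | h); exacts [htS h.1, ht.ne' h])
  rwa [if_pos ht] at this

/-! ### Cutting off a field -/

/-- A smooth mapping on an open set agrees near a given compact subset with a bounded, globally
Lipschitz mapping. -/
theorem exists_bounded_lipschitz_eq_near_compact {E G : Type*} [NormedAddCommGroup E]
    [NormedSpace ℝ E] [FiniteDimensional ℝ E] [NormedAddCommGroup G] [NormedSpace ℝ G]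
    {O K : Set E} (hO : IsOpen O) (hK : IsCompact K) (hKO : K ⊆ O) {F : E → G}
    (hF : ContDiffOn ℝ ∞ F O) :
    ∃ (r : ℝ) (F' : E → G) (C : ℝ), 0 < r ∧ 0 ≤ C ∧ (∀ x, ‖F' x‖ ≤ C) ∧
      (∀ x y, ‖F' x - F' y‖ ≤ C * ‖x - y‖) ∧ ∀ k ∈ K, ∀ x, dist x k ≤ r → F' x = F x := by
  have : ProperSpace E := FiniteDimensional.proper_real E
  obtain ⟨δ, hδ, hδO⟩ := hK.exists_cthickening_subset_open hO hKO
  have hsub : cthickening (δ / 2) K ⊆ thickening δ K :=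
    cthickening_subset_thickening' hδ (by linarith) K
  obtain ⟨χ, hχ, -, hsupp, hone⟩ := exists_contMDiff_support_eq_eq_one_iff (n := (⊤ : ℕ∞)) 𝓘(ℝ, E)
    (isOpen_thickening (δ := δ) (E := K)) (isClosed_cthickening (δ := δ / 2) (E := K)) hsub
  rw [contMDiff_iff_contDiff] at hχ
  have hts : tsupport (fun x => χ x • F x) ⊆ cthickening δ K := by
    refine (closure_mono (Function.support_smul_subset_left χ F)).trans ?_
    rw [hsupp]
    exact closure_thickening_subset_cthickening δ K
  have hcs : HasCompactSupport (fun x => χ x • F x) :=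
    hK.cthickening.of_isClosed_subset (isClosed_tsupport _) hts
  have hsm : ContDiff ℝ ∞ (fun x => χ x • F x) := by
    refine contDiff_iff_contDiffAt.2 fun x => ?_
    by_cases hx : x ∈ tsupport (fun x => χ x • F x)
    · exact hχ.contDiffAt.smul (hF.contDiffAt (hO.mem_nhds (hδO (hts hx))))
    · exact contDiffAt_const.congr_of_eventuallyEq (notMem_tsupport_iff_eventuallyEq.1 hx)
  obtain ⟨C₁, hC₁⟩ := hcs.exists_bound_of_continuous hsm.continuous
  obtain ⟨C₂, hC₂⟩ := ContDiff.lipschitzWith_of_hasCompactSupport hcs hsm (by simp)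
  refine ⟨δ / 2, fun x => χ x • F x, max (max C₁ C₂) 0, by linarith, le_max_right _ _,
    fun x => (hC₁ x).trans ((le_max_left _ _).trans (le_max_left _ _)), fun x y => ?_,
    fun k hk x hx => ?_⟩
  · refine (hC₂.norm_sub_le x y).trans ?_
    gcongr
    exact (le_max_right _ _).trans (le_max_left _ _)
  · have : χ x = 1 := (hone x).1 (mem_cthickening_of_dist_le x k _ K hk hx)
    simp only [this, one_smul]

end Backstepping

namespace Backstepping

open Set Filter Topology

variable {n q : ℕ}

/-! ### Coordinates and dependence on initial blocks of coordinates -/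

theorem xc_add (p p' : Pt n q) (j : ℕ) : xc (p + p') j = xc p j + xc p' j := by
  unfold xc; split_ifs <;> simp

theorem xc_smul (c : ℝ) (p : Pt n q) (j : ℕ) : xc (c • p) j = c * xc p j := by
  unfold xc; split_ifs <;> simp

theorem bc_add (p p' : Pt n q) (j : ℕ) : bc (p + p') j = bc p j + bc p' j := by
  unfold bc; split_ifs <;> simp

theorem bc_smul (c : ℝ) (p : Pt n q) (j : ℕ) : bc (c • p) j = c * bc p j := by
  unfold bc; split_ifs <;> simp

theorem contDiff_xc (j : ℕ) : ContDiff ℝ ∞ fun p : Pt n q => xc p j := by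
  by_cases h : j - 1 < n
  · simp only [xc, dif_pos h]; fun_prop
  · simp only [xc, dif_neg h]; fun_prop

theorem contDiff_bc (j : ℕ) : ContDiff ℝ ∞ fun p : Pt n q => bc p j := by
  by_cases h : j < n + 1
  · simp only [bc, dif_pos h]; fun_prop
  · simp only [bc, dif_neg h]; fun_prop

theorem continuous_xc (j : ℕ) : Continuous fun p : Pt n q => xc p j := (contDiff_xc j).continuous

theorem continuous_bc (j : ℕ) : Continuous fun p : Pt n q => bc p j := (contDiff_bc j).continuous

theorem contDiff_xlow (i : ℕ) : ContDiff ℝ ∞ fun p : Pt n q => xlow p i :=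
  contDiff_pi.2 fun _ => contDiff_xc _

theorem contDiff_trunc (i : ℕ) : ContDiff ℝ ∞ fun p : Pt n q => trunc p i :=
  (contDiff_xlow i).prodMk ((contDiff_pi.2 fun _ => contDiff_bc _).prodMk
    (contDiff_snd.comp contDiff_snd))

/-- The points agree in `x₁, …, xᵢ`, in `β, …, β⁽ᵐ⁾` and in `θ̂`. -/
def Agree (i m : ℕ) (p p' : Pt n q) : Prop :=
  (∀ j, 1 ≤ j → j ≤ i → xc p j = xc p' j) ∧ (∀ j, j ≤ m → bc p j = bc p' j) ∧ p.2.2 = p'.2.2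

theorem Agree.mono {i m i' m' : ℕ} {p p' : Pt n q} (h : Agree i m p p') (hi : i' ≤ i)
    (hm : m' ≤ m) : Agree i' m' p p' :=
  ⟨fun j h1 h2 => h.1 j h1 (h2.trans hi), fun j h1 => h.2.1 j (h1.trans hm), h.2.2⟩

theorem Agree.symm {i m : ℕ} {p p' : Pt n q} (h : Agree i m p p') : Agree i m p' p :=
  ⟨fun j h1 h2 => (h.1 j h1 h2).symm, fun j h1 => (h.2.1 j h1).symm, h.2.2.symm⟩

/-- `f` is a function of `x₁, …, xᵢ`, `β, …, β⁽ᵐ⁾` and `θ̂` only. -/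
def DependsOn {F : Type*} (i m : ℕ) (f : Pt n q → F) : Prop :=
  ∀ p p', Agree i m p p' → f p = f p'

theorem DependsOn.fderiv {F : Type*} [NormedAddCommGroup F] [NormedSpace ℝ F] {i m : ℕ}
    {f : Pt n q → F} (h : DependsOn i m f) : DependsOn i m (fderiv ℝ f) := by
  intro p p' hp
  have h1 : (fun x => f (x + (p' - p))) = f := by
    funext x
    refine h _ _ ⟨fun j h1 h2 => ?_, fun j h1 => ?_, ?_⟩
    · have := hp.1 j h1 h2
      have h3 : xc (p + (p' - p)) j = xc p' j := by rw [add_sub_cancel]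
      rw [xc_add] at h3 ⊢; linarith
    · have := hp.2.1 j h1
      have h3 : bc (p + (p' - p)) j = bc p' j := by rw [add_sub_cancel]
      rw [bc_add] at h3 ⊢; linarith
    · simp [hp.2.2]
  have h2 := fderiv_comp_add_right (𝕜 := ℝ) (f := f) (x := p) (p' - p)
  rw [h1, add_sub_cancel] at h2
  exact h2

theorem fderiv_apply_eq_zero {E F : Type*} [NormedAddCommGroup E] [NormedSpace ℝ E]
    [NormedAddCommGroup F] [NormedSpace ℝ F] {f : E → F} {p v : E}
    (h : ∀ᶠ s : ℝ in 𝓝 0, f (p + s • v) = f p) : fderiv ℝ f p v = 0 := by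
  by_cases hd : DifferentiableAt ℝ f p
  · have h1 : HasLineDerivAt ℝ f (fderiv ℝ f p v) p v := hd.hasFDerivAt.hasLineDerivAt v
    have h2 : HasDerivAt (fun s : ℝ => f (p + s • v)) 0 0 :=
      (hasDerivAt_const (0 : ℝ) (f p)).congr_of_eventuallyEq h
    exact h1.unique h2
  · rw [fderiv_zero_of_not_differentiableAt hd]; rfl

theorem DependsOn.fderiv_apply_eq_zero {F : Type*} [NormedAddCommGroup F] [NormedSpace ℝ F]
    {i m : ℕ} {f : Pt n q → F} (h : DependsOn i m f) (p : Pt n q) {v : Pt n q}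
    (hv : Agree i m v 0) : _root_.fderiv ℝ f p v = 0 := by
  refine Backstepping.fderiv_apply_eq_zero (Eventually.of_forall fun s => h _ _ ⟨fun j h1 h2 => ?_,
    fun j h1 => ?_, ?_⟩)
  · have : xc v j = 0 := by rw [hv.1 j h1 h2]; simp [xc]
    rw [xc_add, xc_smul, this]; simp
  · have : bc v j = 0 := by rw [hv.2.1 j h1]; simp [bc]
    rw [bc_add, bc_smul, this]; simp
  · have := hv.2.2
    simp [this]

theorem xlow_congr {i m : ℕ} {p p' : Pt n q} (h : Agree i m p p') : xlow p i = xlow p' i :=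
  funext fun k => h.1 _ (by omega) (by omega)

theorem trunc_congr {i : ℕ} {p p' : Pt n q} (h : Agree i (i - 1) p p') : trunc p i = trunc p' i := by
  refine Prod.ext (xlow_congr h) (Prod.ext (funext fun k => h.2.1 _ (by omega)) h.2.2)

theorem xlow_eq_zero {i : ℕ} {p : Pt n q} (h : ∀ j, 1 ≤ j → j ≤ i → xc p j = 0) : xlow p i = 0 :=
  funext fun k => h _ (by omega) (by omega)

/-! ### The region -/

theorem continuous_psi {n : ℕ} {P : DesignData q} (hP : P.Valid n) : Continuous P.ψ :=
  hP.ψ_normalized.smooth.continuous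

theorem isOpen_region {P : DesignData q} (hP : P.Valid n) : IsOpen (region n P) :=
  (isOpen_lt continuous_const (continuous_bc 0)).inter
    (isOpen_lt ((continuous_psi hP).comp (continuous_xc 1)).abs (continuous_bc 0))

theorem mem_region_congr {P : DesignData q} {i m : ℕ} (hi : 1 ≤ i) {p p' : Pt n q}
    (h : Agree i m p p') (hp : p ∈ region n P) : p' ∈ region n P := by
  have h1 := h.1 1 le_rfl hi
  have h2 := h.2.1 0 (Nat.zero_le _)
  simpa only [region, Set.mem_ofPred_eq, h1, h2] using hp

theorem strictMono_psi {P : DesignData q} (hP : P.Valid n) : StrictMono P.ψ :=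
  strictMono_of_deriv_pos hP.ψ_normalized.deriv_pos

theorem den_pos {P : DesignData q} {p : Pt n q} (hp : p ∈ region n P) :
    0 < bc p 0 ^ 2 - P.ψ (xc p 1) ^ 2 := by
  have := sq_lt_sq' (by linarith [(abs_lt.1 hp.2).1]) (abs_lt.1 hp.2).2
  linarith

theorem Pif_pos {P : DesignData q} (hP : P.Valid n) {p : Pt n q} (hp : p ∈ region n P) :
    0 < Pif P p := by
  have h1 := den_pos hp
  have h2 := hp.1
  have h3 := hP.ψ_normalized.deriv_pos (xc p 1)
  unfold Pif
  positivity

theorem dslope_psi_pos {P : DesignData q} (hP : P.Valid n) (x : ℝ) : 0 < dslope P.ψ 0 x := by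
  rcases eq_or_ne x 0 with rfl | hx
  · rw [dslope_same]; exact hP.ψ_normalized.deriv_pos 0
  · rw [dslope_of_ne _ hx, slope_def_field, hP.ψ_normalized.map_zero, sub_zero, sub_zero]
    have h := strictMono_psi hP
    rcases hx.lt_or_gt with h1 | h1
    · have := h h1; rw [hP.ψ_normalized.map_zero] at this
      exact div_pos_of_neg_of_neg this h1
    · have := h h1; rw [hP.ψ_normalized.map_zero] at this
      exact div_pos this h1

theorem trunc_mem_region' {P : DesignData q} {p : Pt n q} (hp : p ∈ region n P) (i : ℕ) :
    trunc p i ∈ region' i P := fun _ => hp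

/-! ### Smoothness, dependence and zeros of the design functions -/

theorem contDiffOn_psi {P : DesignData q} (hP : P.Valid n) (s : Set (Pt n q)) :
    ContDiffOn ℝ ∞ (fun p : Pt n q => P.ψ (xc p 1)) s :=
  (hP.ψ_normalized.smooth.comp (contDiff_xc 1)).contDiffOn

theorem contDiffOn_den {P : DesignData q} (hP : P.Valid n) (s : Set (Pt n q)) :
    ContDiffOn ℝ ∞ (fun p : Pt n q => bc p 0 ^ 2 - P.ψ (xc p 1) ^ 2) s :=
  ((contDiff_bc 0).contDiffOn.pow 2).sub ((contDiffOn_psi hP s).pow 2)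

theorem contDiffOn_dpsi {P : DesignData q} (hP : P.Valid n) (s : Set (Pt n q)) :
    ContDiffOn ℝ ∞ (fun p : Pt n q => deriv P.ψ (xc p 1)) s :=
  ((contDiff_infty_iff_deriv.1 hP.ψ_normalized.smooth).2.comp (contDiff_xc 1)).contDiffOn

theorem contDiffOn_zOne {P : DesignData q} (hP : P.Valid n) :
    ContDiffOn ℝ ∞ (zOne P) (region n P) :=
  ((contDiff_bc 0).contDiffOn.mul (contDiffOn_psi hP _)).div (contDiffOn_den hP _)
    fun _ hp => (den_pos hp).ne'

theorem contDiffOn_Pif {P : DesignData q} (hP : P.Valid n) :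
    ContDiffOn ℝ ∞ (Pif P) (region n P) :=
  ((((contDiffOn_den hP _).mul (contDiff_bc 0).contDiffOn).mul (contDiffOn_dpsi hP _)).add
    (((contDiffOn_const.mul ((contDiffOn_psi hP _).pow 2)).mul (contDiffOn_dpsi hP _)).mul
      (contDiff_bc 0).contDiffOn)).div ((contDiffOn_den hP _).pow 2)
    fun _ hp => (pow_pos (den_pos hp) 2).ne'

theorem contDiffOn_Psif {P : DesignData q} (hP : P.Valid n) :
    ContDiffOn ℝ ∞ (Psif P) (region n P) :=
  ((((contDiff_bc 1).contDiffOn.mul (contDiffOn_psi hP _)).mul (contDiffOn_den hP _)).sub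
    (((contDiffOn_const.mul ((contDiff_bc 0).contDiffOn.pow 2)).mul
      (contDiff_bc 1).contDiffOn).mul (contDiffOn_psi hP _))).div ((contDiffOn_den hP _).pow 2)
    fun _ hp => (pow_pos (den_pos hp) 2).ne'

theorem contDiff_phi_line {P : DesignData q} (hn : 1 ≤ n) (hP : P.Valid n) :
    ContDiff ℝ ∞ fun s : ℝ => P.φ 1 (fun _ => s) :=
  (hP.φ_smooth 1 le_rfl hn).comp (contDiff_pi.2 fun _ => contDiff_id)

theorem contDiffOn_PhiOne {P : DesignData q} (hn : 1 ≤ n) (hP : P.Valid n) :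
    ContDiffOn ℝ ∞ (PhiOne P) (region n P) :=
  ((contDiff_dslope_zero (contDiff_phi_line hn hP)).comp (contDiff_xc 1)).contDiffOn

theorem contDiffOn_WOne {P : DesignData q} (hP : P.Valid n) :
    ContDiffOn ℝ ∞ (WOne P) (region n P) :=
  (contDiffOn_den hP _).div ((contDiff_bc 0).contDiffOn.mul
    ((contDiff_dslope_zero hP.ψ_normalized.smooth).comp (contDiff_xc 1)).contDiffOn)
    fun _ hp => (mul_pos hp.1 (dslope_psi_pos hP _)).ne'

theorem reg_one_eq {P : DesignData q} (hn : 1 ≤ n) (hP : P.Valid n) (p : Pt n q) :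
    reg P 1 p = xc p 1 • PhiOne P p := by
  have h0 : P.φ 1 (fun _ => (0 : ℝ)) = 0 := hP.φ_zero 1 le_rfl hn
  have h1 : xlow p 1 = fun _ => xc p 1 := funext fun k => by
    rw [Subsingleton.elim k 0]; rfl
  have := sub_smul_dslope (fun s : ℝ => P.φ 1 (fun _ => s)) 0 (xc p 1)
  rw [h0, sub_zero, sub_zero] at this
  rw [reg, h1, PhiOne, this]

/-- `x₁ = W₁ z₁`. -/
theorem xc_one_eq {P : DesignData q} (hP : P.Valid n) {p : Pt n q} (hp : p ∈ region n P) :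
    xc p 1 = WOne P p * zOne P p := by
  have h1 := (den_pos hp).ne'
  have h2 := hp.1.ne'
  have h3 := (dslope_psi_pos hP (xc p 1)).ne'
  have h4 : xc p 1 * dslope P.ψ 0 (xc p 1) = P.ψ (xc p 1) := by
    have := sub_smul_dslope P.ψ 0 (xc p 1)
    rw [hP.ψ_normalized.map_zero, sub_zero, sub_zero, smul_eq_mul] at this
    exact this
  unfold WOne zOne
  generalize bc p 0 ^ 2 - P.ψ (xc p 1) ^ 2 = D at h1 ⊢
  rw [← h4]
  field_simp

theorem contDiffOn_reg {P : DesignData q} (hP : P.Valid n) {i : ℕ} (h1 : 1 ≤ i) (hi : i ≤ n)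
    (s : Set (Pt n q)) : ContDiffOn ℝ ∞ (reg P i : Pt n q → Vec q) s :=
  ((hP.φ_smooth i h1 hi).comp (contDiff_xlow i)).contDiffOn

theorem reg_congr {P : DesignData q} {i m : ℕ} {p p' : Pt n q} (h : Agree i m p p') :
    reg P i p = reg P i p' := by
  rw [reg, reg, xlow_congr h]

theorem reg_eq_zero {P : DesignData q} (hP : P.Valid n) {i : ℕ} (h1 : 1 ≤ i) (hi : i ≤ n)
    {p : Pt n q} (h : ∀ j, 1 ≤ j → j ≤ i → xc p j = 0) : reg P i p = 0 := by
  rw [reg, xlow_eq_zero h, hP.φ_zero i h1 hi]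

theorem zOne_congr {P : DesignData q} {p p' : Pt n q} (h : Agree 1 0 p p') :
    zOne P p = zOne P p' := by
  simp only [zOne, h.1 1 le_rfl le_rfl, h.2.1 0 le_rfl]

theorem Pif_congr {P : DesignData q} {p p' : Pt n q} (h : Agree 1 0 p p') :
    Pif P p = Pif P p' := by
  simp only [Pif, h.1 1 le_rfl le_rfl, h.2.1 0 le_rfl]

theorem zOne_eq_zero {P : DesignData q} (hP : P.Valid n) {p : Pt n q} (h : xc p 1 = 0) :
    zOne P p = 0 := by simp [zOne, h, hP.ψ_normalized.map_zero]

theorem Psif_eq_zero {P : DesignData q} (hP : P.Valid n) {p : Pt n q} (h : xc p 1 = 0) :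
    Psif P p = 0 := by simp [Psif, h, hP.ψ_normalized.map_zero]

/-- The properties of a virtual control `αᵢ`: smooth on the region, a function of `x₁, …, xᵢ`,
`β, …, β⁽ⁱ⁾`, `θ̂`, and zero where `x₁ = … = xᵢ = 0`. -/
structure IsVirtualControl (P : DesignData q) (i : ℕ) (f : Pt n q → ℝ) : Prop where
  smooth : ContDiffOn ℝ ∞ f (region n P)
  dep : DependsOn i i f
  van : ∀ p ∈ region n P, (∀ j, 1 ≤ j → j ≤ i → xc p j = 0) → f p = 0

theorem IsVirtualControl.fderiv_apply_eq_zero {P : DesignData q} (hP : P.Valid n) {i : ℕ}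
    {f : Pt n q → ℝ} (hf : IsVirtualControl P i f) {p : Pt n q} (hp : p ∈ region n P)
    (h : ∀ j, 1 ≤ j → j ≤ i → xc p j = 0) {v : Pt n q} (hv : v.1 = 0) :
    _root_.fderiv ℝ f p v = 0 := by
  refine Backstepping.fderiv_apply_eq_zero ?_
  have h1 : Tendsto (fun s : ℝ => p + s • v) (𝓝 0) (𝓝 p) := by
    have : Continuous fun s : ℝ => p + s • v := by fun_prop
    simpa using this.tendsto 0
  filter_upwards [h1 ((isOpen_region hP).mem_nhds hp)] with s hs
  rw [hf.van p hp h, hf.van _ hs]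
  intro j hj1 hj2
  have : xc v j = 0 := by simp [xc, hv]
  rw [xc_add, xc_smul, h j hj1 hj2, this]; simp

theorem isVirtualControl_alphaOne {P : DesignData q} (hn : 1 ≤ n) (hP : P.Valid n) :
    IsVirtualControl P 1 (alphaOne P : Pt n q → ℝ) where
  smooth := by
    have hz : ContDiffOn ℝ ∞ (zetaOne P : Pt n q → ℝ) (region n P) :=
      contDiffOn_const.mul (((contDiffOn_const.add (((contDiffOn_const.mul
        (contDiffOn_Pif hP)).mul ((contDiffOn_PhiOne hn hP).norm_sq ℝ)).mul
        ((contDiffOn_WOne hP).pow 2))).add ((contDiffOn_Pif hP).mul contDiffOn_const)).add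
        contDiffOn_const)
    have hne : ∀ p ∈ region n P, Pif P p ≠ 0 := fun p hp => (Pif_pos hP hp).ne'
    exact ((((contDiffOn_const.div (contDiffOn_Pif hP) hne).neg.mul
      (contDiffOn_const.add hz)).mul (contDiffOn_zOne hP)).sub
      ((contDiffOn_Psif hP).div (contDiffOn_Pif hP) hne)).sub
      ((contDiffOn_reg hP le_rfl hn _).inner ℝ (contDiff_snd.comp contDiff_snd).contDiffOn)
  dep := by
    intro p p' h
    have h1 := h.1 1 le_rfl le_rfl
    have h2 := h.2.1 0 (by omega)
    have h3 := h.2.1 1 le_rfl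
    simp only [alphaOne, zetaOne, Pif_congr (P := P) (h.mono le_rfl (Nat.zero_le _)),
      zOne_congr (P := P) (h.mono le_rfl (Nat.zero_le _)), PhiOne, WOne, Psif, h1, h2, h3,
      reg_congr h, h.2.2]
  van := by
    intro p hp h
    have h1 := h 1 le_rfl le_rfl
    simp [alphaOne, zOne_eq_zero hP h1, Psif_eq_zero hP h1, reg_eq_zero hP le_rfl hn h]

theorem contDiff_gain (P : DesignData q) : ContDiff ℝ ∞ (gain P) :=
  (LinearMap.toContinuousLinearMap (Matrix.toEuclideanLin P.Γ)).contDiff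

theorem gain_zero (P : DesignData q) : gain P 0 = 0 := by simp [gain]

theorem gain_add (P : DesignData q) (v w : Vec q) : gain P (v + w) = gain P v + gain P w := by
  simp [gain]

theorem gain_smul (P : DesignData q) (c : ℝ) (w : Vec q) : gain P (c • w) = c • gain P w := by
  simp [gain]

theorem gain_sum (P : DesignData q) {ι : Type*} (s : Finset ι) (f : ι → Vec q) :
    gain P (∑ i ∈ s, f i) = ∑ i ∈ s, gain P (f i) := by
  simp [gain]

theorem contDiffOn_W_trunc {P : DesignData q} {W : Rows q} {i : ℕ}
    (hW : ContDiffOn ℝ ∞ (W i) (region' i P)) (k : Fin i) :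
    ContDiffOn ℝ ∞ (fun p => W i (trunc p i) k) (region n P) := by
  have : ContDiffOn ℝ ∞ (fun p => W i (trunc p i)) (region n P) :=
    hW.comp (contDiff_trunc i).contDiffOn fun p hp => trunc_mem_region' hp i
  exact contDiffOn_pi.1 this k

theorem contDiffOn_frobSq {P : DesignData q} {W : Rows q} {i : ℕ}
    (hW : ContDiffOn ℝ ∞ (W i) (region' i P)) : ContDiffOn ℝ ∞ (frobSq W i) (region n P) :=
  ContDiffOn.sum fun k _ => (contDiffOn_W_trunc hW k).norm_sq ℝ

theorem contDiffOn_zeta {P : DesignData q} {W : Rows q} {i : ℕ}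
    (hW : ContDiffOn ℝ ∞ (W i) (region' i P)) : ContDiffOn ℝ ∞ (zeta P W i) (region n P) :=
  contDiffOn_const.mul (((contDiffOn_const.mul (contDiffOn_frobSq hW)).add
    contDiffOn_const).add contDiffOn_const)

section Recursion

variable {P : DesignData q} (hP : P.Valid n) {a : ℕ → Pt n q → ℝ} {i : ℕ} (hi1 : 1 ≤ i)
  (hi : i ≤ n) (ha : ∀ j, 1 ≤ j → j < i → IsVirtualControl P j (a j))

include hP hi ha

omit hi in
theorem contDiffOn_fderiv_apply {j : ℕ} (hj1 : 1 ≤ j) (hj : j < i) {v : Pt n q → Pt n q}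
    (hv : ContDiffOn ℝ ∞ v (region n P)) :
    ContDiffOn ℝ ∞ (fun p => fderiv ℝ (a j) p (v p)) (region n P) :=
  ((ha j hj1 hj).smooth.fderiv_of_isOpen (isOpen_region hP) (by simp)).clm_apply hv

omit hi in
theorem contDiffOn_zf {k : ℕ} (hk1 : 1 ≤ k) (hk : k ≤ i) :
    ContDiffOn ℝ ∞ (zf P a k) (region n P) := by
  by_cases h : k = 1
  · subst h
    exact (contDiffOn_zOne hP).congr fun p _ => by simp [zf]
  · exact ((contDiff_xc k).contDiffOn.sub (ha (k - 1) (by omega) (by omega)).smooth).congr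
      fun p _ => by simp [zf, h]

omit hP hi in
theorem dependsOn_zf {k : ℕ} (hk1 : 1 ≤ k) (hk : k ≤ i) : DependsOn k (k - 1) (zf P a k) := by
  intro p p' h
  by_cases h1 : k = 1
  · subst h1; simp only [zf, if_true]; exact zOne_congr h
  · simp only [zf, if_neg h1]
    rw [h.1 k hk1 le_rfl,
      (ha (k - 1) (by omega) (by omega)).dep p p' (h.mono (by omega) le_rfl)]

omit hi in
theorem zf_eq_zero {k : ℕ} (hk1 : 1 ≤ k) (hk : k ≤ i) {p : Pt n q} (hp : p ∈ region n P)
    (h : ∀ j, 1 ≤ j → j ≤ k → xc p j = 0) : zf P a k p = 0 := by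
  by_cases h1 : k = 1
  · subst h1; simp only [zf, if_true]; exact zOne_eq_zero hP (h 1 le_rfl le_rfl)
  · simp only [zf, if_neg h1]
    rw [h k hk1 le_rfl, (ha (k - 1) (by omega) (by omega)).van p hp
      fun j hj1 hj => h j hj1 (by omega), sub_zero]

theorem contDiffOn_wf {k : ℕ} (hk1 : 2 ≤ k) (hk : k ≤ i) :
    ContDiffOn ℝ ∞ (wf P a k) (region n P) := by
  refine (contDiffOn_reg hP (by omega) (by omega) _).sub (ContDiffOn.sum fun j hj => ?_)
  rw [Finset.mem_Icc] at hj
  exact (contDiffOn_fderiv_apply hP ha (by omega) (by omega) contDiffOn_const).smul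
    (contDiffOn_reg hP (by omega) (by omega) _)

omit hP hi in
theorem dependsOn_wf {k : ℕ} (hk1 : 2 ≤ k) (hk : k ≤ i) : DependsOn k (k - 1) (wf P a k) := by
  intro p p' h
  simp only [wf, dx]
  rw [reg_congr h, (ha (k - 1) (by omega) (by omega)).dep.fderiv p p' (h.mono (by omega) le_rfl)]
  congr 1
  refine Finset.sum_congr rfl fun j hj => ?_
  rw [Finset.mem_Icc] at hj
  rw [reg_congr (h.mono (by omega) le_rfl : Agree j (k - 1) p p')]

omit ha in
theorem wf_eq_zero {k : ℕ} (hk1 : 1 ≤ k) (hk : k ≤ i) {p : Pt n q}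
    (h : ∀ j, 1 ≤ j → j ≤ k → xc p j = 0) : wf P a k p = 0 := by
  simp only [wf]
  rw [reg_eq_zero hP hk1 (by omega) h, Finset.sum_eq_zero, sub_zero]
  intro j hj
  rw [Finset.mem_Icc] at hj
  rw [reg_eq_zero hP hj.1 (by omega) fun l hl1 hl => h l hl1 (by omega), smul_zero]

include hi1 in
theorem contDiffOn_tau {k : ℕ} (hk : k ≤ i) : ContDiffOn ℝ ∞ (tau P a k) (region n P) := by
  refine (contDiff_gain P).comp_contDiffOn (((((contDiffOn_zOne hP).mul
    (contDiffOn_Pif hP)).mul (contDiff_xc 1).contDiffOn).smul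
    (contDiffOn_PhiOne (by omega) hP)).add (ContDiffOn.sum fun j hj => ?_))
  rw [Finset.mem_Icc] at hj
  exact (contDiffOn_zf hP ha (by omega) (by omega)).smul
    (contDiffOn_wf hP hi ha (by omega) (by omega))

omit hP hi in
theorem dependsOn_tau {k : ℕ} (hk1 : 1 ≤ k) (hk : k ≤ i) : DependsOn k (k - 1) (tau P a k) := by
  intro p p' h
  have h0 : Agree 1 0 p p' := h.mono hk1 (Nat.zero_le _)
  simp only [tau, PhiOne]
  rw [zOne_congr h0, Pif_congr h0, h0.1 1 le_rfl le_rfl]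
  congr 2
  refine Finset.sum_congr rfl fun j hj => ?_
  rw [Finset.mem_Icc] at hj
  rw [dependsOn_zf ha (by omega) (by omega) p p' (h.mono (by omega) (by omega)),
    dependsOn_wf ha (by omega) (by omega) p p' (h.mono (by omega) (by omega))]

omit ha in
theorem tau_eq_zero {k : ℕ} (hk1 : 1 ≤ k) (hk : k ≤ i) {p : Pt n q}
    (h : ∀ j, 1 ≤ j → j ≤ k → xc p j = 0) : tau P a k p = 0 := by
  simp only [tau]
  rw [zOne_eq_zero hP (h 1 le_rfl hk1), Finset.sum_eq_zero]
  · simp [gain_zero]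
  · intro j hj
    rw [Finset.mem_Icc] at hj
    rw [wf_eq_zero hP hi (by omega) (by omega) fun l hl1 hl => h l hl1 (by omega), smul_zero]

theorem isVirtualControl_alphaNext {W : Rows q} (hi2 : 2 ≤ i)
    (hW : ContDiffOn ℝ ∞ (W i) (region' i P)) : IsVirtualControl P i (alphaNext P W a i) where
  smooth := by
    have hz := contDiffOn_zf hP ha (by omega) le_rfl
    have hw := contDiffOn_wf hP hi ha hi2 le_rfl
    have hprev : ContDiffOn ℝ ∞ (zPrev P a i) (region n P) := by
      by_cases h : i = 2
      · exact ((contDiffOn_Pif hP).mul (contDiffOn_zOne hP)).congr fun p _ => by simp [zPrev, h]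
      · exact (contDiffOn_zf hP ha (k := i - 1) (by omega) (by omega)).congr
          fun p _ => by simp [zPrev, h]
    have hzeta : ContDiffOn ℝ ∞ (zeta P W i) (region n P) :=
      contDiffOn_zeta hW
    refine (((((hprev.neg.sub ((contDiffOn_const.add hzeta).mul hz)).sub
      (hw.inner ℝ (contDiff_snd.comp contDiff_snd).contDiffOn)).add
      (ContDiffOn.sum fun j hj => ?_)).add (ContDiffOn.sum fun j hj => ?_)).add
      (ContDiffOn.sum fun j hj => ?_)).add ?_
    · rw [Finset.mem_Icc] at hj
      exact (contDiffOn_fderiv_apply hP ha (by omega) (by omega) contDiffOn_const).mul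
        (contDiff_xc _).contDiffOn
    · exact (contDiffOn_fderiv_apply hP ha (by omega) (by omega) contDiffOn_const).mul
        (contDiff_bc _).contDiffOn
    · rw [Finset.mem_Icc] at hj
      exact contDiffOn_fderiv_apply hP ha (by omega) (by omega)
        (contDiffOn_const.prodMk (contDiffOn_const.prodMk ((contDiff_gain P).comp_contDiffOn
          ((contDiffOn_zf hP ha (by omega) (by omega)).smul hw))))
    · exact contDiffOn_fderiv_apply hP ha (by omega) (by omega)
        (contDiffOn_const.prodMk (contDiffOn_const.prodMk
          (contDiffOn_tau hP (by omega) hi ha le_rfl)))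
  dep := by
    intro p p' h
    have h' : Agree i (i - 1) p p' := h.mono le_rfl (by omega)
    have hprev : zPrev P a i p = zPrev P a i p' := by
      by_cases h2 : i = 2
      · simp only [zPrev, if_pos h2]
        rw [Pif_congr (h.mono (by omega) (Nat.zero_le _)),
          zOne_congr (h.mono (by omega) (Nat.zero_le _))]
      · simp only [zPrev, if_neg h2]
        exact dependsOn_zf ha (by omega) (by omega) p p' (h.mono (by omega) (by omega))
    have hd : ∀ j, 1 ≤ j → j < i → fderiv ℝ (a j) p = fderiv ℝ (a j) p' := fun j h1 h2 =>
      (ha j h1 h2).dep.fderiv p p' (h.mono (by omega) (by omega))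
    simp only [alphaNext, zeta, frobSq, dx, db, dth]
    rw [hprev, trunc_congr h', dependsOn_zf ha (by omega) le_rfl p p' h',
      dependsOn_wf ha hi2 le_rfl p p' h', dependsOn_tau ha (by omega) le_rfl p p' h', h.2.2,
      hd (i - 1) (by omega) (by omega)]
    congr 1
    congr 1
    · congr 1
      · congr 1
        refine Finset.sum_congr rfl fun j hj => ?_
        rw [Finset.mem_Icc] at hj
        rw [h.1 (j + 1) (by omega) (by omega)]
      · refine Finset.sum_congr rfl fun j hj => ?_
        rw [Finset.mem_range] at hj
        rw [h.2.1 (j + 1) (by omega)]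
    · refine Finset.sum_congr rfl fun j hj => ?_
      rw [Finset.mem_Icc] at hj
      rw [hd (j - 1) (by omega) (by omega),
        dependsOn_zf ha (by omega) (by omega) p p' (h.mono (by omega) (by omega))]
  van := by
    intro p hp h
    have hw := wf_eq_zero (a := a) hP hi (k := i) (by omega) le_rfl h
    have hprev : zPrev P a i p = 0 := by
      by_cases h2 : i = 2
      · simp [zPrev, h2, zOne_eq_zero hP (h 1 le_rfl (by omega))]
      · simp only [zPrev, if_neg h2]
        exact zf_eq_zero hP ha (by omega) (by omega) hp fun j h1 h3 => h j h1 (by omega)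
    have s1 : ∑ j ∈ Finset.Icc 1 (i - 1), dx j (a (i - 1)) p * xc p (j + 1) = 0 :=
      Finset.sum_eq_zero fun j hj => by
        rw [Finset.mem_Icc] at hj
        rw [h (j + 1) (by omega) (by omega), mul_zero]
    have s2 : ∑ j ∈ Finset.range i, db j (a (i - 1)) p * bc p (j + 1) = 0 :=
      Finset.sum_eq_zero fun j hj => by
        rw [db, (ha (i - 1) (by omega) (by omega)).fderiv_apply_eq_zero hP hp
          (fun j h1 h3 => h j h1 (by omega)) rfl, zero_mul]
    have hz : ∀ f : Pt n q → ℝ, dth f p 0 = 0 := fun f => (fderiv ℝ f p).map_zero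
    simp only [alphaNext]
    rw [hprev, zf_eq_zero hP ha (by omega) le_rfl hp h, hw, s1, s2,
      tau_eq_zero hP hi (by omega) le_rfl h]
    simp [hz, gain_zero]

end Recursion

/-! ### The recursion for the virtual controls -/

theorem zf_congr_family {P : DesignData q} {a a' : ℕ → Pt n q → ℝ} {i : ℕ}
    (h : ∀ j, 1 ≤ j → j < i → a j = a' j) {k : ℕ} (hk1 : 1 ≤ k) (hk : k ≤ i) :
    zf P a k = zf P a' k := by
  funext p
  by_cases h1 : k = 1
  · simp [zf, h1]
  · simp only [zf, if_neg h1]; rw [h (k - 1) (by omega) (by omega)]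

theorem wf_congr_family {P : DesignData q} {a a' : ℕ → Pt n q → ℝ} {i : ℕ}
    (h : ∀ j, 1 ≤ j → j < i → a j = a' j) {k : ℕ} (hk1 : 2 ≤ k) (hk : k ≤ i) :
    wf P a k = wf P a' k := by
  funext p
  simp only [wf]; rw [h (k - 1) (by omega) (by omega)]

theorem tau_congr_family {P : DesignData q} {a a' : ℕ → Pt n q → ℝ} {i : ℕ}
    (h : ∀ j, 1 ≤ j → j < i → a j = a' j) {k : ℕ} (hk : k ≤ i) :
    tau P a k = tau P a' k := by
  funext p
  simp only [tau]
  congr 2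
  refine Finset.sum_congr rfl fun j hj => ?_
  rw [Finset.mem_Icc] at hj
  rw [zf_congr_family h (by omega) (by omega : j ≤ i),
    wf_congr_family h (by omega) (by omega : j ≤ i)]

theorem alphaNext_congr_family {P : DesignData q} {W W' : Rows q} {a a' : ℕ → Pt n q → ℝ} {i : ℕ}
    (hi : 2 ≤ i) (h : ∀ j, 1 ≤ j → j < i → a j = a' j) (hW : W i = W' i) :
    alphaNext P W a i = alphaNext P W' a' i := by
  have hprev : zPrev P a i = zPrev P a' i := by
    funext p
    by_cases h2 : i = 2
    · simp [zPrev, h2]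
    · simp only [zPrev, if_neg h2]
      rw [zf_congr_family h (by omega) (by omega : i - 1 ≤ i)]
  have hzeta : zeta P W i = (zeta P W' i : Pt n q → ℝ) := by
    funext p; simp only [zeta, frobSq, hW]
  funext p
  simp only [alphaNext]
  rw [hprev, hzeta, zf_congr_family h (by omega) le_rfl, wf_congr_family h hi le_rfl,
    tau_congr_family h le_rfl, h (i - 1) (by omega) (by omega)]
  congr 2
  refine Finset.sum_congr rfl fun j hj => ?_
  rw [Finset.mem_Icc] at hj
  rw [h (j - 1) (by omega) (by omega), zf_congr_family h (by omega) (by omega : j ≤ i)]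

theorem table_of_le (P : DesignData q) (W : Rows q) {m j : ℕ} (h : j ≤ m) :
    (table P W m j : Pt n q → ℝ) = alpha P W j := by
  induction m with
  | zero => obtain rfl : j = 0 := by omega
            rfl
  | succ m ih =>
    rcases h.eq_or_lt with rfl | h
    · rfl
    · rw [table, Function.update_of_ne h.ne, ih (by omega)]

theorem alpha_one (P : DesignData q) (W : Rows q) :
    (alpha P W 1 : Pt n q → ℝ) = alphaOne P := by
  simp [alpha, table]

theorem alpha_eq_alphaNext (P : DesignData q) (W : Rows q) {i : ℕ} (hi : 2 ≤ i) :
    (alpha P W i : Pt n q → ℝ) = alphaNext P W (alpha P W) i := by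
  obtain ⟨m, rfl⟩ : ∃ m, i = m + 1 := ⟨i - 1, by omega⟩
  rw [alpha, table, Function.update_self, if_neg (by omega)]
  exact alphaNext_congr_family hi (fun j _ h2 => table_of_le P W (by omega)) rfl

theorem alpha_congr {P : DesignData q} {W W' : Rows q} {i : ℕ} (hi : 1 ≤ i)
    (h : ∀ j, 2 ≤ j → j ≤ i → W j = W' j) : (alpha P W i : Pt n q → ℝ) = alpha P W' i := by
  induction i using Nat.strong_induction_on with
  | _ i ih =>
    rcases hi.eq_or_lt with rfl | hi2
    · rw [alpha_one, alpha_one]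
    · rw [alpha_eq_alphaNext P W hi2, alpha_eq_alphaNext P W' hi2]
      exact alphaNext_congr_family hi2
        (fun j h1 h2 => ih j h2 h1 fun l hl1 hl => h l hl1 (by omega)) (h i hi2 le_rfl)

theorem isVirtualControl_alpha {P : DesignData q} (hP : P.Valid n) {W : Rows q} {i : ℕ}
    (hi1 : 1 ≤ i) (hi : i ≤ n) (hW : ∀ j, 2 ≤ j → j ≤ i → ContDiffOn ℝ ∞ (W j) (region' j P)) :
    IsVirtualControl P i (alpha P W i : Pt n q → ℝ) := by
  induction i using Nat.strong_induction_on with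
  | _ i ih =>
    rcases hi1.eq_or_lt with rfl | hi2
    · rw [alpha_one]; exact isVirtualControl_alphaOne hi hP
    · rw [alpha_eq_alphaNext P W hi2]
      exact isVirtualControl_alphaNext hP hi
        (fun j h1 h2 => ih j h2 h1 (by omega) fun l hl1 hl => hW l hl1 (by omega)) hi2
        (hW i hi2 le_rfl)

/-! ### Hadamard factorizations -/

/-- The unit vector of the coordinate `x_j`. -/
def ex (j : ℕ) : Pt n q := (fun k => if k.val + 1 = j then 1 else 0, 0, 0)

/-- The unit vector of the coordinate `β⁽ʲ⁾`. -/
def eb (j : ℕ) : Pt n q := (0, fun k => if k.val = j then 1 else 0, 0)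

theorem sum_fin_eq_sum_Icc {M : Type*} [AddCommMonoid M] (i : ℕ) (g : ℕ → M) :
    ∑ k : Fin i, g (k.val + 1) = ∑ j ∈ Finset.Icc 1 i, g j := by
  rw [Fin.sum_univ_eq_sum_range (fun k => g (k + 1)) i, Finset.range_eq_Ico,
    Finset.sum_Ico_add' g 0 i 1]
  rfl

theorem xc_val (p : Pt n q) (k : Fin n) : xc p (k.val + 1) = p.1 k := by
  simp [xc]

theorem bc_val (p : Pt n q) (k : Fin (n + 1)) : bc p k.val = p.2.1 k := by
  simp [bc, k.isLt]

theorem clm_apply_eq_sum {F : Type*} [NormedAddCommGroup F] [NormedSpace ℝ F]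
    (L : Pt n q →L[ℝ] F) (p : Pt n q) :
    L p = ∑ j ∈ Finset.Icc 1 n, xc p j • L (ex j)
      + ∑ j ∈ Finset.range (n + 1), bc p j • L (eb j) + L (0, 0, p.2.2) := by
  have h1 : p = ∑ k : Fin n, p.1 k • (ex (k.val + 1) : Pt n q)
      + ∑ k : Fin (n + 1), p.2.1 k • (eb k.val : Pt n q) + (0, 0, p.2.2) := by
    refine Prod.ext ?_ (Prod.ext ?_ ?_)
    · funext l
      simp [Prod.fst_sum, Finset.sum_apply, ex, eb, Fin.val_inj]
    · funext l
      simp [Prod.fst_sum, Prod.snd_sum, Finset.sum_apply, ex, eb, Fin.val_inj]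
    · simp [Prod.snd_sum, ex, eb]
  conv_lhs => rw [h1]
  rw [map_add, map_add, map_sum, map_sum, ← sum_fin_eq_sum_Icc n fun j => xc p j • L (ex j),
    ← Fin.sum_univ_eq_sum_range (fun j => bc p j • L (eb j)) (n + 1)]
  simp only [map_smul, xc_val, bc_val]

theorem agree_ex_zero {i m k : ℕ} (h : i < k) : Agree i m (ex k : Pt n q) 0 := by
  refine ⟨fun j h1 h2 => ?_, fun j _ => ?_, rfl⟩
  · simp only [xc, ex]
    split_ifs <;> first | omega | rfl
  · simp [bc, ex]

theorem agree_eb_zero {i m k : ℕ} (h : m < k) : Agree i m (eb k : Pt n q) 0 := by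
  refine ⟨fun j _ _ => ?_, fun j h2 => ?_, rfl⟩
  · simp [xc, eb]
  · simp only [bc, eb]
    split_ifs <;> first | omega | rfl

/-- Scaling of the state coordinates. The region is invariant for factors in `[0, 1]`. -/
def scaleX (y : Pt n q × ℝ) : Pt n q := (y.2 • y.1.1, y.1.2)

theorem contDiff_scaleX : ContDiff ℝ ∞ (scaleX : Pt n q × ℝ → Pt n q) :=
  (contDiff_snd.smul (contDiff_fst.comp contDiff_fst)).prodMk (contDiff_snd.comp contDiff_fst)

theorem xc_scaleX (y : Pt n q × ℝ) (j : ℕ) : xc (scaleX y) j = y.2 * xc y.1 j := by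
  unfold xc scaleX; split_ifs <;> simp

theorem scaleX_mem_region {P : DesignData q} (hP : P.Valid n) {p : Pt n q} (hp : p ∈ region n P)
    {s : ℝ} (hs : s ∈ Icc (0 : ℝ) 1) : scaleX (p, s) ∈ region n P := by
  refine ⟨hp.1, lt_of_le_of_lt ?_ hp.2⟩
  rw [xc_scaleX]
  simp only
  have hm := (strictMono_psi hP).monotone
  have h0 := hP.ψ_normalized.map_zero
  rcases le_total 0 (xc p 1) with h | h
  · have h1 : 0 ≤ P.ψ (s * xc p 1) := h0 ▸ hm (mul_nonneg hs.1 h)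
    have h2 := hm (mul_le_of_le_one_left h hs.2)
    rw [abs_of_nonneg h1, abs_of_nonneg (h1.trans h2)]; exact h2
  · have h1 : P.ψ (s * xc p 1) ≤ 0 := h0 ▸ hm (mul_nonpos_of_nonneg_of_nonpos hs.1 h)
    have h2 : P.ψ (xc p 1) ≤ P.ψ (s * xc p 1) := hm (by nlinarith [hs.1, hs.2])
    rw [abs_of_nonpos h1, abs_of_nonpos (h2.trans h1)]; linarith

/-- Hadamard's lemma in the state coordinates. -/
theorem exists_sum_xc_smul {F : Type} [NormedAddCommGroup F] [NormedSpace ℝ F] [CompleteSpace F]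
    {P : DesignData q} (hP : P.Valid n) {i m : ℕ} (hi : i ≤ n) {f : Pt n q → F}
    (hf : ContDiffOn ℝ ∞ f (region n P)) (hdep : DependsOn i m f)
    (hvan : ∀ p ∈ region n P, (∀ j, 1 ≤ j → j ≤ i → xc p j = 0) → f p = 0) :
    ∃ g : ℕ → Pt n q → F, (∀ k, ContDiffOn ℝ ∞ (g k) (region n P)) ∧
      (∀ k, DependsOn i m (g k)) ∧
      ∀ p ∈ region n P, f p = ∑ k ∈ Finset.Icc 1 i, xc p k • g k p := by
  have hO : IsOpen (scaleX ⁻¹' region n P) := (isOpen_region hP).preimage contDiff_scaleX.continuous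
  have hsub : region n P ×ˢ Icc (0 : ℝ) 1 ⊆ scaleX ⁻¹' region n P :=
    fun y hy => scaleX_mem_region hP hy.1 hy.2
  have hsm : ∀ v, ContDiffOn ℝ ∞ (fun y => fderiv ℝ f (scaleX y) v) (scaleX ⁻¹' region n P) :=
    fun v => ((hf.fderiv_of_isOpen (isOpen_region hP) (by simp)).comp contDiff_scaleX.contDiffOn
      fun y hy => hy).clm_apply contDiffOn_const
  refine ⟨fun k p => ∫ s in (0 : ℝ)..1, fderiv ℝ f (scaleX (p, s)) (ex k), fun k => ?_,
    fun k p p' h => ?_, fun p hp => ?_⟩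
  · exact contDiffOn_integral (isOpen_region hP) hO hsub (hsm (ex k))
  · have : ∀ s : ℝ, fderiv ℝ f (scaleX (p, s)) = fderiv ℝ f (scaleX (p', s)) := fun s => by
      refine hdep.fderiv _ _ ⟨fun j h1 h2 => ?_, h.2.1, h.2.2⟩
      rw [xc_scaleX, xc_scaleX]; simp only; rw [h.1 j h1 h2]
    simp only [this]
  · have hcont : ∀ v, ContinuousOn (fun s : ℝ => fderiv ℝ f (scaleX (p, s)) v) (Icc 0 1) :=
      fun v => (hsm v).continuousOn.comp (by fun_prop) fun s hs => hsub ⟨hp, hs⟩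
    have hint : ∀ v, IntervalIntegrable (fun s : ℝ => fderiv ℝ f (scaleX (p, s)) v)
        MeasureTheory.volume 0 1 := fun v => (hcont v).intervalIntegrable_of_Icc zero_le_one
    have hd : ∀ s ∈ uIcc (0 : ℝ) 1, HasDerivAt (fun s : ℝ => f (scaleX (p, s)))
        (fderiv ℝ f (scaleX (p, s)) (p.1, 0, 0)) s := fun s hs => by
      rw [uIcc_of_le zero_le_one] at hs
      have h1 : DifferentiableAt ℝ f (scaleX (p, s)) :=
        (hf.contDiffAt ((isOpen_region hP).mem_nhds (hsub ⟨hp, hs⟩))).differentiableAt (by simp)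
      have h2 : HasDerivAt (fun s : ℝ => scaleX (p, s)) (p.1, (0, 0)) s := by
        have : HasDerivAt (fun s : ℝ => (s • p.1, p.2)) ((1 : ℝ) • p.1, 0) s :=
          ((hasDerivAt_id s).smul_const p.1).prodMk (hasDerivAt_const s p.2)
        rw [one_smul] at this
        exact this
      exact h1.hasFDerivAt.comp_hasDerivAt s h2
    have h3 := intervalIntegral.integral_eq_sub_of_hasDerivAt hd (hint _)
    have h4 : f (scaleX (p, 0)) = 0 := hvan _ (hsub ⟨hp, by simp⟩) fun j _ _ => by
      rw [xc_scaleX]; simp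
    have h5 : scaleX (p, 1) = p := by simp [scaleX]
    rw [h4, h5, sub_zero] at h3
    rw [← h3]
    have h6 : ∀ s : ℝ, fderiv ℝ f (scaleX (p, s)) (p.1, 0, 0)
        = ∑ k ∈ Finset.Icc 1 i, xc p k • fderiv ℝ f (scaleX (p, s)) (ex k) := fun s => by
      rw [clm_apply_eq_sum]
      have e1 : ∑ j ∈ Finset.range (n + 1), bc ((p.1, 0, 0) : Pt n q) j •
          fderiv ℝ f (scaleX (p, s)) (eb j) = 0 := Finset.sum_eq_zero fun j _ => by
        simp [bc]
      have e2 : fderiv ℝ f (scaleX (p, s)) (0, 0, ((p.1, 0, 0) : Pt n q).2.2) = 0 :=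
        (fderiv ℝ f (scaleX (p, s))).map_zero
      rw [e1, e2, add_zero, add_zero]
      symm
      refine Finset.sum_subset (Finset.Icc_subset_Icc_right hi) fun j h1 h2 => ?_
      rw [Finset.mem_Icc] at h1 h2
      rw [hdep.fderiv_apply_eq_zero _ (agree_ex_zero (by omega)), smul_zero]
    simp only [h6]
    rw [intervalIntegral.integral_finsetSum
      (f := fun k (s : ℝ) => xc p k • fderiv ℝ f (scaleX (p, s)) (ex k))
      fun k _ => (hint (ex k)).smul (xc p k)]
    simp only [intervalIntegral.integral_smul]

/-- The state coordinates are combinations of the `z_j` with smooth coefficients. -/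
theorem exists_xc_eq_sum_zf {P : DesignData q} (hP : P.Valid n) {a : ℕ → Pt n q → ℝ} {i : ℕ}
    (hi : i ≤ n) (ha : ∀ j, 1 ≤ j → j < i → IsVirtualControl P j (a j)) {k : ℕ} (hk1 : 1 ≤ k)
    (hk : k ≤ i) :
    ∃ A : ℕ → Pt n q → ℝ, (∀ j, ContDiffOn ℝ ∞ (A j) (region n P)) ∧
      (∀ j, DependsOn k (k - 1) (A j)) ∧
      ∀ p ∈ region n P, xc p k = ∑ j ∈ Finset.Icc 1 i, zf P a j p * A j p := by
  induction k using Nat.strong_induction_on with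
  | _ k ih =>
    rcases hk1.eq_or_lt with rfl | hk2
    · refine ⟨fun j p => if j = 1 then WOne P p else 0, fun j => ?_, fun j p p' h => ?_,
        fun p hp => ?_⟩
      · by_cases h : j = 1
        · simp only [if_pos h]; exact contDiffOn_WOne hP
        · simp only [if_neg h]; exact contDiffOn_const
      · simp only [WOne, h.1 1 le_rfl le_rfl, h.2.1 0 le_rfl]
      · rw [Finset.sum_eq_single 1]
        · simp only [if_true, zf]; rw [xc_one_eq hP hp, mul_comm]
        · intro j _ hj; simp [hj]
        · intro h; simp [Finset.mem_Icc] at h; omega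
    · have hv := ha (k - 1) (by omega) (by omega)
      obtain ⟨g, hg1, hg2, hg3⟩ := exists_sum_xc_smul hP (by omega) hv.smooth hv.dep hv.van
      choose! A hA1 hA2 hA3 using fun l (h1 : l < k) (h2 : 1 ≤ l) => ih l h1 h2 (by omega)
      refine ⟨fun j p => (if j = k then 1 else 0) + ∑ l ∈ Finset.Icc 1 (k - 1), A l j p * g l p,
        fun j => ?_, fun j p p' h => ?_, fun p hp => ?_⟩
      · refine contDiffOn_const.add (ContDiffOn.sum fun l hl => ?_)
        rw [Finset.mem_Icc] at hl
        exact (hA1 l (by omega) (by omega) j).mul (hg1 l)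
      · simp only
        congr 1
        refine Finset.sum_congr rfl fun l hl => ?_
        rw [Finset.mem_Icc] at hl
        rw [hA2 l (by omega) (by omega) j p p' (h.mono (by omega) (by omega)),
          hg2 l p p' (h.mono (by omega) le_rfl)]
      · simp only [mul_add, Finset.sum_add_distrib]
        have h1 : ∑ j ∈ Finset.Icc 1 i, zf P a j p * (if j = k then 1 else 0) = zf P a k p := by
          rw [Finset.sum_eq_single k]
          · simp
          · intro j _ hj; simp [hj]
          · intro h; simp [Finset.mem_Icc] at h; omega
        have h2 : ∑ j ∈ Finset.Icc 1 i, zf P a j p * ∑ l ∈ Finset.Icc 1 (k - 1), A l j p * g l p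
            = a (k - 1) p := by
          rw [hg3 p hp]
          simp only [Finset.mul_sum]
          rw [Finset.sum_comm]
          refine Finset.sum_congr rfl fun l hl => ?_
          rw [Finset.mem_Icc] at hl
          rw [hA3 l (by omega) (by omega) p hp, smul_eq_mul, Finset.sum_mul]
          exact Finset.sum_congr rfl fun j _ => by ring
        rw [h1, h2]
        simp only [zf, if_neg (by omega : ¬ k = 1)]
        ring

/-- Smooth functions vanishing where `x₁ = … = xᵢ = 0` are smooth combinations of
`z₁, …, zᵢ`. -/
theorem exists_eq_sum_zf_smul {F : Type} [NormedAddCommGroup F] [NormedSpace ℝ F] [CompleteSpace F]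
    {P : DesignData q} (hP : P.Valid n) {a : ℕ → Pt n q → ℝ} {i m : ℕ} (hi : i ≤ n)
    (ha : ∀ j, 1 ≤ j → j < i → IsVirtualControl P j (a j)) (hm : i - 1 ≤ m) {f : Pt n q → F}
    (hf : ContDiffOn ℝ ∞ f (region n P)) (hdep : DependsOn i m f)
    (hvan : ∀ p ∈ region n P, (∀ j, 1 ≤ j → j ≤ i → xc p j = 0) → f p = 0) :
    ∃ G : ℕ → Pt n q → F, (∀ j, ContDiffOn ℝ ∞ (G j) (region n P)) ∧
      (∀ j, DependsOn i m (G j)) ∧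
      ∀ p ∈ region n P, f p = ∑ j ∈ Finset.Icc 1 i, zf P a j p • G j p := by
  obtain ⟨g, hg1, hg2, hg3⟩ := exists_sum_xc_smul hP hi hf hdep hvan
  choose! A hA1 hA2 hA3 using fun l (h1 : 1 ≤ l) (h2 : l ≤ i) => exists_xc_eq_sum_zf hP hi ha h1 h2
  refine ⟨fun j p => ∑ l ∈ Finset.Icc 1 i, A l j p • g l p, fun j => ?_, fun j p p' h => ?_,
    fun p hp => ?_⟩
  · refine ContDiffOn.sum fun l hl => ?_
    rw [Finset.mem_Icc] at hl
    exact (hA1 l hl.1 hl.2 j).smul (hg1 l)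
  · refine Finset.sum_congr rfl fun l hl => ?_
    rw [Finset.mem_Icc] at hl
    rw [hA2 l hl.1 hl.2 j p p' (h.mono (by omega) (by omega)), hg2 l p p' h]
  · rw [hg3 p hp]
    simp only [Finset.smul_sum]
    rw [Finset.sum_comm]
    refine Finset.sum_congr rfl fun l hl => ?_
    rw [Finset.mem_Icc] at hl
    rw [hA3 l hl.1 hl.2 p hp, Finset.sum_smul]
    exact Finset.sum_congr rfl fun j _ => by rw [smul_smul]

/-- Extension of a truncated argument by zeros. -/
def pad (n : ℕ) {i : ℕ} (r : Pt' i q) : Pt n q :=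
  (fun k => if h : k.val < i then r.1 ⟨k.val, h⟩ else 0,
    fun k => if h : k.val < i then r.2.1 ⟨k.val, h⟩ else 0, r.2.2)

theorem contDiff_pad {i : ℕ} : ContDiff ℝ ∞ (pad n : Pt' i q → Pt n q) := by
  refine ContDiff.prodMk (contDiff_pi.2 fun k => ?_) (ContDiff.prodMk (contDiff_pi.2 fun k => ?_)
    (contDiff_snd.comp contDiff_snd))
  · by_cases h : k.val < i
    · simp only [dif_pos h]; fun_prop
    · simp only [dif_neg h]; fun_prop
  · by_cases h : k.val < i
    · simp only [dif_pos h]; fun_prop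
    · simp only [dif_neg h]; fun_prop

theorem pad_mem_region {P : DesignData q} {i : ℕ} (hi1 : 1 ≤ i) (hi : i ≤ n) {r : Pt' i q}
    (hr : r ∈ region' i P) : pad n r ∈ region n P := by
  have h1 : bc (pad n r) 0 = r.2.1 ⟨0, hi1⟩ := by
    simp only [bc, pad]; rw [dif_pos (by omega), dif_pos (by omega)]
  have h2 : xc (pad n r) 1 = r.1 ⟨0, hi1⟩ := by
    simp only [xc, pad]; rw [dif_pos (by omega), dif_pos (by omega)]
  show 0 < bc (pad n r) 0 ∧ |P.ψ (xc (pad n r) 1)| < bc (pad n r) 0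
  rw [h1, h2]
  exact hr hi1

theorem agree_pad_trunc {i : ℕ} (hi1 : 1 ≤ i) (hi : i ≤ n) (p : Pt n q) :
    Agree i (i - 1) (pad n (trunc p i)) p := by
  refine ⟨fun j h1 h2 => ?_, fun j h1 => ?_, rfl⟩
  · have : j - 1 + 1 = j := by omega
    conv_lhs => rw [xc, dif_pos (by omega : j - 1 < n)]
    simp only [pad, trunc, xlow]
    rw [dif_pos (by omega), this]
  · conv_lhs => rw [bc, dif_pos (by omega : j < n + 1)]
    simp only [pad, trunc]
    rw [dif_pos (by omega)]

/-- The rows are chosen one step at a time: `wᵢ` involves `αᵢ₋₁`, which involves only the earlier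
`W_j`, so setting `Wᵢ` does not disturb the factorizations already obtained. -/
theorem exists_rows {P : DesignData q} (hP : P.Valid n) (m : ℕ) (hm : m ≤ n) :
    ∃ W : Rows q, ∀ i, 2 ≤ i → i ≤ m → ContDiffOn ℝ ∞ (W i) (region' i P) ∧
      ∀ p ∈ region n P,
        wf P (alpha P W) i p = ∑ k : Fin i, zf P (alpha P W) (k.val + 1) p • W i (trunc p i) k := by
  induction m with
  | zero => exact ⟨fun _ _ _ => 0, fun i h1 h2 => by omega⟩
  | succ m ih =>
    obtain ⟨W, hW⟩ := ih (by omega)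
    by_cases hm1 : m + 1 < 2
    · exact ⟨W, fun i h1 h2 => by omega⟩
    have ha : ∀ j, 1 ≤ j → j < m + 1 → IsVirtualControl P j (alpha P W j : Pt n q → ℝ) :=
      fun j h1 h2 => isVirtualControl_alpha hP h1 (by omega) fun l hl1 hl => (hW l hl1 (by omega)).1
    obtain ⟨G, hG1, hG2, hG3⟩ := exists_eq_sum_zf_smul hP hm ha (m := m) (by omega)
      (contDiffOn_wf hP hm ha (by omega) le_rfl) (dependsOn_wf ha (by omega) le_rfl)
      fun p _ h => wf_eq_zero hP hm (by omega) le_rfl h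
    set W' : Rows q := Function.update W (m + 1) fun r k => G (k.val + 1) (pad n r) with hW'
    have hold : ∀ j, j ≤ m → W' j = W j := fun j hj => Function.update_of_ne (by omega) _ _
    have hal : ∀ j, 1 ≤ j → j < m + 1 → (alpha P W' j : Pt n q → ℝ) = alpha P W j := fun j h1 h2 =>
      alpha_congr h1 fun l _ hl => hold l (by omega)
    refine ⟨W', fun i h1 h2 => ?_⟩
    rcases h2.eq_or_lt with rfl | h2
    · have hnew : W' (m + 1) = fun r k => G (k.val + 1) (pad n r) := Function.update_self _ _ _
      rw [hnew]
      refine ⟨contDiffOn_pi.2 fun k => (hG1 _).comp contDiff_pad.contDiffOn fun r hr =>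
        pad_mem_region (by omega) hm hr, fun p hp => ?_⟩
      rw [wf_congr_family hal h1 le_rfl, hG3 p hp,
        ← sum_fin_eq_sum_Icc (m + 1) fun j => zf P (alpha P W) j p • G j p]
      refine Finset.sum_congr rfl fun k _ => ?_
      show _ = _ • G (k.val + 1) (pad n (trunc p (m + 1)))
      rw [zf_congr_family hal (by omega) (by omega : k.val + 1 ≤ m + 1),
        hG2 _ _ p (agree_pad_trunc (by omega) hm p)]
    · rw [hold i (by omega)]
      refine ⟨(hW i h1 (by omega)).1, fun p hp => ?_⟩
      rw [wf_congr_family hal h1 h2.le, (hW i h1 (by omega)).2 p hp]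
      refine Finset.sum_congr rfl fun k _ => ?_
      rw [zf_congr_family hal (by omega) (by omega : k.val + 1 ≤ m + 1)]

/-- `Ω` is what the formula for a virtual control `αₙ` would give, up to sign and damping. -/
theorem Omega_eq (P : DesignData q) (W : Rows q) (p : Pt n q) :
    Omega P W p = -alphaNext P W (alpha P W) n p
      - (P.k n + zeta P W n p) * zf P (alpha P W) n p := by
  simp only [Omega, alphaNext]; ring

theorem Agree.eq {p p' : Pt n q} (h : Agree n n p p') : p = p' := by
  refine Prod.ext (funext fun k => ?_) (Prod.ext (funext fun k => ?_) h.2.2)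
  · rw [← xc_val, ← xc_val]; exact h.1 _ (by omega) (by omega)
  · rw [← bc_val, ← bc_val]; exact h.2.1 _ (by omega)

/-- The factors required by the design exist. -/
theorem exists_isFactorization (hn : 2 ≤ n) {P : DesignData q} (hP : P.Valid n) :
    ∃ (W : Rows q) (Ωb : Pt n q → Fin n → ℝ), IsFactorization n P W Ωb := by
  obtain ⟨W, hW⟩ := exists_rows hP n le_rfl
  have ha : ∀ j, 1 ≤ j → j < n → IsVirtualControl P j (alpha P W j : Pt n q → ℝ) :=
    fun j h1 h2 => isVirtualControl_alpha hP h1 (by omega) fun l hl1 hl => (hW l hl1 (by omega)).1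
  have hv := isVirtualControl_alphaNext hP le_rfl ha hn (hW n hn le_rfl).1
  have hsm : ContDiffOn ℝ ∞ (Omega P W) (region n P) :=
    (hv.smooth.neg.sub ((contDiffOn_const.add (contDiffOn_zeta (hW n hn le_rfl).1)).mul
      (contDiffOn_zf hP ha (by omega) le_rfl))).congr fun p _ => Omega_eq P W p
  obtain ⟨G, hG1, -, hG3⟩ := exists_eq_sum_zf_smul hP le_rfl ha (m := n) (by omega) hsm
    (fun p p' h => by rw [h.eq]) fun p hp h => by
      rw [Omega_eq, hv.van p hp h, zf_eq_zero hP ha (by omega) le_rfl hp h]; simp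
  refine ⟨W, fun p k => G (k.val + 1) p, fun i h1 h2 => (hW i h1 h2).1,
    fun i h1 h2 => (hW i h1 h2).2, contDiffOn_pi.2 fun k => hG1 _, fun p hp => ?_⟩
  rw [hG3 p hp, ← sum_fin_eq_sum_Icc n fun j => zf P (alpha P W) j p • G j p]
  exact Finset.sum_congr rfl fun k _ => by rw [smul_eq_mul, mul_comm]

/-! ### The algebra of the backstepping recursion -/

theorem sum_Icc_two_top {M : Type*} [AddCommMonoid M] (hn : 2 ≤ n) (g : ℕ → M) :
    ∑ k ∈ Finset.Icc 2 n, g k = ∑ k ∈ Finset.Icc 2 (n - 1), g k + g n := by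
  obtain ⟨m, rfl⟩ : ∃ m, n = m + 1 := ⟨n - 1, by omega⟩
  rw [Finset.sum_Icc_succ_top hn]; rfl

theorem sum_Icc_two_bot {M : Type*} [AddCommMonoid M] (hn : 2 ≤ n) (g : ℕ → M) :
    ∑ k ∈ Finset.Icc 2 n, g k = g 2 + ∑ k ∈ Finset.Icc 2 (n - 1), g (k + 1) := by
  obtain ⟨m, rfl⟩ : ∃ m, n = m + 2 := ⟨n - 2, by omega⟩
  induction m with
  | zero => simp
  | succ m ih =>
    rw [Finset.sum_Icc_succ_top (by omega), ih (by omega), sum_Icc_two_top (n := m + 1 + 2 - 1)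
      (by omega), add_assoc]
    rfl

theorem sum_Icc_one_eq {M : Type*} [AddCommMonoid M] {i : ℕ} (hi : 1 ≤ i) (g : ℕ → M) :
    ∑ k ∈ Finset.Icc 1 i, g k = g 1 + ∑ k ∈ Finset.Icc 2 i, g k := by
  rw [← Finset.add_sum_Ioc_eq_sum_Icc hi]; rfl

/-- `xⱼ'` along the plant, with plant parameter `θ` and last input `v = b u`. -/
noncomputable def xdot (P : DesignData q) (θ : Vec q) (v : ℝ) (j : ℕ) (p : Pt n q) : ℝ :=
  inner ℝ (reg P j p) θ + if j < n then xc p (j + 1) else v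

/-- The derivative of `z_k` along the closed loop. -/
noncomputable def zdot (P : DesignData q) (a : ℕ → Pt n q → ℝ) (θ : Vec q) (v : ℝ) (k : ℕ)
    (p : Pt n q) : ℝ :=
  if k = 1 then Pif P p * xdot P θ v 1 p + Psif P p
  else xdot P θ v k p - (∑ j ∈ Finset.Icc 1 (k - 1), dx j (a (k - 1)) p * xdot P θ v j p
    + ∑ j ∈ Finset.range k, db j (a (k - 1)) p * bc p (j + 1)
    + dth (a (k - 1)) p (tau P a n p))

/-- The couplings between different steps that come from the adaptation of `θ̂`. They are
antisymmetric, see `sum_zf_mul_coupling`. -/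
noncomputable def coupling (P : DesignData q) (a : ℕ → Pt n q → ℝ) (k : ℕ) (p : Pt n q) : ℝ :=
  ∑ j ∈ Finset.Icc 2 (k - 1), dth (a (j - 1)) p (gain P (zf P a j p • wf P a k p))
    - ∑ l ∈ Finset.Icc (k + 1) n, dth (a (k - 1)) p (gain P (zf P a l p • wf P a l p))

theorem dth_add (f : Pt n q → ℝ) (p : Pt n q) (v w : Vec q) :
    dth f p (v + w) = dth f p v + dth f p w := by
  simp only [dth]
  rw [← map_add]; simp

theorem dth_zero (f : Pt n q → ℝ) (p : Pt n q) : dth f p 0 = 0 := (fderiv ℝ f p).map_zero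

theorem dth_smul (f : Pt n q → ℝ) (p : Pt n q) (c : ℝ) (v : Vec q) :
    dth f p (c • v) = c * dth f p v := by
  simp only [dth]
  rw [← smul_eq_mul, ← map_smul]; simp

theorem dth_sum (f : Pt n q → ℝ) (p : Pt n q) {ι : Type*} (s : Finset ι) (g : ι → Vec q) :
    dth f p (∑ i ∈ s, g i) = ∑ i ∈ s, dth f p (g i) := by
  classical
  induction s using Finset.induction_on with
  | empty => simp [dth_zero]
  | insert i s hi ih => rw [Finset.sum_insert hi, Finset.sum_insert hi, dth_add, ih]

/-- In `∑ z_k · coupling_k` the pair of steps `j < k` contributes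
`z_k (∂α_{j-1}/∂θ̂) Γ z_j w_k` once with each sign. -/
theorem sum_zf_mul_coupling (P : DesignData q) (a : ℕ → Pt n q → ℝ) (p : Pt n q) :
    ∑ k ∈ Finset.Icc 2 n, zf P a k p * coupling P a k p = 0 := by
  simp only [coupling, gain_smul, dth_smul, mul_sub, Finset.mul_sum, Finset.sum_sub_distrib]
  rw [sub_eq_zero, Finset.sum_comm' (t' := Finset.Icc 2 n) (s' := fun j => Finset.Icc (j + 1) n)]
  · refine Finset.sum_congr rfl fun k _ => Finset.sum_congr rfl fun l _ => by ring
  · intro x y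
    simp only [Finset.mem_Icc]
    omega

theorem tau_eq_add (P : DesignData q) (a : ℕ → Pt n q → ℝ) {k : ℕ} (hk1 : 1 ≤ k) (hk : k ≤ n)
    (p : Pt n q) : tau P a n p
      = tau P a k p + ∑ l ∈ Finset.Icc (k + 1) n, gain P (zf P a l p • wf P a l p) := by
  have h : ∑ j ∈ Finset.Icc 2 n, zf P a j p • wf P a j p
      = ∑ j ∈ Finset.Icc 2 k, zf P a j p • wf P a j p
        + ∑ l ∈ Finset.Icc (k + 1) n, zf P a l p • wf P a l p := by
    have e1 : Finset.Icc 2 n = Finset.Ioc 1 n := rfl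
    have e2 : Finset.Icc 2 k = Finset.Ioc 1 k := rfl
    have e3 : Finset.Icc (k + 1) n = Finset.Ioc k n := by
      ext; simp only [Finset.mem_Icc, Finset.mem_Ioc]; omega
    rw [e1, e2, e3, ← Finset.Ioc_union_Ioc_eq_Ioc hk1 hk, Finset.sum_union]
    exact Finset.Ioc_disjoint_Ioc_of_le le_rfl
  simp only [tau]
  rw [h, ← add_assoc, gain_add, gain_sum]

theorem inner_wf (P : DesignData q) (a : ℕ → Pt n q → ℝ) (k : ℕ) (p : Pt n q) (θ : Vec q) :
    inner ℝ (wf P a k p) θ = inner ℝ (reg P k p) θ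
      - ∑ j ∈ Finset.Icc 1 (k - 1), dx j (a (k - 1)) p * inner ℝ (reg P j p) θ := by
  simp only [wf, inner_sub_left, sum_inner, real_inner_smul_left]

/-- The closed-loop derivative of `z_k`, `k ≥ 2`, in terms of the formula for `α_k`. -/
theorem zdot_eq (P : DesignData q) (W : Rows q) (a : ℕ → Pt n q → ℝ) (θ : Vec q) (v : ℝ) {k : ℕ}
    (hk1 : 2 ≤ k) (hk : k ≤ n) (p : Pt n q) :
    zdot P a θ v k p = inner ℝ (wf P a k p) (θ - p.2.2)
      + ((if k < n then xc p (k + 1) else v) - alphaNext P W a k p) - zPrev P a k p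
      - (P.k k + zeta P W k p) * zf P a k p + coupling P a k p := by
  have h1 : ∑ j ∈ Finset.Icc 1 (k - 1), dx j (a (k - 1)) p * xdot P θ v j p
      = ∑ j ∈ Finset.Icc 1 (k - 1), dx j (a (k - 1)) p * inner ℝ (reg P j p) θ
        + ∑ j ∈ Finset.Icc 1 (k - 1), dx j (a (k - 1)) p * xc p (j + 1) := by
    rw [← Finset.sum_add_distrib]
    refine Finset.sum_congr rfl fun j hj => ?_
    rw [Finset.mem_Icc] at hj
    rw [xdot, if_pos (by omega : j < n), mul_add]
  simp only [zdot, if_neg (by omega : ¬ k = 1), alphaNext, coupling]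
  rw [h1, tau_eq_add P a (by omega : 1 ≤ k) hk p, dth_add, dth_sum, inner_sub_right,
    inner_wf P a k p θ, xdot]
  ring

theorem zdot_one (hn : 2 ≤ n) {P : DesignData q} (hP : P.Valid n) (W : Rows q) (θ : Vec q) (v : ℝ)
    {p : Pt n q} (hp : p ∈ region n P) :
    zdot P (alpha P W) θ v 1 p = Pif P p * (inner ℝ (reg P 1 p) (θ - p.2.2) + zf P (alpha P W) 2 p)
      - (P.k 1 + zetaOne P p) * zOne P p := by
  have h := (Pif_pos hP hp).ne'
  have h2 : xc p (1 + 1) = zf P (alpha P W) 2 p + alphaOne P p := by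
    simp [zf, alpha_one]
  simp only [zdot, if_true, xdot, if_pos (by omega : 1 < n), h2, inner_sub_right, alphaOne]
  field_simp
  ring

/-- The sum of the `z_k z_k'` after the cancellations of the design. -/
theorem sum_zf_mul_zdot (hn : 2 ≤ n) {P : DesignData q} (hP : P.Valid n) (W : Rows q) (θ : Vec q)
    (v : ℝ) {p : Pt n q} (hp : p ∈ region n P) :
    ∑ k ∈ Finset.Icc 1 n, zf P (alpha P W) k p * zdot P (alpha P W) θ v k p
      = Pif P p * zOne P p * inner ℝ (reg P 1 p) (θ - p.2.2)
        + ∑ k ∈ Finset.Icc 2 n, zf P (alpha P W) k p * inner ℝ (wf P (alpha P W) k p) (θ - p.2.2)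
        - (P.k 1 + zetaOne P p) * zOne P p ^ 2
        - ∑ k ∈ Finset.Icc 2 n, (P.k k + zeta P W k p) * zf P (alpha P W) k p ^ 2
        + zf P (alpha P W) n p * (v + Omega P W p
          + (P.k n + zeta P W n p) * zf P (alpha P W) n p) := by
  set a : ℕ → Pt n q → ℝ := alpha P W with ha
  have hz1 : zf P a 1 p = zOne P p := by simp [zf]
  have e1 : ∑ k ∈ Finset.Icc 2 n, zf P a k p * zdot P a θ v k p
      = ∑ k ∈ Finset.Icc 2 n, zf P a k p * inner ℝ (wf P a k p) (θ - p.2.2)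
        + ∑ k ∈ Finset.Icc 2 n, zf P a k p *
            ((if k < n then xc p (k + 1) else v) - alphaNext P W a k p)
        - ∑ k ∈ Finset.Icc 2 n, zf P a k p * zPrev P a k p
        - ∑ k ∈ Finset.Icc 2 n, (P.k k + zeta P W k p) * zf P a k p ^ 2
        + ∑ k ∈ Finset.Icc 2 n, zf P a k p * coupling P a k p := by
    rw [← Finset.sum_add_distrib, ← Finset.sum_sub_distrib, ← Finset.sum_sub_distrib,
      ← Finset.sum_add_distrib]
    refine Finset.sum_congr rfl fun k hk => ?_
    rw [Finset.mem_Icc] at hk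
    rw [zdot_eq P W a θ v hk.1 hk.2]; ring
  have e2 : ∑ k ∈ Finset.Icc 2 n, zf P a k p *
      ((if k < n then xc p (k + 1) else v) - alphaNext P W a k p)
      = ∑ k ∈ Finset.Icc 2 (n - 1), zf P a k p * zf P a (k + 1) p
        + zf P a n p * (v - alphaNext P W a n p) := by
    rw [sum_Icc_two_top hn, if_neg (lt_irrefl n)]
    congr 1
    refine Finset.sum_congr rfl fun k hk => ?_
    rw [Finset.mem_Icc] at hk
    have : zf P a (k + 1) p = xc p (k + 1) - a k p := by
      rw [zf, if_neg (by omega : ¬ k + 1 = 1), Nat.add_sub_cancel]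
    rw [if_pos (by omega : k < n), this, ha, alpha_eq_alphaNext P W hk.1]
  have e3 : ∑ k ∈ Finset.Icc 2 n, zf P a k p * zPrev P a k p
      = zf P a 2 p * (Pif P p * zOne P p)
        + ∑ k ∈ Finset.Icc 2 (n - 1), zf P a k p * zf P a (k + 1) p := by
    rw [sum_Icc_two_bot hn]
    congr 1
    refine Finset.sum_congr rfl fun k hk => ?_
    rw [Finset.mem_Icc] at hk
    simp only [zPrev, if_neg (by omega : ¬ k + 1 = 2), Nat.add_sub_cancel]
    ring
  have e4 := Omega_eq P W p
  rw [sum_Icc_one_eq (by omega : 1 ≤ n), e1, e2, e3, sum_zf_mul_coupling P a p, ha,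
    zdot_one hn hP W θ v hp, ← ha, hz1]
  rw [← ha] at e4
  rw [e4]
  ring

/-- Young's inequality for a term `y ⟨∑ zₖ Wₖ, Δ⟩`. -/
theorem mul_inner_sum_le {ι : Type*} (s : Finset ι) (z : ι → ℝ) (w : ι → Vec q) (y δ : ℝ)
    (Δ : Vec q) (hΔ : ‖Δ‖ ≤ δ) :
    y * inner ℝ (∑ k ∈ s, z k • w k) Δ
      ≤ δ / 2 * (∑ k ∈ s, ‖w k‖ ^ 2) * y ^ 2 + δ / 2 * ∑ k ∈ s, z k ^ 2 := by
  rw [sum_inner, Finset.mul_sum, Finset.mul_sum, Finset.sum_mul, Finset.mul_sum,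
    ← Finset.sum_add_distrib]
  refine Finset.sum_le_sum fun k _ => ?_
  have h0 : 0 ≤ δ := (norm_nonneg Δ).trans hΔ
  have h1 : |inner ℝ (w k) Δ| ≤ ‖w k‖ * δ :=
    (abs_real_inner_le_norm _ _).trans (by gcongr)
  rw [real_inner_smul_left]
  calc y * (z k * inner ℝ (w k) Δ) ≤ |y * (z k * inner ℝ (w k) Δ)| := le_abs_self _
    _ = |y| * |z k| * |inner ℝ (w k) Δ| := by rw [abs_mul, abs_mul, mul_assoc]
    _ ≤ |y| * |z k| * (‖w k‖ * δ) := by gcongr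
    _ ≤ _ := by
      have e1 := sq_abs y
      have e2 := sq_abs (z k)
      have := mul_nonneg h0 (sq_nonneg (|y| * ‖w k‖ - |z k|))
      rw [← e1, ← e2]
      nlinarith [this]

theorem sum_Icc_sum_Icc_eq (hn : 2 ≤ n) (g : ℕ → ℝ) :
    ∑ k ∈ Finset.Icc 2 n, ∑ j ∈ Finset.Icc 1 k, g j
      = ((n : ℝ) - 1) * g 1 + ∑ j ∈ Finset.Icc 2 n, ((n : ℝ) + 1 - j) * g j := by
  have h1 : ∀ k ∈ Finset.Icc 2 n, ∑ j ∈ Finset.Icc 1 k, g j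
      = g 1 + ∑ j ∈ Finset.Icc 2 k, g j := fun k hk => by
    rw [Finset.mem_Icc] at hk; exact sum_Icc_one_eq (by omega) g
  rw [Finset.sum_congr rfl h1, Finset.sum_add_distrib, Finset.sum_const, Nat.card_Icc,
    Finset.sum_comm' (t' := Finset.Icc 2 n) (s' := fun j => Finset.Icc j n)
      (by intro x y; simp only [Finset.mem_Icc]; omega)]
  congr 1
  · rw [nsmul_eq_mul, Nat.cast_sub (by omega)]; push_cast; ring
  · refine Finset.sum_congr rfl fun j hj => ?_
    rw [Finset.mem_Icc] at hj
    rw [Finset.sum_const, Nat.card_Icc, nsmul_eq_mul, Nat.cast_sub (by omega)]; push_cast; ring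

theorem sign_facts {σ y : ℝ} (h0 : 0 < |y|) (hs : Real.sign y = σ) : σ * |y| = y ∧ σ ^ 2 = 1 := by
  rcases lt_trichotomy y 0 with h | h | h
  · rw [Real.sign_of_neg h] at hs
    subst hs; rw [abs_of_neg h]; constructor <;> ring
  · simp [h] at h0
  · rw [Real.sign_of_pos h] at hs
    subst hs; rw [abs_of_pos h]; constructor <;> ring

theorem kappa_pos (hn : 2 ≤ n) {P : DesignData q} (hP : P.Valid n) (hδ : 0 ≤ P.δ) (W : Rows q)
    (Ωb : Pt n q → Fin n → ℝ) (p : Pt n q) : 0 < kappa P W Ωb p := by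
  have h1 := hP.k_pos n (by omega) le_rfl
  have h2 := hP.ε_pos
  have h3 : 0 ≤ frobSq W n p := Finset.sum_nonneg fun k _ => sq_nonneg _
  have h4 : 0 ≤ ∑ k : Fin n, Ωb p k ^ 2 := Finset.sum_nonneg fun k _ => sq_nonneg _
  unfold kappa
  positivity

/-- The input term and the adaptation of `ρ̂`: only a lower bound of `|b|` is used. -/
theorem gain_term_le {b ρ κ z σ ℓ γ : ℝ} (hγ : 0 < γ) (hκ : 0 ≤ κ) (hℓ : 0 < |ℓ|)
    (hsℓ : Real.sign ℓ = σ) (hb : Real.sign b = σ) (hbℓ : |ℓ| ≤ |b|) (hρ : 0 < σ * ρ) :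
    z * (b * (ρ * (-κ * z))) + |ℓ| / γ * (ρ - 1 / ℓ) * (-γ * σ * z * (-κ * z)) ≤ -κ * z ^ 2 := by
  obtain ⟨h1, h2⟩ := sign_facts hℓ hsℓ
  obtain ⟨h3, -⟩ := sign_facts (hℓ.trans_le hbℓ) hb
  have hℓ0 : ℓ ≠ 0 := abs_pos.1 hℓ
  have e : z * (b * (ρ * (-κ * z))) + |ℓ| / γ * (ρ - 1 / ℓ) * (-γ * σ * z * (-κ * z))
      = κ * z ^ 2 * (-(b * ρ) + (σ * |ℓ|) * (ρ - 1 / ℓ)) := by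
    field_simp
  have h4 : ℓ * ρ ≤ b * ρ := by
    rw [← h1, ← h3]
    have := mul_le_mul_of_nonneg_right hbℓ hρ.le
    nlinarith
  have h5 : ℓ * (ρ - 1 / ℓ) = ℓ * ρ - 1 := by field_simp
  rw [e, h1, h5]
  have := mul_nonneg hκ (sq_nonneg z)
  nlinarith

/-- The dissipation inequality of the closed loop, as a pointwise statement. -/
theorem dissipation (hn : 2 ≤ n) {P : DesignData q} (hP : P.Valid n) {W : Rows q}
    {Ωb : Pt n q → Fin n → ℝ} (hF : IsFactorization n P W Ωb) {p : Pt n q} (hp : p ∈ region n P)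
    {θ ℓθ : Vec q} (hθ : ‖θ - ℓθ‖ ≤ P.δ) {b ℓb ρ : ℝ} (hℓ : 0 < |ℓb|)
    (hsℓ : Real.sign ℓb = P.sgn) (hb : Real.sign b = P.sgn) (hbℓ : |ℓb| ≤ |b|)
    (hρ : 0 < P.sgn * ρ) :
    ∑ k ∈ Finset.Icc 1 n, zf P (alpha P W) k p
        * zdot P (alpha P W) θ (b * (ρ * ubar P W Ωb p)) k p
      + inner ℝ (p.2.2 - ℓθ) ((zOne P p * Pif P p * xc p 1) • PhiOne P p
        + ∑ j ∈ Finset.Icc 2 n, zf P (alpha P W) j p • wf P (alpha P W) j p)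
      + |ℓb| / P.γ * (ρ - 1 / ℓb) * (-P.γ * P.sgn * zf P (alpha P W) n p * ubar P W Ωb p)
      ≤ -∑ k ∈ Finset.Icc 1 n, P.k k * zf P (alpha P W) k p ^ 2 := by
  have hδ : 0 ≤ P.δ := (norm_nonneg _).trans hθ
  have hε := hP.ε_pos
  rw [sum_zf_mul_zdot hn hP W θ _ hp]
  set z : ℕ → ℝ := fun k => zf P (alpha P W) k p with hz
  have hz1 : zOne P p = z 1 := by simp [hz, zf]
  have hgain := gain_term_le (z := z n) hP.γ_pos (kappa_pos hn hP hδ W Ωb p).le hℓ hsℓ hb hbℓ hρ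
  -- the uncertainty in the first step
  have hfirst : Pif P p * z 1 * inner ℝ (reg P 1 p) (θ - ℓθ)
      ≤ P.δ / 2 * (Pif P p * ‖PhiOne P p‖ ^ 2 * WOne P p ^ 2 + Pif P p) * z 1 ^ 2 := by
    have h1 := mul_inner_sum_le (q := q) {()} (fun _ => z 1) (fun _ => WOne P p • PhiOne P p)
      (z 1) P.δ (θ - ℓθ) hθ
    simp only [Finset.sum_singleton] at h1
    have h2 : z 1 • WOne P p • PhiOne P p = reg P 1 p := by
      rw [reg_one_eq (by omega) hP, smul_smul, mul_comm, ← hz1, ← xc_one_eq hP hp]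
    have h3 : ‖WOne P p • PhiOne P p‖ ^ 2 = ‖PhiOne P p‖ ^ 2 * WOne P p ^ 2 := by
      rw [norm_smul, mul_pow, Real.norm_eq_abs, sq_abs, mul_comm]
    rw [h2, h3] at h1
    have := mul_le_mul_of_nonneg_left h1 (Pif_pos hP hp).le
    nlinarith [this]
  -- the uncertainty in the later steps
  have hlater : ∑ k ∈ Finset.Icc 2 n, z k * inner ℝ (wf P (alpha P W) k p) (θ - ℓθ)
      ≤ P.δ / 2 * ∑ k ∈ Finset.Icc 2 n, frobSq W k p * z k ^ 2
        + P.δ / 2 * (((n : ℝ) - 1) * z 1 ^ 2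
          + ∑ j ∈ Finset.Icc 2 n, ((n : ℝ) + 1 - j) * z j ^ 2) := by
    rw [← sum_Icc_sum_Icc_eq hn fun j => z j ^ 2, Finset.mul_sum, Finset.mul_sum,
      ← Finset.sum_add_distrib]
    refine Finset.sum_le_sum fun k hk => ?_
    rw [Finset.mem_Icc] at hk
    rw [hF.W_eq k hk.1 hk.2 p hp, ← sum_fin_eq_sum_Icc k fun j => z j ^ 2, frobSq, ← mul_assoc]
    exact mul_inner_sum_le _ _ _ _ _ _ hθ
  -- the lumped term of the last step
  have hlast : z n * Omega P W p ≤ P.ε / 2 * (∑ k : Fin n, Ωb p k ^ 2) * z n ^ 2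
      + 1 / (2 * P.ε) * (z 1 ^ 2 + ∑ k ∈ Finset.Icc 2 n, z k ^ 2) := by
    rw [hF.Ω_eq p hp, ← sum_Icc_one_eq (by omega : 1 ≤ n) fun k => z k ^ 2,
      ← sum_fin_eq_sum_Icc n fun k => z k ^ 2, Finset.mul_sum, Finset.mul_sum, Finset.sum_mul,
      Finset.mul_sum, ← Finset.sum_add_distrib]
    refine Finset.sum_le_sum fun k _ => ?_
    have h1 := mul_nonneg (inv_nonneg.2 hε.le) (sq_nonneg (P.ε * (Ωb p k * z n) - z (k.val + 1)))
    have h2 : P.ε⁻¹ * (P.ε * (Ωb p k * z n) - z (k.val + 1)) ^ 2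
        = P.ε * (Ωb p k * z n) ^ 2 - 2 * (Ωb p k * z n) * z (k.val + 1)
          + P.ε⁻¹ * z (k.val + 1) ^ 2 := by field_simp; ring
    rw [h2] at h1
    have h3 : 1 / (2 * P.ε) = P.ε⁻¹ / 2 := by field_simp
    rw [h3]
    show z n * (Ωb p k * z (k.val + 1)) ≤ _
    nlinarith [h1]
  -- the damping
  have hzeta : ∑ k ∈ Finset.Icc 2 n, (P.k k + zeta P W k p) * z k ^ 2
      = ∑ k ∈ Finset.Icc 2 n, P.k k * z k ^ 2
        + P.δ / 2 * ∑ k ∈ Finset.Icc 2 n, frobSq W k p * z k ^ 2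
        + P.δ / 2 * ∑ j ∈ Finset.Icc 2 n, ((n : ℝ) + 1 - j) * z j ^ 2
        + 1 / (2 * P.ε) * ∑ k ∈ Finset.Icc 2 n, z k ^ 2 := by
    rw [Finset.mul_sum, Finset.mul_sum, Finset.mul_sum, ← Finset.sum_add_distrib,
      ← Finset.sum_add_distrib, ← Finset.sum_add_distrib]
    refine Finset.sum_congr rfl fun k _ => ?_
    rw [zeta]; field_simp; ring
  have hzeta1 : zetaOne P p * z 1 ^ 2 = 1 / (2 * P.ε) * z 1 ^ 2
      + P.δ / 2 * (Pif P p * ‖PhiOne P p‖ ^ 2 * WOne P p ^ 2 + Pif P p) * z 1 ^ 2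
      + P.δ / 2 * (((n : ℝ) - 1) * z 1 ^ 2) := by
    rw [zetaOne]; field_simp; ring
  have hkap : kappa P W Ωb p = P.k n + zeta P W n p + P.ε / 2 * ∑ k : Fin n, Ωb p k ^ 2 := by
    rw [kappa, zeta]; ring
  -- the estimation errors cancel
  have hin : ∀ w : Vec q, inner ℝ w (θ - p.2.2) = inner ℝ w (θ - ℓθ) - inner ℝ (p.2.2 - ℓθ) w :=
    fun w => by
      rw [real_inner_comm w (p.2.2 - ℓθ), ← inner_sub_right]; congr 1; abel
  have hcanc : Pif P p * z 1 * inner ℝ (reg P 1 p) (θ - p.2.2)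
      + ∑ k ∈ Finset.Icc 2 n, z k * inner ℝ (wf P (alpha P W) k p) (θ - p.2.2)
      + inner ℝ (p.2.2 - ℓθ) ((z 1 * Pif P p * xc p 1) • PhiOne P p
        + ∑ j ∈ Finset.Icc 2 n, z j • wf P (alpha P W) j p)
      = Pif P p * z 1 * inner ℝ (reg P 1 p) (θ - ℓθ)
        + ∑ k ∈ Finset.Icc 2 n, z k * inner ℝ (wf P (alpha P W) k p) (θ - ℓθ) := by
    simp only [hin, inner_add_right, inner_sum, mul_sub, Finset.sum_sub_distrib,
      real_inner_smul_right, reg_one_eq (by omega : 1 ≤ n) hP]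
    ring
  have hub : ubar P W Ωb p = -kappa P W Ωb p * z n := rfl
  rw [sum_Icc_one_eq (by omega : 1 ≤ n), hub]
  rw [hkap] at hgain ⊢
  have hz' : ∀ k, zf P (alpha P W) k p = z k := fun _ => rfl
  simp only [hz', hz1] at hcanc ⊢
  linarith [hcanc, hfirst, hlater, hlast, hzeta, hzeta1, hgain]

/-! ### Compactness of sublevel sets of the errors -/

/-- Points at a positive distance from the boundary of the region. -/
def innerRegion (P : DesignData q) (c m R : ℝ) : Set (Pt n q) :=
  {p | m ≤ bc p 0 ∧ |P.ψ (xc p 1)| ≤ c * bc p 0 ∧ ‖p‖ ≤ R}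

theorem isCompact_innerRegion {P : DesignData q} (hP : P.Valid n) (c m R : ℝ) :
    IsCompact (innerRegion P c m R : Set (Pt n q)) := by
  refine Metric.isCompact_of_isClosed_isBounded ?_ ?_
  · exact (isClosed_le continuous_const (continuous_bc 0)).inter
      ((isClosed_le ((continuous_psi hP).comp (continuous_xc 1)).abs
        (continuous_const.mul (continuous_bc 0))).inter
        (isClosed_le continuous_norm continuous_const))
  · refine (Metric.isBounded_closedBall (x := (0 : Pt n q)) (r := R)).subset fun p hp => ?_
    rw [mem_closedBall_zero_iff]; exact hp.2.2

theorem innerRegion_subset_region {P : DesignData q} {c m : ℝ} (hc : c < 1) (hm : 0 < m) (R : ℝ) :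
    (innerRegion P c m R : Set (Pt n q)) ⊆ region n P := fun p hp => by
  have h0 : 0 < bc p 0 := hm.trans_le hp.1
  exact ⟨h0, hp.2.1.trans_lt (by nlinarith)⟩

theorem abs_psi_le_of_zOne_le {P : DesignData q} {p : Pt n q} (hp : p ∈ region n P) {M : ℝ}
    (hM : 0 ≤ M) (hz : |zOne P p| ≤ M) : |P.ψ (xc p 1)| ≤ 2 * M / (1 + 2 * M) * bc p 0 := by
  have h0 := hp.1
  have hD := den_pos hp
  rw [zOne, abs_div, abs_mul, abs_of_pos h0, abs_of_pos hD, div_le_iff₀ hD,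
    ← sq_abs (P.ψ (xc p 1))] at hz
  have h1 := hp.2
  have h2 := abs_nonneg (P.ψ (xc p 1))
  set y := |P.ψ (xc p 1)|
  set B := bc p 0
  rw [div_mul_eq_mul_div, le_div_iff₀ (by positivity)]
  have h3 : M * (B ^ 2 - y ^ 2) ≤ M * (2 * B * (B - y)) :=
    mul_le_mul_of_nonneg_left (by nlinarith) hM
  have h4 : B * y ≤ B * (2 * M * (B - y)) := by nlinarith
  have := le_of_mul_le_mul_left h4 h0
  linarith

theorem exists_abs_le_of_psi_le {P : DesignData q} (hP : P.Valid n) {c : ℝ} (hc : c < 1) :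
    ∃ R, ∀ x, |P.ψ x| ≤ c → |x| ≤ R := by
  have hm := strictMono_psi hP
  obtain ⟨r₁, h1⟩ := (hP.ψ_normalized.limit_top.eventually_const_lt hc).exists
  obtain ⟨r₂, h2⟩ := (hP.ψ_normalized.limit_bot.eventually_lt_const
    (by linarith : (-1 : ℝ) < -c)).exists
  refine ⟨max |r₁| |r₂|, fun x hx => ?_⟩
  obtain ⟨h3, h4⟩ := abs_le.1 hx
  have h5 : x < r₁ := hm.lt_iff_lt.1 (h4.trans_lt h1)
  have h6 : r₂ < x := hm.lt_iff_lt.1 (h2.trans_le h3)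
  exact abs_le_max_abs_abs h6.le h5.le |>.trans (by rw [max_comm])

theorem norm_le_of_xc_le {p : Pt n q} {R : ℝ} (h : ‖p.2‖ ≤ R)
    (hx : ∀ j, 1 ≤ j → j ≤ n → |xc p j| ≤ R) : ‖p‖ ≤ R := by
  have hR : 0 ≤ R := (norm_nonneg _).trans h
  refine max_le ((pi_norm_le_iff_of_nonneg hR).2 fun k => ?_) h
  rw [← xc_val]; exact hx _ (by omega) (by omega)

/-- Points of the region with bounded errors `z₁, …, zₙ` stay in a compact part of it. -/
theorem exists_compact_of_zf_le (hn : 2 ≤ n) {P : DesignData q} (hP : P.Valid n)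
    {a : ℕ → Pt n q → ℝ} (ha : ∀ j, 1 ≤ j → j < n → IsVirtualControl P j (a j)) {m : ℝ}
    (hm : 0 < m) (M : ℝ) :
    ∃ K : Set (Pt n q), IsCompact K ∧ K ⊆ region n P ∧ ∀ p ∈ region n P, m ≤ bc p 0 → bc p 0 ≤ 1 →
      ‖p.2‖ ≤ M → (∀ k, 1 ≤ k → k ≤ n → |zf P a k p| ≤ M) → p ∈ K := by
  rcases lt_or_ge M 0 with hM | hM
  · exact ⟨∅, isCompact_empty, empty_subset _, fun p _ _ _ h _ =>
      absurd ((norm_nonneg _).trans h) (not_le.2 hM)⟩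
  set c := 2 * M / (1 + 2 * M) with hc
  have hc1 : c < 1 := by rw [hc, div_lt_one (by positivity)]; linarith
  have hc0 : 0 ≤ c := by positivity
  have hpsi : ∀ p ∈ region n P, (∀ k, 1 ≤ k → k ≤ n → |zf P a k p| ≤ M) →
      |P.ψ (xc p 1)| ≤ c * bc p 0 := fun p hp hz =>
    abs_psi_le_of_zOne_le hp hM (by simpa [zf] using hz 1 le_rfl (by omega))
  have key : ∀ k, 1 ≤ k → k ≤ n → ∃ R, M ≤ R ∧ ∀ p ∈ region n P, m ≤ bc p 0 → bc p 0 ≤ 1 →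
      ‖p.2‖ ≤ M → (∀ k, 1 ≤ k → k ≤ n → |zf P a k p| ≤ M) →
      ∀ j, 1 ≤ j → j ≤ k → |xc p j| ≤ R := by
    intro k hk1
    induction k, hk1 using Nat.le_induction with
    | base =>
      intro _
      obtain ⟨R, hR⟩ := exists_abs_le_of_psi_le hP hc1
      refine ⟨max R M, le_max_right _ _, fun p hp _ hB1 _ hz j h1 h2 => ?_⟩
      obtain rfl : j = 1 := by omega
      refine (hR _ ((hpsi p hp hz).trans ?_)).trans (le_max_left _ _)
      nlinarith [hp.1]
    | succ k hk1 ih =>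
      intro hk
      obtain ⟨R, hMR, hR⟩ := ih (by omega)
      obtain ⟨C, hC⟩ := (isCompact_innerRegion (n := n) hP c m R).exists_bound_of_continuousOn
        ((ha k hk1 (by omega)).smooth.continuousOn.mono (innerRegion_subset_region hc1 hm R))
      refine ⟨max R (M + C), hMR.trans (le_max_left _ _), fun p hp hB0 hB1 h2 hz j h1 hj => ?_⟩
      rcases Nat.lt_or_ge k j with hkj | hkj
      · obtain rfl : j = k + 1 := by omega
        -- `α_k` is evaluated at the point whose coordinates after `x_k` are zero
        set p' : Pt n q := (fun l => if l.val + 1 ≤ k then p.1 l else 0, p.2) with hp'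
        have hag : Agree k k p p' := by
          refine ⟨fun l hl1 hl => ?_, fun l _ => rfl, rfl⟩
          simp only [xc, hp']
          split_ifs with h3 h4
          · rfl
          · exfalso; omega
          · rfl
        have hp'R : p' ∈ innerRegion P c m R := by
          refine ⟨hB0, ?_, norm_le_of_xc_le (h2.trans hMR) fun l hl1 hl => ?_⟩
          · have h3 : xc p' 1 = xc p 1 := (hag.1 1 le_rfl hk1).symm
            rw [h3]; exact hpsi p hp hz
          · rcases Nat.lt_or_ge k l with hkl | hkl
            · have : xc p' l = 0 := by
                simp only [xc, hp']
                split_ifs with h3 h4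
                · exfalso; omega
                · rfl
                · rfl
              rw [this, abs_zero]; exact hM.trans hMR
            · rw [← hag.1 l hl1 hkl]; exact hR p hp hB0 hB1 h2 hz l hl1 hkl
        have h3 : |a k p| ≤ C := by
          rw [(ha k hk1 (by omega)).dep p p' hag]; exact hC p' hp'R
        have h4 : xc p (k + 1) = zf P a (k + 1) p + a k p := by
          rw [zf, if_neg (by omega : ¬ k + 1 = 1), Nat.add_sub_cancel]; ring
        rw [h4]
        exact (abs_add_le _ _).trans ((add_le_add (hz _ (by omega) hk) h3).trans (le_max_right _ _))
      · exact (hR p hp hB0 hB1 h2 hz j h1 hkj).trans (le_max_left _ _)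
  obtain ⟨R, hMR, hR⟩ := key n (by omega) le_rfl
  exact ⟨_, isCompact_innerRegion hP c m R, innerRegion_subset_region hc1 hm R,
    fun p hp hB0 hB1 h2 hz => ⟨hB0, hpsi p hp hz,
      norm_le_of_xc_le (h2.trans hMR) (hR p hp hB0 hB1 h2 hz)⟩⟩

theorem continuousOn_sum_zf_sq {P : DesignData q} (hP : P.Valid n)
    {a : ℕ → Pt n q → ℝ} (ha : ∀ j, 1 ≤ j → j < n → IsVirtualControl P j (a j)) :
    ContinuousOn (fun p => ∑ k ∈ Finset.Icc 1 n, zf P a k p ^ 2) (region n P) :=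
  continuousOn_finsetSum _ fun k hk => by
    rw [Finset.mem_Icc] at hk
    exact (contDiffOn_zf hP ha hk.1 hk.2).continuousOn.pow 2

/-- Small errors mean a small state, uniformly on compact sets. -/
theorem exists_norm_lt_of_sum_zf_sq_lt {P : DesignData q} (hP : P.Valid n)
    {a : ℕ → Pt n q → ℝ} (ha : ∀ j, 1 ≤ j → j < n → IsVirtualControl P j (a j))
    {K : Set (Pt n q)} (hK : IsCompact K) (hKr : K ⊆ region n P) {r : ℝ} (hr : 0 < r) :
    ∃ μ, 0 < μ ∧ ∀ p ∈ K, ∑ k ∈ Finset.Icc 1 n, zf P a k p ^ 2 < μ → ‖p.1‖ < r := by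
  have hK' : IsCompact (K ∩ {p | r ≤ ‖p.1‖}) :=
    hK.inter_right (isClosed_le continuous_const (continuous_fst.norm))
  rcases (K ∩ {p | r ≤ ‖p.1‖}).eq_empty_or_nonempty with h | h
  · refine ⟨1, one_pos, fun p hp _ => ?_⟩
    by_contra hcon
    exact notMem_empty p (h ▸ ⟨hp, not_lt.1 hcon⟩)
  · obtain ⟨p₀, hp₀, hmin⟩ := hK'.exists_isMinOn h
      ((continuousOn_sum_zf_sq hP ha).mono (inter_subset_left.trans hKr))
    have hnn : ∀ k ∈ Finset.Icc 1 n, 0 ≤ zf P a k p₀ ^ 2 := fun k _ => sq_nonneg _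
    refine ⟨_, (Finset.sum_nonneg hnn).lt_of_ne fun h0 => ?_, fun p hp hlt => ?_⟩
    · have hz : ∀ k ∈ Finset.Icc 1 n, zf P a k p₀ = 0 := fun k hk => by
        have := (Finset.sum_eq_zero_iff_of_nonneg hnn).1 h0.symm k hk
        exact pow_eq_zero_iff two_ne_zero |>.1 this
      have hx : p₀.1 = 0 := funext fun k => by
        obtain ⟨A, -, -, hA⟩ := exists_xc_eq_sum_zf hP le_rfl ha (k := k.val + 1) (by omega)
          (by omega)
        rw [← xc_val, hA p₀ (hKr hp₀.1), Finset.sum_eq_zero fun j hj => by rw [hz j hj, zero_mul]]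
        rfl
      have : r ≤ ‖p₀.1‖ := hp₀.2
      rw [hx, norm_zero] at this
      linarith
    · by_contra hcon
      exact absurd (hmin ⟨hp, not_lt.1 hcon⟩) (not_le.2 hlt)

/-- On compact sets the update law for `θ̂` is quadratically small in the errors. -/
theorem exists_norm_tau_le (hn : 2 ≤ n) {P : DesignData q} (hP : P.Valid n) {W : Rows q}
    {Ωb : Pt n q → Fin n → ℝ} (hF : IsFactorization n P W Ωb)
    {K : Set (Pt n q)} (hK : IsCompact K) (hKr : K ⊆ region n P) :
    ∃ C, 0 ≤ C ∧ ∀ p ∈ K, ‖tau P (alpha P W) n p‖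
      ≤ C * ∑ k ∈ Finset.Icc 1 n, zf P (alpha P W) k p ^ 2 := by
  set H : Pt n q → ℝ := fun p => ‖(Pif P p * WOne P p) • PhiOne P p‖
    + ∑ k ∈ Finset.Icc 2 n, ∑ j : Fin k, ‖W k (trunc p k) j‖ with hH
  have hHc : ContinuousOn H K := by
    refine ContinuousOn.mono (ContinuousOn.add ?_ (continuousOn_finsetSum _ fun k hk =>
      continuousOn_finsetSum _ fun j _ => ?_)) hKr
    · exact (((contDiffOn_Pif hP).continuousOn.mul (contDiffOn_WOne hP).continuousOn).smul
        (contDiffOn_PhiOne (by omega) hP).continuousOn).norm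
    · rw [Finset.mem_Icc] at hk
      exact (contDiffOn_W_trunc (hF.W_smooth k hk.1 hk.2) j).continuousOn.norm
  obtain ⟨C, hC⟩ := hK.exists_bound_of_continuousOn hHc
  set G := LinearMap.toContinuousLinearMap (Matrix.toEuclideanLin P.Γ) with hG
  refine ⟨‖G‖ * max C 0, by positivity, fun p hp => ?_⟩
  set S := ∑ k ∈ Finset.Icc 1 n, zf P (alpha P W) k p ^ 2 with hS
  have hS0 : 0 ≤ S := Finset.sum_nonneg fun k _ => sq_nonneg _
  have hz : ∀ k, 1 ≤ k → k ≤ n → zf P (alpha P W) k p ^ 2 ≤ S := fun k h1 h2 =>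
    Finset.single_le_sum (f := fun k => zf P (alpha P W) k p ^ 2) (fun k _ => sq_nonneg _)
      (Finset.mem_Icc.2 ⟨h1, h2⟩)
  have hzz : ∀ k j, 1 ≤ k → k ≤ n → 1 ≤ j → j ≤ n →
      |zf P (alpha P W) k p * zf P (alpha P W) j p| ≤ S := fun k j h1 h2 h3 h4 => by
    have e1 := hz k h1 h2
    have e2 := hz j h3 h4
    rw [abs_le]
    constructor <;> nlinarith [sq_nonneg (zf P (alpha P W) k p + zf P (alpha P W) j p),
      sq_nonneg (zf P (alpha P W) k p - zf P (alpha P W) j p)]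
  have hz1 : zOne P p = zf P (alpha P W) 1 p := by simp [zf]
  have h1 : ‖(zOne P p * Pif P p * xc p 1) • PhiOne P p
      + ∑ k ∈ Finset.Icc 2 n, zf P (alpha P W) k p • wf P (alpha P W) k p‖ ≤ S * H p := by
    rw [hH, mul_add]
    refine (norm_add_le _ _).trans (add_le_add ?_ ?_)
    · have : (zOne P p * Pif P p * xc p 1) • PhiOne P p
          = (zf P (alpha P W) 1 p * zf P (alpha P W) 1 p) • (Pif P p * WOne P p) • PhiOne P p := by
        rw [xc_one_eq hP (hKr hp), smul_smul, hz1]; congr 1; ring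
      rw [this, norm_smul, Real.norm_eq_abs]
      exact mul_le_mul_of_nonneg_right (hzz 1 1 le_rfl (by omega) le_rfl (by omega)) (norm_nonneg _)
    · rw [Finset.mul_sum]
      refine (norm_sum_le _ _).trans (Finset.sum_le_sum fun k hk => ?_)
      rw [Finset.mem_Icc] at hk
      rw [hF.W_eq k hk.1 hk.2 p (hKr hp), Finset.smul_sum, Finset.mul_sum]
      refine (norm_sum_le _ _).trans (Finset.sum_le_sum fun j _ => ?_)
      rw [smul_smul, norm_smul, Real.norm_eq_abs]
      exact mul_le_mul_of_nonneg_right (hzz _ _ (by omega) (by omega) (by omega) (by omega))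
        (norm_nonneg _)
  have h2 : H p ≤ max C 0 := (le_abs_self _).trans ((hC p hp).trans (le_max_left _ _))
  calc ‖tau P (alpha P W) n p‖ ≤ ‖G‖ * ‖(zOne P p * Pif P p * xc p 1) • PhiOne P p
      + ∑ k ∈ Finset.Icc 2 n, zf P (alpha P W) k p • wf P (alpha P W) k p‖ := G.le_opNorm _
    _ ≤ ‖G‖ * (S * max C 0) := by gcongr; exact h1.trans (by gcongr)
    _ = _ := by ring

/-! ### Performance functions -/

theorem IsPerformanceFunction.timeDeriv_zero (β : ℝ → ℝ) (t : ℝ) : timeDeriv β 0 t = β t := by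
  simp [timeDeriv]

theorem IsPerformanceFunction.exists_lower_bound {β : ℝ → ℝ} (hβ : IsPerformanceFunction n β) :
    ∃ m, 0 < m ∧ ∀ t, 0 ≤ t → m ≤ β t := by
  obtain ⟨l, hl0, -, hl⟩ := hβ.limit
  obtain ⟨T, hT⟩ := eventually_atTop.1 (hl.eventually_const_lt (half_lt_self hl0))
  have hc : ContinuousOn β (Icc 0 (max T 0)) := hβ.contDiffOn.continuousOn.mono Icc_subset_Ici_self
  obtain ⟨t₀, ht₀, hmin⟩ := isCompact_Icc.exists_isMinOn ⟨0, left_mem_Icc.2 (le_max_right _ _)⟩ hc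
  refine ⟨min (β t₀) (l / 2), lt_min (hβ.pos t₀ ht₀.1) (by linarith), fun t ht => ?_⟩
  rcases le_total t (max T 0) with h | h
  · exact (min_le_left _ _).trans (hmin ⟨ht, h⟩)
  · exact (min_le_right _ _).trans (hT t ((le_max_left _ _).trans h)).le

theorem IsPerformanceFunction.exists_bound {β : ℝ → ℝ} (hβ : IsPerformanceFunction n β) :
    ∃ C, ∀ t, 0 ≤ t → ∀ j, j ≤ n → |timeDeriv β j t| ≤ C := by
  have h : ∀ j : Fin (n + 1), ∃ C, ∀ t, 0 ≤ t → |timeDeriv β j t| ≤ C := fun j => by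
    rcases Nat.eq_zero_or_pos j.val with h | h
    · refine ⟨1, fun t ht => ?_⟩
      rw [h, timeDeriv_zero, abs_of_pos (hβ.pos t ht)]; exact hβ.le_one t ht
    · exact hβ.bounded_deriv j h (by omega)
  choose C hC using h
  obtain ⟨D, hD⟩ := Finite.bddAbove_range C
  exact ⟨D, fun t ht j hj => (hC ⟨j, by omega⟩ t ht).trans (hD ⟨⟨j, by omega⟩, rfl⟩)⟩

theorem IsPerformanceFunction.continuousOn_timeDeriv {β : ℝ → ℝ} (hβ : IsPerformanceFunction n β)
    {j : ℕ} (hj : j < n) : ContinuousOn (timeDeriv β j) (Ici 0) :=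
  hβ.contDiffOn.continuousOn_iteratedDerivWithin (by exact_mod_cast (by omega : j ≤ n - 1))
    (uniqueDiffOn_Ici 0)

/-- Off a locally finite set, `β⁽ʲ⁾` has derivative `β⁽ʲ⁺¹⁾` for `j < n`, and `β⁽ⁿ⁾` is
continuous. -/
theorem IsPerformanceFunction.exists_regular {β : ℝ → ℝ} (hβ : IsPerformanceFunction n β) :
    ∃ S : Set ℝ, LocallyFiniteTimes S ∧ ∀ t, 0 < t → t ∉ S →
      (∀ j, j < n → HasDerivAt (timeDeriv β j) (timeDeriv β (j + 1) t) t) ∧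
      ∀ j, j ≤ n → ContinuousAt (timeDeriv β j) t := by
  obtain ⟨S₁, hS₁, h1⟩ := hβ.differentiable_off
  obtain ⟨S₂, hS₂, h2⟩ := hβ.piecewiseContinuous.continuousAt_off
  refine ⟨S₁ ∪ S₂, hS₁.union hS₂, fun t ht htS => ⟨fun j hj => ?_, fun j hj => ?_⟩⟩
  · have hd : DifferentiableWithinAt ℝ (timeDeriv β j) (Ici 0) t := by
      by_cases hjn : j = n - 1
      · subst hjn; exact h1 t ⟨ht.le, fun h => htS (Or.inl h)⟩
      · exact hβ.contDiffOn.differentiableOn_iteratedDerivWithin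
          (by exact_mod_cast (by omega : j < n - 1)) (uniqueDiffOn_Ici 0) t ht.le
    have := hd.hasDerivWithinAt.hasDerivAt (Ici_mem_nhds ht)
    rwa [show timeDeriv β (j + 1) t = derivWithin (timeDeriv β j) (Ici 0) t from
      congrFun iteratedDerivWithin_succ t]
  · rcases hj.eq_or_lt with rfl | hj
    · exact h2 t ht fun h => htS (Or.inr h)
    · exact (hβ.continuousOn_timeDeriv hj).continuousAt (Ici_mem_nhds ht)

/-! ### The inverse adaptation gain -/

/-- Multiplication by the inverse of the adaptation gain. -/
noncomputable def gainInv (P : DesignData q) (v : Vec q) : Vec q := Matrix.toEuclideanLin P.Γ⁻¹ v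

theorem gainInv_gain {P : DesignData q} (hP : P.Valid n) (v : Vec q) :
    gainInv P (gain P v) = v := by
  have hu : IsUnit P.Γ.det := (Matrix.isUnit_iff_isUnit_det _).1 hP.Γ_posDef.isUnit
  simp only [gainInv, gain, Matrix.toLpLin_apply, Matrix.mulVec_mulVec,
    Matrix.nonsing_inv_mul _ hu, Matrix.one_mulVec]

theorem inner_gainInv_comm {P : DesignData q} (hP : P.Valid n) (v w : Vec q) :
    inner ℝ (gainInv P v) w = inner ℝ v (gainInv P w) :=
  (Matrix.isSymmetric_toEuclideanLin_iff.2 hP.Γ_posDef.inv.isHermitian) v w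

theorem inner_gainInv_pos {P : DesignData q} (hP : P.Valid n) {v : Vec q} (hv : v ≠ 0) :
    0 < inner ℝ v (gainInv P v) := by
  have h := hP.Γ_posDef.inv.dotProduct_mulVec_pos (x := WithLp.ofLp v)
    (fun h => hv (by ext i; exact congrFun h i))
  simpa [gainInv, Matrix.toLpLin_apply, EuclideanSpace.inner_eq_star_dotProduct,
    dotProduct_comm] using h

theorem exists_norm_sq_le_inner_gainInv {P : DesignData q} (hP : P.Valid n) :
    ∃ c, 0 < c ∧ ∀ v : Vec q, ‖v‖ ^ 2 ≤ c * inner ℝ v (gainInv P v) := by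
  have hc : Continuous fun v : Vec q => inner ℝ v (gainInv P v) :=
    continuous_id.inner
      (LinearMap.toContinuousLinearMap (Matrix.toEuclideanLin P.Γ⁻¹)).continuous
  rcases (Metric.sphere (0 : Vec q) 1).eq_empty_or_nonempty with h | h
  · refine ⟨1, one_pos, fun v => ?_⟩
    have hv : v = 0 := by
      by_contra hv
      have : ‖v‖⁻¹ • v ∈ Metric.sphere (0 : Vec q) 1 := by
        rw [mem_sphere_zero_iff_norm, norm_smul, norm_inv, norm_norm,
          inv_mul_cancel₀ (norm_ne_zero_iff.2 hv)]
      rw [h] at this; exact this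
    simp [hv]
  · obtain ⟨v₀, hv₀, hmin⟩ := (isCompact_sphere (0 : Vec q) 1).exists_isMinOn h hc.continuousOn
    have hv0 : v₀ ≠ 0 := by
      rintro rfl; simp at hv₀
    have hpos := inner_gainInv_pos hP hv0
    refine ⟨(inner ℝ v₀ (gainInv P v₀))⁻¹, inv_pos.2 hpos, fun v => ?_⟩
    rcases eq_or_ne v 0 with rfl | hv
    · simp
    have hn : ‖v‖ ≠ 0 := norm_ne_zero_iff.2 hv
    have h1 : ‖v‖⁻¹ • v ∈ Metric.sphere (0 : Vec q) 1 := by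
      rw [mem_sphere_zero_iff_norm, norm_smul, norm_inv, norm_norm, inv_mul_cancel₀ hn]
    have h2 : inner ℝ v₀ (gainInv P v₀) ≤ inner ℝ (‖v‖⁻¹ • v) (gainInv P (‖v‖⁻¹ • v)) := hmin h1
    have h3 : gainInv P (‖v‖⁻¹ • v) = ‖v‖⁻¹ • gainInv P v := by simp [gainInv]
    rw [h3, real_inner_smul_left, real_inner_smul_right] at h2
    rw [inv_mul_eq_div, le_div_iff₀ hpos]
    have h4 := mul_le_mul_of_nonneg_left h2 (sq_nonneg ‖v‖)
    calc _ ≤ _ := h4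
      _ = _ := by field_simp

/-! ### The Lyapunov function -/

/-- The Lyapunov function
`½ ∑ z_k² + ½ (θ̂ - ℓ_θ)ᵀ Γ⁻¹ (θ̂ - ℓ_θ) + |ℓ_b| / (2 γ) (ρ̂ - 1 / ℓ_b)²`. -/
noncomputable def lyap (P : DesignData q) (a : ℕ → Pt n q → ℝ) (ℓθ : Vec q) (ℓb : ℝ)
    (y : Pt n q × ℝ) : ℝ :=
  1 / 2 * ∑ k ∈ Finset.Icc 1 n, zf P a k y.1 ^ 2
    + 1 / 2 * inner ℝ (y.1.2.2 - ℓθ) (gainInv P (y.1.2.2 - ℓθ))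
    + |ℓb| / (2 * P.γ) * (y.2 - 1 / ℓb) ^ 2

/-- The point with the coordinate `β⁽ⁿ⁾`, which may jump, replaced by zero. -/
def low (p : Pt n q) : Pt n q := (p.1, fun k => if k.val < n then p.2.1 k else 0, p.2.2)

theorem agree_low (hn : 1 ≤ n) (p : Pt n q) : Agree n (n - 1) p (low p) := by
  refine ⟨fun j _ _ => rfl, fun j hj => ?_, rfl⟩
  simp only [bc, low]
  rw [dif_pos (by omega), dif_pos (by omega), if_pos (by omega)]

theorem zf_low {P : DesignData q} {a : ℕ → Pt n q → ℝ}
    (ha : ∀ j, 1 ≤ j → j < n → IsVirtualControl P j (a j)) {k : ℕ} (hk1 : 1 ≤ k) (hk : k ≤ n)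
    (p : Pt n q) : zf P a k (low p) = zf P a k p :=
  (dependsOn_zf ha hk1 hk p (low p) ((agree_low (by omega) p).mono hk (by omega))).symm

theorem lyap_low {P : DesignData q} {a : ℕ → Pt n q → ℝ}
    (ha : ∀ j, 1 ≤ j → j < n → IsVirtualControl P j (a j)) (ℓθ : Vec q) (ℓb : ℝ)
    (p : Pt n q) (ρ : ℝ) : lyap P a ℓθ ℓb (low p, ρ) = lyap P a ℓθ ℓb (p, ρ) := by
  simp only [lyap, low]
  congr 3
  refine Finset.sum_congr rfl fun k hk => ?_
  rw [Finset.mem_Icc] at hk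
  have := zf_low ha hk.1 hk.2 p
  simp only [low] at this
  rw [this]

theorem low_mem_region_iff (hn : 1 ≤ n) {P : DesignData q} {p : Pt n q} :
    low p ∈ region n P ↔ p ∈ region n P :=
  ⟨fun h => mem_region_congr hn (agree_low hn p).symm h,
    fun h => mem_region_congr hn (agree_low hn p) h⟩

theorem continuousOn_lyap {P : DesignData q} (hP : P.Valid n) {a : ℕ → Pt n q → ℝ}
    (ha : ∀ j, 1 ≤ j → j < n → IsVirtualControl P j (a j)) (ℓθ : Vec q) (ℓb : ℝ) :
    ContinuousOn (lyap P a ℓθ ℓb) (region n P ×ˢ univ) := by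
  have h1 : ContinuousOn (fun y : Pt n q × ℝ => ∑ k ∈ Finset.Icc 1 n, zf P a k y.1 ^ 2)
      (region n P ×ˢ univ) :=
    (continuousOn_sum_zf_sq hP ha).comp continuousOn_fst fun y hy => hy.1
  have h2 : Continuous fun v : Vec q => gainInv P v :=
    (LinearMap.toContinuousLinearMap (Matrix.toEuclideanLin P.Γ⁻¹)).continuous
  refine ((continuousOn_const.mul h1).add (Continuous.continuousOn ?_)).add
    (Continuous.continuousOn (by fun_prop))
  have h3 : Continuous fun y : Pt n q × ℝ => y.1.2.2 - ℓθ := by fun_prop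
  exact continuous_const.mul (h3.inner (h2.comp h3))

theorem lyap_bounds {P : DesignData q} (hP : P.Valid n) (a : ℕ → Pt n q → ℝ) (ℓθ : Vec q)
    {ℓb : ℝ} (y : Pt n q × ℝ) :
    0 ≤ inner ℝ (y.1.2.2 - ℓθ) (gainInv P (y.1.2.2 - ℓθ)) ∧
    ∑ k ∈ Finset.Icc 1 n, zf P a k y.1 ^ 2 ≤ 2 * lyap P a ℓθ ℓb y ∧
    inner ℝ (y.1.2.2 - ℓθ) (gainInv P (y.1.2.2 - ℓθ)) ≤ 2 * lyap P a ℓθ ℓb y ∧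
    |ℓb| / (2 * P.γ) * (y.2 - 1 / ℓb) ^ 2 ≤ lyap P a ℓθ ℓb y := by
  have h1 : 0 ≤ inner ℝ (y.1.2.2 - ℓθ) (gainInv P (y.1.2.2 - ℓθ)) := by
    rcases eq_or_ne (y.1.2.2 - ℓθ) 0 with h | h
    · rw [h]; simp
    · exact (inner_gainInv_pos hP h).le
  have h2 : 0 ≤ ∑ k ∈ Finset.Icc 1 n, zf P a k y.1 ^ 2 := Finset.sum_nonneg fun k _ => sq_nonneg _
  have h3 : 0 ≤ |ℓb| / (2 * P.γ) * (y.2 - 1 / ℓb) ^ 2 := by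
    have := hP.γ_pos; positivity
  unfold lyap
  refine ⟨h1, ?_, ?_, ?_⟩ <;> linarith

/-! ### Derivatives along the closed loop -/

theorem xc_pt (β : ℝ → ℝ) (t : ℝ) (s : St n q) {j : ℕ} (hj : j - 1 < n) :
    xc (pt β t s) j = s.1 ⟨j - 1, hj⟩ := by simp [xc, pt, hj]

theorem bc_pt (β : ℝ → ℝ) (t : ℝ) (s : St n q) {j : ℕ} (hj : j ≤ n) :
    bc (pt β t s) j = timeDeriv β j t := by
  have : j < n + 1 := by omega
  simp [bc, pt, this]

theorem hasDerivAt_xc {P : DesignData q} {W : Rows q} {Ωb : Pt n q → Fin n → ℝ} {β b : ℝ → ℝ}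
    {θ : ℝ → Vec q} {X : ℝ → St n q} {t : ℝ} (hX : HasDerivAt X (field P W Ωb β θ b t (X t)) t)
    {j : ℕ} (hj1 : 1 ≤ j) (hj : j ≤ n) :
    HasDerivAt (fun s => (X s).1 ⟨j - 1, by omega⟩)
      (xdot P (θ t) (b t * control P W Ωb β t (X t)) j (pt β t (X t))) t := by
  have h1 := hasDerivAt_pi.1 hX.fst ⟨j - 1, by omega⟩
  have h2 : (field P W Ωb β θ b t (X t)).1 ⟨j - 1, by omega⟩
      = xdot P (θ t) (b t * control P W Ωb β t (X t)) j (pt β t (X t)) := by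
    simp only [field, xdot, Nat.sub_add_cancel hj1]
    have : j - 1 + 2 = j + 1 := by omega
    rw [this]
  rw [← h2]; exact h1

/-- The derivative of `z_k` along the closed loop is `zdot`. -/
theorem hasDerivAt_zf (hn : 2 ≤ n) {P : DesignData q} (hP : P.Valid n) {W : Rows q}
    {Ωb : Pt n q → Fin n → ℝ} (ha : ∀ j, 1 ≤ j → j < n → IsVirtualControl P j
      (alpha P W j : Pt n q → ℝ)) {β b : ℝ → ℝ} {θ : ℝ → Vec q} {X : ℝ → St n q} {t : ℝ}
    (hX : HasDerivAt X (field P W Ωb β θ b t (X t)) t)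
    (hβ : ∀ j, j < n → HasDerivAt (timeDeriv β j) (timeDeriv β (j + 1) t) t)
    (hp : pt β t (X t) ∈ region n P) {k : ℕ} (hk1 : 1 ≤ k) (hk : k ≤ n) :
    HasDerivAt (fun s => zf P (alpha P W) k (pt β s (X s)))
      (zdot P (alpha P W) (θ t) (b t * control P W Ωb β t (X t)) k (pt β t (X t))) t := by
  set v := b t * control P W Ωb β t (X t) with hv
  rcases hk1.eq_or_lt with rfl | hk2
  · have hD := (den_pos hp).ne'
    have hx := hasDerivAt_xc hX le_rfl hk
    have hψ : HasDerivAt P.ψ (deriv P.ψ ((X t).1 ⟨1 - 1, by omega⟩)) ((X t).1 ⟨1 - 1, by omega⟩) :=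
      (hP.ψ_normalized.smooth.differentiable (by simp)).differentiableAt.hasDerivAt
    have hψx := hψ.comp t hx
    have hB := hβ 0 (by omega)
    have hnum := hB.mul hψx
    have hden := (hB.pow 2).sub (hψx.pow 2)
    simp only [zf, if_true, zdot, Pif, Psif, zOne, xc_pt β _ _ (by omega : 1 - 1 < n),
      bc_pt β _ _ (Nat.zero_le n), bc_pt β _ _ (by omega : 1 ≤ n)] at hD ⊢
    refine (hnum.div hden hD).congr_deriv ?_
    simp only [Function.comp, Pi.pow_apply, Pi.sub_apply, Pi.mul_apply]
    field_simp
    ring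
  · have hak := ha (k - 1) (by omega) (by omega)
    -- `α_{k-1}` is differentiated along the path without the coordinate `β⁽ⁿ⁾`
    set w : Pt n q := ((field P W Ωb β θ b t (X t)).1,
      fun j => if j.val < n then timeDeriv β (j.val + 1) t else 0,
      thetaLaw P W β t (X t)) with hw
    have hlow : HasDerivAt (fun s => low (pt β s (X s))) w t := by
      have h1 : HasDerivAt (fun s => (X s).1) (field P W Ωb β θ b t (X t)).1 t := hX.fst
      have h3 : HasDerivAt (fun s => (X s).2.1) (thetaLaw P W β t (X t)) t := hX.snd.fst
      have h2 : HasDerivAt (fun s (j : Fin (n + 1)) => if j.val < n then timeDeriv β j.val s else 0)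
          (fun j => if j.val < n then timeDeriv β (j.val + 1) t else 0) t := by
        refine hasDerivAt_pi.2 fun j => ?_
        by_cases hj : j.val < n
        · simp only [if_pos hj]; exact hβ j hj
        · simp only [if_neg hj]; exact hasDerivAt_const _ _
      exact h1.prodMk (h2.prodMk h3)
    have hag : ∀ p : Pt n q, Agree (k - 1) (k - 1) p (low p) := fun p =>
      (agree_low (by omega) p).mono (by omega) (by omega)
    have hdiff : DifferentiableAt ℝ (alpha P W (k - 1)) (low (pt β t (X t))) :=
      (hak.smooth.contDiffAt ((isOpen_region hP).mem_nhds
        ((low_mem_region_iff (by omega)).2 hp))).differentiableAt (by simp)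
    have hcomp : HasDerivAt (fun s => alpha P W (k - 1) (pt β s (X s)))
        (fderiv ℝ (alpha P W (k - 1)) (pt β t (X t)) w) t := by
      have h1 := hdiff.hasFDerivAt.comp_hasDerivAt t hlow
      rw [← hak.dep.fderiv _ _ (hag (pt β t (X t)))] at h1
      exact h1.congr_of_eventuallyEq (Eventually.of_forall fun s => hak.dep _ _ (hag _))
    have hx := hasDerivAt_xc hX hk1 hk
    have hsub := hx.sub hcomp
    simp only [zf, if_neg (by omega : ¬ k = 1), zdot, xc_pt β _ _ (by omega : k - 1 < n)]
    refine hsub.congr_deriv ?_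
    congr 1
    rw [clm_apply_eq_sum]
    congr 1
    congr 1
    · symm
      have hxw : ∀ j, 1 ≤ j → j ≤ n → xc w j = xdot P (θ t) v j (pt β t (X t)) := fun j h1 h2 => by
        simp only [xc, hw]
        rw [dif_pos (by omega)]
        simp only [field, xdot, Nat.sub_add_cancel h1, hv]
        have : j - 1 + 2 = j + 1 := by omega
        rw [this]
      rw [← Finset.sum_subset (Finset.Icc_subset_Icc_right (by omega : k - 1 ≤ n))]
      · refine Finset.sum_congr rfl fun j hj => ?_
        rw [Finset.mem_Icc] at hj
        rw [hxw j hj.1 (by omega), smul_eq_mul, mul_comm]; rfl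
      · intro j h1 h2
        rw [Finset.mem_Icc] at h1 h2
        rw [hak.dep.fderiv_apply_eq_zero _ (agree_ex_zero (by omega)), smul_zero]
    · symm
      rw [← Finset.sum_subset (Finset.range_subset_range.2 (by omega : k ≤ n + 1))]
      · refine Finset.sum_congr rfl fun j hj => ?_
        rw [Finset.mem_range] at hj
        have : bc w j = bc (pt β t (X t)) (j + 1) := by
          rw [bc_pt β _ _ (by omega)]
          simp only [bc, hw]
          rw [dif_pos (by omega), if_pos (by omega)]
        rw [this, smul_eq_mul, mul_comm]; rfl
      · intro j h1 h2
        rw [Finset.mem_range] at h1 h2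
        rw [hak.dep.fderiv_apply_eq_zero _ (agree_eb_zero (by omega)), smul_zero]

/-! ### The closed loop: dissipation along solutions -/

/-- The standing assumptions on the closed loop, with one admissible pair `(ℓ_θ, ℓ_b)` of reference
parameters. -/
structure IsClosedLoop (P : DesignData q) (W : Rows q) (Ωb : Pt n q → Fin n → ℝ) (β : ℝ → ℝ)
    (θ : ℝ → Vec q) (b : ℝ → ℝ) (ℓθ : Vec q) (ℓb : ℝ) : Prop where
  two_le : 2 ≤ n
  valid : P.Valid n
  factor : IsFactorization n P W Ωb
  perf : IsPerformanceFunction n β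
  theta_pc : PiecewiseContinuous θ
  b_pc : PiecewiseContinuous b
  theta_le : ∀ t, 0 ≤ t → ‖θ t - ℓθ‖ ≤ P.δ
  gain_level : IsGainLevel P.sgn b ℓb

section ClosedLoop

variable {P : DesignData q} {W : Rows q} {Ωb : Pt n q → Fin n → ℝ} {β : ℝ → ℝ}
  {θ : ℝ → Vec q} {b : ℝ → ℝ} {ℓθ : Vec q} {ℓb : ℝ}

theorem IsFactorization.isVirtualControl (hP : P.Valid n) (hF : IsFactorization n P W Ωb) :
    ∀ j, 1 ≤ j → j < n → IsVirtualControl P j (alpha P W j : Pt n q → ℝ) := fun _ h1 h2 =>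
  isVirtualControl_alpha hP h1 h2.le fun l hl1 hl => hF.W_smooth l hl1 (by omega)

theorem IsClosedLoop.ha (h : IsClosedLoop P W Ωb β θ b ℓθ ℓb) :
    ∀ j, 1 ≤ j → j < n → IsVirtualControl P j (alpha P W j : Pt n q → ℝ) :=
  h.factor.isVirtualControl h.valid

theorem IsClosedLoop.delta_nonneg (h : IsClosedLoop P W Ωb β θ b ℓθ ℓb) : 0 ≤ P.δ :=
  (norm_nonneg _).trans (h.theta_le 0 le_rfl)

theorem IsClosedLoop.sgn_sq (h : IsClosedLoop P W Ωb β θ b ℓθ ℓb) : P.sgn ^ 2 = 1 :=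
  (sign_facts h.gain_level.1 h.gain_level.2.1).2

/-- The Lyapunov function at time `t` and closed-loop state `s`. -/
noncomputable def lyapAt (P : DesignData q) (W : Rows q) (β : ℝ → ℝ) (ℓθ : Vec q) (ℓb : ℝ) (t : ℝ)
    (s : St n q) : ℝ := lyap P (alpha P W) ℓθ ℓb (pt β t s, s.2.2)

/-- The weighted sum `∑ kᵢ zᵢ²` bounding the dissipation from below. -/
noncomputable def dissAt (P : DesignData q) (W : Rows q) (β : ℝ → ℝ) (t : ℝ) (s : St n q) : ℝ :=
  ∑ k ∈ Finset.Icc 1 n, P.k k * zf P (alpha P W) k (pt β t s) ^ 2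

theorem IsClosedLoop.hasDerivAt_lyapAt (h : IsClosedLoop P W Ωb β θ b ℓθ ℓb) {X : ℝ → St n q}
    {t : ℝ} (ht : 0 ≤ t) (hX : HasDerivAt X (field P W Ωb β θ b t (X t)) t)
    (hβ : ∀ j, j < n → HasDerivAt (timeDeriv β j) (timeDeriv β (j + 1) t) t)
    (hp : pt β t (X t) ∈ region n P) (hρ : 0 < P.sgn * (X t).2.2) :
    ∃ V', HasDerivAt (fun s => lyapAt P W β ℓθ ℓb s (X s)) V' t ∧
      V' ≤ -dissAt P W β t (X t) := by
  have hP := h.valid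
  set p := pt β t (X t) with hpdef
  set y : Vec q := (zOne P p * Pif P p * xc p 1) • PhiOne P p
    + ∑ j ∈ Finset.Icc 2 n, zf P (alpha P W) j p • wf P (alpha P W) j p with hy
  have hdiss := dissipation h.two_le hP h.factor hp (h.theta_le t ht) h.gain_level.1
    h.gain_level.2.1 (h.gain_level.2.2 t ht).1 (h.gain_level.2.2 t ht).2 hρ
  refine ⟨_, ?_, hdiss⟩
  have hz : HasDerivAt (fun s => 1 / 2 * ∑ k ∈ Finset.Icc 1 n, zf P (alpha P W) k (pt β s (X s)) ^ 2)
      (∑ k ∈ Finset.Icc 1 n, zf P (alpha P W) k p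
        * zdot P (alpha P W) (θ t) (b t * ((X t).2.2 * ubar P W Ωb p)) k p) t := by
    have := (HasDerivAt.fun_sum fun k (hk : k ∈ Finset.Icc 1 n) =>
      (hasDerivAt_zf h.two_le hP h.ha hX hβ hp (Finset.mem_Icc.1 hk).1
        (Finset.mem_Icc.1 hk).2).pow 2).const_mul (1 / 2)
    refine this.congr_deriv ?_
    rw [Finset.mul_sum]
    refine Finset.sum_congr rfl fun k _ => ?_
    simp only [control, ← hpdef]
    push_cast
    ring
  have hth : HasDerivAt (fun s => (X s).2.1 - ℓθ) (gain P y) t := by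
    have h1 : HasDerivAt (fun s => (X s).2.1) (thetaLaw P W β t (X t)) t := hX.snd.fst
    exact h1.sub_const ℓθ
  have hth2 : HasDerivAt (fun s => gainInv P ((X s).2.1 - ℓθ)) y t := by
    have h1 := (LinearMap.toContinuousLinearMap
      (Matrix.toEuclideanLin P.Γ⁻¹)).hasFDerivAt.comp_hasDerivAt t hth
    have h2 : (LinearMap.toContinuousLinearMap (Matrix.toEuclideanLin P.Γ⁻¹)) (gain P y) = y :=
      gainInv_gain hP y
    rw [h2] at h1
    exact h1
  have hQ : HasDerivAt (fun s => 1 / 2 * inner ℝ ((X s).2.1 - ℓθ) (gainInv P ((X s).2.1 - ℓθ)))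
      (inner ℝ ((X t).2.1 - ℓθ) y) t := by
    refine ((hth.inner ℝ hth2).const_mul (1 / 2)).congr_deriv ?_
    rw [← inner_gainInv_comm hP, gainInv_gain hP, real_inner_comm y]
    ring
  have hR : HasDerivAt (fun s => |ℓb| / (2 * P.γ) * ((X s).2.2 - 1 / ℓb) ^ 2)
      (|ℓb| / P.γ * ((X t).2.2 - 1 / ℓb)
        * (-P.γ * P.sgn * zf P (alpha P W) n p * ubar P W Ωb p)) t := by
    have h1 : HasDerivAt (fun s => (X s).2.2) (rhoLaw P W Ωb β t (X t)) t := hX.snd.snd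
    refine (((h1.sub_const (1 / ℓb)).pow 2).const_mul (|ℓb| / (2 * P.γ))).congr_deriv ?_
    have := hP.γ_pos.ne'
    simp only [rhoLaw, ← hpdef]
    push_cast
    field_simp
  exact (hz.add hQ).add hR

theorem IsClosedLoop.continuousOn_low_pt (h : IsClosedLoop P W Ωb β θ b ℓθ ℓb) {X : ℝ → St n q}
    {I : Set ℝ} (hI : I ⊆ Ici 0) (hX : ContinuousOn X I) :
    ContinuousOn (fun t => (low (pt β t (X t)), (X t).2.2)) I := by
  have h1 : ContinuousOn (fun t (j : Fin (n + 1)) => if j.val < n then timeDeriv β j.val t else 0)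
      I := by
    refine continuousOn_pi.2 fun j => ?_
    by_cases hj : j.val < n
    · simp only [if_pos hj]; exact (h.perf.continuousOn_timeDeriv hj).mono hI
    · simp only [if_neg hj]; exact continuousOn_const
  exact (hX.fst.prodMk (h1.prodMk hX.snd.fst)).prodMk hX.snd.snd

theorem IsClosedLoop.continuousOn_lyapAt (h : IsClosedLoop P W Ωb β θ b ℓθ ℓb) {X : ℝ → St n q}
    {I : Set ℝ} (hI : I ⊆ Ici 0) (hX : ContinuousOn X I)
    (hr : ∀ t ∈ I, pt β t (X t) ∈ region n P) :
    ContinuousOn (fun t => lyapAt P W β ℓθ ℓb t (X t)) I := by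
  have h1 := (continuousOn_lyap h.valid h.ha ℓθ ℓb).comp (h.continuousOn_low_pt hI hX)
    fun t ht => ⟨(low_mem_region_iff (by have := h.two_le; omega)).2 (hr t ht), mem_univ _⟩
  exact h1.congr fun t _ => (lyap_low h.ha ℓθ ℓb _ _).symm

/-- The dissipation inequality in integrated form, against a comparison function `g`. -/
theorem IsClosedLoop.lyapAt_add_le (h : IsClosedLoop P W Ωb β θ b ℓθ ℓb) {X : ℝ → St n q}
    {S : Set ℝ} (hS : LocallyFiniteTimes S) {s t : ℝ} (hs : 0 ≤ s) (hst : s ≤ t)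
    (hXc : ContinuousOn X (Icc s t))
    (hX : ∀ r ∈ Ioo s t, r ∉ S → HasDerivAt X (field P W Ωb β θ b r (X r)) r)
    (hr : ∀ r ∈ Icc s t, pt β r (X r) ∈ region n P) (hρ : ∀ r ∈ Icc s t, 0 < P.sgn * (X r).2.2)
    {g g' : ℝ → ℝ} (hgc : ContinuousOn g (Icc s t))
    (hg : ∀ r ∈ Ioo s t, r ∉ S → HasDerivAt g (g' r) r ∧ g' r ≤ dissAt P W β r (X r)) :
    lyapAt P W β ℓθ ℓb t (X t) + g t ≤ lyapAt P W β ℓθ ℓb s (X s) + g s := by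
  obtain ⟨S', hS', hreg⟩ := h.perf.exists_regular
  have hI : Icc s t ⊆ Ici 0 := fun r hr => hs.trans hr.1
  have hex : ∀ r, r ∈ Ioo s t → r ∉ (S ∪ S') ∩ Icc 0 t →
      ∃ V', HasDerivAt (fun s => lyapAt P W β ℓθ ℓb s (X s) + g s) V' r ∧ V' ≤ 0 := by
    intro r hrI hrS
    have hrS' : r ∉ S ∪ S' := fun h1 => hrS ⟨h1, hs.trans hrI.1.le, hrI.2.le⟩
    have hrc := Ioo_subset_Icc_self hrI
    obtain ⟨V', h1, h2⟩ := h.hasDerivAt_lyapAt (hs.trans hrc.1)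
      (hX r hrI fun h1 => hrS' (Or.inl h1))
      (hreg r (hs.trans_lt hrI.1) fun h1 => hrS' (Or.inr h1)).1 (hr r hrc) (hρ r hrc)
    obtain ⟨h3, h4⟩ := hg r hrI fun h1 => hrS' (Or.inl h1)
    exact ⟨_, h1.add h3, by linarith⟩
  choose! V' hV' using hex
  exact le_of_deriv_nonpos_off_finite ((hS.union hS') t) hst
    ((h.continuousOn_lyapAt hI hXc hr).add hgc) hV'

theorem IsClosedLoop.sgn_rho_le (h : IsClosedLoop P W Ωb β θ b ℓθ ℓb) {X : ℝ → St n q}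
    {S : Set ℝ} (hS : LocallyFiniteTimes S) {s t : ℝ} (hs : 0 ≤ s) (hst : s ≤ t)
    (hXc : ContinuousOn X (Icc s t))
    (hX : ∀ r ∈ Ioo s t, r ∉ S → HasDerivAt X (field P W Ωb β θ b r (X r)) r) :
    P.sgn * (X s).2.2 ≤ P.sgn * (X t).2.2 := by
  have key := le_of_deriv_nonpos_off_finite (hS t) hst
    (f := fun r => -(P.sgn * (X r).2.2)) (f' := fun r => -(P.sgn * rhoLaw P W Ωb β r (X r)))
    ((continuousOn_const.mul hXc.snd.snd).neg) fun r hr hrS => ?_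
  · linarith
  · have h1 : HasDerivAt (fun s => (X s).2.2) (rhoLaw P W Ωb β r (X r)) r :=
      (hX r hr fun h1 => hrS ⟨h1, hs.trans hr.1.le, hr.2.le⟩).snd.snd
    refine ⟨(h1.const_mul P.sgn).neg, ?_⟩
    have h2 : P.sgn * rhoLaw P W Ωb β r (X r) = P.sgn ^ 2 * (P.γ
        * (kappa P W Ωb (pt β r (X r)) * zf P (alpha P W) n (pt β r (X r)) ^ 2)) := by
      simp only [rhoLaw, ubar]; ring
    have h3 := kappa_pos h.two_le h.valid h.delta_nonneg W Ωb (pt β r (X r))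
    have h4 := h.valid.γ_pos
    rw [h2, h.sgn_sq, one_mul, neg_nonpos]
    positivity

theorem norm_low_snd_le (p : Pt n q) : ‖(low p).2‖ ≤ ‖p.2‖ := by
  refine max_le ((pi_norm_le_iff_of_nonneg (norm_nonneg _)).2 fun j => ?_) (norm_snd_le p.2)
  simp only [low]
  split_ifs
  · exact (norm_le_pi_norm p.2.1 j).trans (norm_fst_le p.2)
  · simp

theorem IsClosedLoop.exists_bound_of_lyapAt_le (h : IsClosedLoop P W Ωb β θ b ℓθ ℓb) (c : ℝ) :
    ∃ M, ∀ t, 0 ≤ t → ∀ s : St n q, lyapAt P W β ℓθ ℓb t s ≤ c →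
      ‖(pt β t s).2‖ ≤ M ∧ |s.2.2| ≤ M ∧
      ∀ k, 1 ≤ k → k ≤ n → |zf P (alpha P W) k (pt β t s)| ≤ M := by
  obtain ⟨C, hC⟩ := h.perf.exists_bound
  obtain ⟨d, hd0, hd⟩ := exists_norm_sq_le_inner_gainInv h.valid
  have hγ := h.valid.γ_pos
  have hℓ := h.gain_level.1
  set M₁ := ‖ℓθ‖ + √(d * (2 * c)) with hM₁
  set M₂ := |1 / ℓb| + √(c / (|ℓb| / (2 * P.γ))) with hM₂
  set M₃ := √(2 * c) with hM₃
  refine ⟨max (max C M₁) (max M₂ M₃), fun t ht s hs => ?_⟩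
  obtain ⟨-, h2, h3, h4⟩ := lyap_bounds h.valid (alpha P W) ℓθ (ℓb := ℓb) (pt β t s, s.2.2)
  have hs' : lyap P (alpha P W) ℓθ ℓb (pt β t s, s.2.2) ≤ c := hs
  refine ⟨max_le ?_ ?_, ?_, fun k hk1 hk => ?_⟩
  · have hC0 : 0 ≤ C := (abs_nonneg _).trans (hC 0 le_rfl 0 (Nat.zero_le _))
    refine (((pi_norm_le_iff_of_nonneg hC0).2 fun j => ?_).trans (le_max_left C M₁)).trans
      (le_max_left _ _)
    exact hC t ht j (by omega)
  · refine le_trans ?_ ((le_max_right C M₁).trans (le_max_left _ _))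
    have h5 : ‖s.2.1 - ℓθ‖ ≤ √(d * (2 * c)) := Real.le_sqrt_of_sq_le <|
      (hd _).trans (mul_le_mul_of_nonneg_left (h3.trans (by linarith)) hd0.le)
    have h6 : s.2.1 = ℓθ + (s.2.1 - ℓθ) := by abel
    show ‖s.2.1‖ ≤ M₁
    rw [h6]
    exact (norm_add_le _ _).trans (by linarith)
  · refine le_trans ?_ ((le_max_left M₂ M₃).trans (le_max_right _ _))
    have h5 : |s.2.2 - 1 / ℓb| ≤ √(c / (|ℓb| / (2 * P.γ))) := Real.abs_le_sqrt (by
      rw [le_div_iff₀ (by positivity), mul_comm]; exact h4.trans hs')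
    have h6 : s.2.2 = 1 / ℓb + (s.2.2 - 1 / ℓb) := by ring
    rw [h6]
    exact (abs_add_le _ _).trans (by linarith)
  · refine le_trans ?_ ((le_max_right M₂ M₃).trans (le_max_right _ _))
    refine Real.abs_le_sqrt ?_
    have h5 := Finset.single_le_sum (f := fun k => zf P (alpha P W) k (pt β t s) ^ 2)
      (fun k _ => sq_nonneg _) (Finset.mem_Icc.2 ⟨hk1, hk⟩)
    exact h5.trans (h2.trans (by linarith))

/-- Sublevel sets of the Lyapunov function lie in compact parts of the region, uniformly in
time. -/
theorem IsClosedLoop.exists_compact_of_lyapAt_le (h : IsClosedLoop P W Ωb β θ b ℓθ ℓb) (c : ℝ) :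
    ∃ K : Set (Pt n q × ℝ), IsCompact K ∧ K ⊆ region n P ×ˢ univ ∧
      ∀ t, 0 ≤ t → ∀ s : St n q, pt β t s ∈ region n P → lyapAt P W β ℓθ ℓb t s ≤ c →
        (pt β t s, s.2.2) ∈ K ∧ (low (pt β t s), s.2.2) ∈ K := by
  have hn := h.two_le
  obtain ⟨M, hM⟩ := h.exists_bound_of_lyapAt_le c
  obtain ⟨m, hm0, hm⟩ := h.perf.exists_lower_bound
  obtain ⟨K, hK, hKr, hKm⟩ := exists_compact_of_zf_le hn h.valid h.ha hm0 M
  refine ⟨K ×ˢ Icc (-M) M, hK.prod isCompact_Icc, prod_mono hKr (subset_univ _),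
    fun t ht s hr hV => ?_⟩
  obtain ⟨h1, h2, h3⟩ := hM t ht s hV
  have hb : bc (pt β t s) 0 = β t := by
    rw [bc_pt β t s (Nat.zero_le n), IsPerformanceFunction.timeDeriv_zero]
  have hb' : bc (low (pt β t s)) 0 = β t := by
    rw [← (agree_low (by omega) (pt β t s)).2.1 0 (Nat.zero_le _), hb]
  refine ⟨⟨hKm _ hr (hb ▸ hm t ht) (hb ▸ h.perf.le_one t ht) h1 h3, abs_le.1 h2⟩,
    ⟨hKm _ ((low_mem_region_iff (by omega)).2 hr) (hb' ▸ hm t ht) (hb' ▸ h.perf.le_one t ht)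
      ((norm_low_snd_le _).trans h1) fun k hk1 hk => ?_, abs_le.1 h2⟩⟩
  rw [zf_low h.ha hk1 hk]; exact h3 k hk1 hk

end ClosedLoop

/-! ### Existence and uniqueness of solutions -/

/-- The part of the closed-loop field that does not involve `θ` and `b`, its coefficients of `θ`,
and its coefficient of `b`. -/
noncomputable def fieldParts (P : DesignData q) (W : Rows q) (Ωb : Pt n q → Fin n → ℝ)
    (y : Pt n q × ℝ) : St n q × (Fin n → Vec q) × St n q :=
  ((fun i => if i.val + 1 < n then xc y.1 (i.val + 2) else 0, tau P (alpha P W) n y.1,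
      -P.γ * P.sgn * zf P (alpha P W) n y.1 * ubar P W Ωb y.1),
    fun i => reg P (i.val + 1) y.1,
    (fun i => if i.val + 1 < n then 0 else y.2 * ubar P W Ωb y.1, 0, 0))

/-- The value of a field with given parts at the parameters `θ`, `b`. -/
noncomputable def assemble (y : St n q × (Fin n → Vec q) × St n q) (θ : Vec q) (b : ℝ) : St n q :=
  y.1 + (fun i => inner ℝ (y.2.1 i) θ, 0, 0) + b • y.2.2

theorem assemble_sub (y y' : St n q × (Fin n → Vec q) × St n q) (θ : Vec q) (b : ℝ) :
    assemble (y - y') θ b = assemble y θ b - assemble y' θ b := by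
  have h : ((fun i => inner ℝ ((y - y').2.1 i) θ, 0, 0) : St n q)
      = (fun i => inner ℝ (y.2.1 i) θ, 0, 0) - (fun i => inner ℝ (y'.2.1 i) θ, 0, 0) := by
    refine Prod.ext (funext fun i => ?_) (Prod.ext ?_ ?_)
    · simp [inner_sub_left]
    · simp
    · simp
  simp only [assemble]
  rw [h, Prod.fst_sub, Prod.snd_sub, Prod.snd_sub, smul_sub]
  abel

theorem norm_assemble_le (y : St n q × (Fin n → Vec q) × St n q) (θ : Vec q) (b : ℝ) :
    ‖assemble y θ b‖ ≤ ‖y‖ * (1 + ‖θ‖ + |b|) := by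
  have h1 : ‖y.1‖ ≤ ‖y‖ := norm_fst_le y
  have h2 : ‖y.2.1‖ ≤ ‖y‖ := (norm_fst_le y.2).trans (norm_snd_le y)
  have h3 : ‖y.2.2‖ ≤ ‖y‖ := (norm_snd_le y.2).trans (norm_snd_le y)
  have h4 : ‖((fun i => inner ℝ (y.2.1 i) θ, 0, 0) : St n q)‖ ≤ ‖y‖ * ‖θ‖ := by
    have h0 : 0 ≤ ‖y‖ * ‖θ‖ := by positivity
    refine max_le ((pi_norm_le_iff_of_nonneg h0).2 fun i => ?_) (max_le (by simpa) (by simpa))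
    refine (norm_inner_le_norm _ _).trans ?_
    gcongr
    exact (norm_le_pi_norm _ i).trans h2
  calc ‖assemble y θ b‖ ≤ ‖y.1‖ + ‖((fun i => inner ℝ (y.2.1 i) θ, 0, 0) : St n q)‖
        + ‖b • y.2.2‖ := norm_add₃_le
    _ ≤ ‖y‖ + ‖y‖ * ‖θ‖ + |b| * ‖y‖ := by
        rw [norm_smul, Real.norm_eq_abs]; gcongr
    _ = _ := by ring

theorem continuous_assemble :
    Continuous fun w : (St n q × (Fin n → Vec q) × St n q) × Vec q × ℝ =>
      assemble w.1 w.2.1 w.2.2 := by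
  unfold assemble
  refine (continuous_fst.fst.add ?_).add (by fun_prop)
  refine Continuous.prodMk (continuous_pi fun i => ?_) continuous_const
  exact Continuous.inner (by fun_prop) (by fun_prop)

section ClosedLoop

variable {P : DesignData q} {W : Rows q} {Ωb : Pt n q → Fin n → ℝ} {β : ℝ → ℝ}
  {θ : ℝ → Vec q} {b : ℝ → ℝ} {ℓθ : Vec q} {ℓb : ℝ}

theorem field_eq_assemble (t : ℝ) (s : St n q) : field P W Ωb β θ b t s
    = assemble (fieldParts P W Ωb (pt β t s, s.2.2)) (θ t) (b t) := by
  refine Prod.ext (funext fun i => ?_) (Prod.ext ?_ ?_)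
  · simp only [field, assemble, fieldParts, control, Prod.fst_add, Prod.smul_fst, Pi.add_apply,
      Pi.smul_apply, smul_eq_mul]
    split_ifs <;> ring
  · simp [field, assemble, fieldParts, thetaLaw]
  · simp [field, assemble, fieldParts, rhoLaw]

theorem IsFactorization.contDiffOn_ubar (hn : 2 ≤ n) (hP : P.Valid n)
    (hF : IsFactorization n P W Ωb) : ContDiffOn ℝ ∞ (ubar P W Ωb) (region n P) := by
  have hz := contDiffOn_zf hP (hF.isVirtualControl hP) (k := n) (by omega) le_rfl
  have hκ : ContDiffOn ℝ ∞ (kappa P W Ωb) (region n P) :=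
    contDiffOn_const.add (contDiffOn_const.mul ((((contDiffOn_const.mul
      (contDiffOn_frobSq (hF.W_smooth n hn le_rfl))).add contDiffOn_const).add
      contDiffOn_const).add (contDiffOn_const.mul
      (ContDiffOn.sum fun k _ => (contDiffOn_pi.1 hF.Ω_smooth k).pow 2))))
  exact hκ.neg.mul hz

theorem IsFactorization.contDiffOn_fieldParts (hn : 2 ≤ n) (hP : P.Valid n)
    (hF : IsFactorization n P W Ωb) :
    ContDiffOn ℝ ∞ (fieldParts P W Ωb) (region n P ×ˢ univ) := by
  have ha := hF.isVirtualControl hP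
  have hl : ∀ {F : Type} [NormedAddCommGroup F] [NormedSpace ℝ F] {f : Pt n q → F},
      ContDiffOn ℝ ∞ f (region n P) →
      ContDiffOn ℝ ∞ (fun y : Pt n q × ℝ => f y.1) (region n P ×ˢ univ) := fun hf =>
    hf.comp contDiffOn_fst fun y hy => hy.1
  have hz := contDiffOn_zf hP ha (k := n) (by omega) le_rfl
  have hu := hF.contDiffOn_ubar hn hP
  refine ContDiffOn.prodMk (ContDiffOn.prodMk (contDiffOn_pi.2 fun i => ?_)
    (ContDiffOn.prodMk (hl (contDiffOn_tau hP (by omega) le_rfl ha le_rfl))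
      ((contDiffOn_const.mul (hl hz)).mul (hl hu))))
    (ContDiffOn.prodMk (contDiffOn_pi.2 fun i => hl (contDiffOn_reg hP (by omega) (by omega) _))
      (ContDiffOn.prodMk (contDiffOn_pi.2 fun i => ?_) contDiffOn_const))
  · by_cases h : i.val + 1 < n
    · simp only [if_pos h]; exact hl (contDiff_xc _).contDiffOn
    · simp only [if_neg h]; exact contDiffOn_const
  · by_cases h : i.val + 1 < n
    · simp only [if_pos h]; exact contDiffOn_const
    · simp only [if_neg h]; exact contDiffOn_snd.mul (hl hu)

theorem norm_pt_sub_le (β : ℝ → ℝ) (t : ℝ) (s s' : St n q) :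
    ‖(pt β t s, s.2.2) - (pt β t s', s'.2.2)‖ ≤ ‖s - s'‖ := by
  refine max_le (max_le (norm_fst_le (s - s')) (max_le ?_ ?_)) ?_
  · have : ((pt β t s, s.2.2) - (pt β t s', s'.2.2) : Pt n q × ℝ).1.2.1 = 0 := by
      simp [pt]
    rw [this, norm_zero]; exact norm_nonneg _
  · exact (norm_fst_le (s - s').2).trans (norm_snd_le (s - s'))
  · exact (norm_snd_le (s - s').2).trans (norm_snd_le (s - s'))

/-- Near the states that a compact part of the region allows at time `t`, the closed-loop field
agrees with a field that satisfies the hypotheses of `exists_halfline_solution`. -/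
theorem IsClosedLoop.exists_modified_field (h : IsClosedLoop P W Ωb β θ b ℓθ ℓb)
    {K : Set (Pt n q × ℝ)} (hK : IsCompact K) (hKr : K ⊆ region n P ×ˢ univ) :
    ∃ (r : ℝ) (f : ℝ → St n q → St n q) (L : ℝ → ℝ) (S : Set ℝ), 0 < r ∧ LocallyFiniteTimes S ∧
      (∀ t, 0 < t → t ∉ S → ContinuousAt L t) ∧ (∀ R, ∃ C, ∀ t ∈ Icc 0 R, ‖L t‖ ≤ C) ∧
      (∀ t, 0 ≤ L t) ∧ (∀ y t, 0 < t → t ∉ S → ContinuousAt (fun s => f s y) t) ∧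
      (∀ t y y', ‖f t y - f t y'‖ ≤ L t * ‖y - y'‖) ∧ (∀ t y, ‖f t y‖ ≤ L t) ∧
      ∀ t s s', (pt β t s', s'.2.2) ∈ K → dist s s' ≤ r → f t s = field P W Ωb β θ b t s := by
  obtain ⟨r, F', C, hr, hC, hb, hlip, heq⟩ := exists_bounded_lipschitz_eq_near_compact
    ((isOpen_region h.valid).prod isOpen_univ) hK hKr
    (h.factor.contDiffOn_fieldParts h.two_le h.valid)
  obtain ⟨S₁, hS₁, hθ⟩ := h.theta_pc.continuousAt_off
  obtain ⟨S₂, hS₂, hb'⟩ := h.b_pc.continuousAt_off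
  obtain ⟨S₃, hS₃, hβ⟩ := h.perf.exists_regular
  have hFc : Continuous F' :=
    (LipschitzWith.of_dist_le_mul (K := ⟨C, hC⟩) fun x y => by
      rw [dist_eq_norm, dist_eq_norm]; exact hlip x y).continuous
  refine ⟨r, fun t s => assemble (F' (pt β t s, s.2.2)) (θ t) (b t),
    fun t => C * (1 + ‖θ t‖ + |b t|), S₁ ∪ S₂ ∪ S₃, hr, (hS₁.union hS₂).union hS₃,
    fun t ht htS => ?_, fun R => ?_, fun t => by positivity, fun y t ht htS => ?_,
    fun t y y' => ?_, fun t y => ?_, fun t s s' hs' hd => ?_⟩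
  · have h1 := hθ t ht fun h1 => htS (Or.inl (Or.inl h1))
    have h2 := hb' t ht fun h1 => htS (Or.inl (Or.inr h1))
    exact continuousAt_const.mul ((continuousAt_const.add h1.norm).add h2.abs)
  · obtain ⟨C₁, h1⟩ := h.theta_pc.exists_bound R
    obtain ⟨C₂, h2⟩ := h.b_pc.exists_bound R
    refine ⟨C * (1 + C₁ + C₂), fun t ht => ?_⟩
    have h3 := h1 t ht
    have h4 : |b t| ≤ C₂ := h2 t ht
    rw [Real.norm_eq_abs, abs_of_nonneg (by positivity)]
    exact mul_le_mul_of_nonneg_left (by linarith) hC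
  · have h1 := hθ t ht fun h1 => htS (Or.inl (Or.inl h1))
    have h2 := hb' t ht fun h1 => htS (Or.inl (Or.inr h1))
    have h3 := (hβ t ht fun h1 => htS (Or.inr h1)).2
    have h4 : ContinuousAt (fun s => (pt β s y, y.2.2)) t := by
      refine ContinuousAt.prodMk (ContinuousAt.prodMk continuousAt_const
        (ContinuousAt.prodMk (continuousAt_pi.2 fun j => h3 j (by omega)) continuousAt_const))
        continuousAt_const
    have h5 : ContinuousAt (fun s => (F' (pt β s y, y.2.2), θ s, b s)) t :=
      (hFc.continuousAt.comp h4).prodMk (h1.prodMk h2)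
    exact continuous_assemble.continuousAt.comp h5
  · simp only
    rw [← assemble_sub]
    refine (norm_assemble_le _ _ _).trans ?_
    calc _ ≤ C * ‖y - y'‖ * (1 + ‖θ t‖ + |b t|) := by
          gcongr
          exact (hlip _ _).trans (mul_le_mul_of_nonneg_left (norm_pt_sub_le β t y y') hC)
      _ = _ := by ring
  · refine (norm_assemble_le _ _ _).trans ?_
    exact mul_le_mul_of_nonneg_right (hb _) (by positivity)
  · simp only
    rw [heq _ hs' _ ((dist_eq_norm _ _).trans_le
      ((norm_pt_sub_le β t s s').trans ((dist_eq_norm s s').symm.trans_le hd))),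
      ← field_eq_assemble]

/-- A solution that stays in the region with a bounded Lyapunov function is unique. -/
theorem IsClosedLoop.unique (h : IsClosedLoop P W Ωb β θ b ℓθ ℓb) {X Y : ℝ → St n q} {c : ℝ}
    (hX : IsSolution P W Ωb β θ b ⊤ X) (hXr : ∀ t, 0 ≤ t → pt β t (X t) ∈ region n P)
    (hXV : ∀ t, 0 ≤ t → lyapAt P W β ℓθ ℓb t (X t) ≤ c) {T : EReal}
    (hY : IsSolution P W Ωb β θ b T Y) (h0 : Y 0 = X 0) {t : ℝ} (ht : 0 ≤ t) (htT : (t : EReal) < T) :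
    Y t = X t := by
  obtain ⟨K, hK, hKr, hKX⟩ := h.exists_compact_of_lyapAt_le c
  obtain ⟨r, f, L, -, hr, -, -, hLb, hL0, -, hlip, -, heq⟩ := h.exists_modified_field hK hKr
  obtain ⟨hXc, S₁, hS₁, hXd⟩ := hX
  obtain ⟨hYc, S₂, hS₂, hYd⟩ := hY
  have hlt : ∀ s, s ≤ t → (s : EReal) < T := fun s hs =>
    lt_of_le_of_lt (EReal.coe_le_coe_iff.2 hs) htT
  have hXc' : ContinuousOn X (Icc 0 t) := hXc.mono fun s hs => ⟨hs.1, EReal.coe_lt_top s⟩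
  have hYc' : ContinuousOn Y (Icc 0 t) := hYc.mono fun s hs => ⟨hs.1, hlt s hs.2⟩
  refine IsClosed.mem_of_ge_of_forall_exists_gt (a := 0) (b := t) (s := {s | Y s = X s}) ?_ h0 ht ?_
  · have h1 : ContinuousOn (fun s => Y s - X s) (Icc 0 t) := hYc'.sub hXc'
    have h2 := h1.preimage_isClosed_of_isClosed isClosed_Icc (isClosed_singleton (x := (0 : St n q)))
    convert h2 using 1
    ext s
    simp only [mem_inter_iff, Set.mem_ofPred_eq, mem_preimage, mem_singleton_iff, sub_eq_zero]
    exact and_comm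
  · rintro x ⟨hx, hx0, hxt⟩
    simp only [Set.mem_ofPred_eq] at hx
    -- the two solutions stay `r`-close for a short time
    obtain ⟨y, hxy, hyt, hclose⟩ : ∃ y, x < y ∧ y ≤ t ∧ ∀ s ∈ Icc x y, dist (Y s) (X s) ≤ r := by
      have h1 : ContinuousWithinAt (fun s => dist (Y s) (X s)) (Icc 0 t) x :=
        (continuous_dist.comp_continuousOn (hYc'.prodMk hXc')) x ⟨hx0, hxt.le⟩
      have h2 : ∀ᶠ s in 𝓝[Icc 0 t] x, dist (Y s) (X s) < r :=
        h1.eventually_lt_const (by show dist (Y x) (X x) < r; rw [hx, dist_self]; exact hr)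
      have h3 : ∀ᶠ s in 𝓝[≥] x, dist (Y s) (X s) < r :=
        h2.filter_mono (nhdsWithin_le_of_mem (mem_of_superset (Icc_mem_nhdsGE hxt)
          (Icc_subset_Icc_left hx0)))
      obtain ⟨u, hu, hu'⟩ := mem_nhdsGE_iff_exists_Icc_subset.1 h3
      exact ⟨min u t, lt_min hu hxt, min_le_right _ _, fun s hs =>
        (hu' ⟨hs.1, hs.2.trans (min_le_left _ _)⟩ : dist (Y s) (X s) < r).le⟩
    refine ⟨y, ?_, hxy, hyt⟩
    obtain ⟨C, hC⟩ := hLb t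
    have hC0 : 0 ≤ C := (norm_nonneg _).trans (hC 0 ⟨le_rfl, ht⟩)
    have hsub : Icc x y ⊆ Icc 0 t := Icc_subset_Icc hx0 hyt
    have key := eq_zero_of_norm_deriv_le_off_finite ((hS₁.union hS₂) t)
      (h := fun s => Y s - X s) (h' := fun s => f s (Y s) - f s (X s)) hxy.le hC0
      ((hYc'.sub hXc').mono hsub) (fun s hs hsS => ?_) (by simp [hx])
    · exact sub_eq_zero.1 key
    · have hsI := hsub (Ioo_subset_Icc_self hs)
      have hs0 : 0 < s := hx0.trans_lt hs.1
      have hsS' : s ∉ S₁ ∪ S₂ := fun h1 => hsS ⟨h1, hsI⟩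
      have hsK := (hKX s hs0.le (X s) (hXr s hs0.le) (hXV s hs0.le)).1
      have e1 := hYd s hs0 (hlt s hsI.2) fun h1 => hsS' (Or.inr h1)
      have e2 := hXd s hs0 (EReal.coe_lt_top s) fun h1 => hsS' (Or.inl h1)
      rw [← heq s (Y s) (X s) hsK (hclose s (Ioo_subset_Icc_self hs))] at e1
      rw [← heq s (X s) (X s) hsK (by rw [dist_self]; exact hr.le)] at e2
      refine ⟨e1.sub e2, (hlip s _ _).trans ?_⟩
      gcongr
      exact (le_abs_self _).trans (hC s hsI)

theorem pt_zero_mem_region (hP : P.Valid n) (hβ : IsPerformanceFunction n β)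
    (s : St n q) : pt β 0 s ∈ region n P := by
  have h1 : bc (pt β 0 s) 0 = 1 := by
    rw [bc_pt β 0 s (Nat.zero_le n), IsPerformanceFunction.timeDeriv_zero, hβ.init]
  have hm := strictMono_psi hP
  show 0 < bc (pt β 0 s) 0 ∧ |P.ψ (xc (pt β 0 s) 1)| < bc (pt β 0 s) 0
  rw [h1]
  set x := xc (pt β 0 s) 1
  refine ⟨one_pos, abs_lt.2 ⟨?_, ?_⟩⟩
  · exact (hm.monotone.le_of_tendsto hP.ψ_normalized.limit_bot (x - 1)).trans_lt (hm (by linarith))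
  · exact (hm (by linarith : x < x + 1)).trans_le
      (hm.monotone.ge_of_tendsto hP.ψ_normalized.limit_top (x + 1))

/-- Global existence. The solution of the modified field cannot leave the sublevel set on which the
modification is inactive. -/
theorem IsClosedLoop.exists_solution (h : IsClosedLoop P W Ωb β θ b ℓθ ℓb) {s₀ : St n q}
    (hs₀ : 0 < P.sgn * s₀.2.2) :
    ∃ X : ℝ → St n q, IsSolution P W Ωb β θ b ⊤ X ∧ X 0 = s₀ ∧
      (∀ t, 0 ≤ t → pt β t (X t) ∈ region n P) ∧
      (∀ t, 0 ≤ t → lyapAt P W β ℓθ ℓb t (X t) ≤ lyapAt P W β ℓθ ℓb 0 s₀) ∧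
      ∀ t, 0 ≤ t → P.sgn * s₀.2.2 ≤ P.sgn * (X t).2.2 := by
  have hn1 : 1 ≤ n := by have := h.two_le; omega
  set V₀ := lyapAt P W β ℓθ ℓb 0 s₀ with hV₀
  obtain ⟨K, hK, hKr, hKX⟩ := h.exists_compact_of_lyapAt_le (V₀ + 1)
  obtain ⟨r, f, L, S, hr, hS, hLc, hLb, hL0, hfc, hlip, hfb, heq⟩ := h.exists_modified_field hK hKr
  obtain ⟨X, hX0, hXc, hXd⟩ := exists_halfline_solution hS.countable hLc hLb (fun t _ => hL0 t) hfc
    (fun t _ => hlip t) (fun t _ => hfb t) s₀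
  have hfield : ∀ t, 0 ≤ t → pt β t (X t) ∈ region n P → lyapAt P W β ℓθ ℓb t (X t) ≤ V₀ + 1 →
      f t (X t) = field P W Ωb β θ b t (X t) := fun t ht h1 h2 =>
    heq t (X t) (X t) (hKX t ht _ h1 h2).1 (by rw [dist_self]; exact hr.le)
  have hmain : ∀ T, 0 ≤ T → T ∈ {t | pt β t (X t) ∈ region n P ∧
      lyapAt P W β ℓθ ℓb t (X t) ≤ V₀ ∧ P.sgn * s₀.2.2 ≤ P.sgn * (X t).2.2} := by
    intro T hT
    have hlowc : ContinuousOn (fun t => (low (pt β t (X t)), (X t).2.2)) (Ici 0) :=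
      h.continuousOn_low_pt Subset.rfl hXc.continuousOn
    refine IsClosed.mem_of_ge_of_forall_exists_gt (a := 0) (b := T) ?_ ?_ hT ?_
    · -- the conditions are closed in terms of the continuous path in the compact set `K`
      have hQ : IsClosed (K ∩ (lyap P (alpha P W) ℓθ ℓb ⁻¹' Iic V₀)) :=
        ((continuousOn_lyap h.valid h.ha ℓθ ℓb).mono hKr).preimage_isClosed_of_isClosed
          hK.isClosed isClosed_Iic
      have hQ' : IsClosed (K ∩ (lyap P (alpha P W) ℓθ ℓb ⁻¹' Iic V₀)
          ∩ {y | P.sgn * s₀.2.2 ≤ P.sgn * y.2}) :=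
        hQ.inter (isClosed_le continuous_const (by fun_prop))
      have := (hlowc.mono Icc_subset_Ici_self).preimage_isClosed_of_isClosed
        (isClosed_Icc (a := (0 : ℝ)) (b := T)) hQ'
      convert this using 1
      ext t
      constructor
      · rintro ⟨⟨h1, h2, h3⟩, ht⟩
        exact ⟨ht, ⟨(hKX t ht.1 _ h1 (by linarith)).2, (lyap_low h.ha ℓθ ℓb _ _).trans_le h2⟩, h3⟩
      · rintro ⟨ht, ⟨h1, h2⟩, h3⟩
        exact ⟨⟨(low_mem_region_iff hn1).1 (hKr h1).1,
          (lyap_low h.ha ℓθ ℓb _ _).symm.trans_le h2, h3⟩, ht⟩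
    · refine ⟨pt_zero_mem_region h.valid h.perf _, ?_, ?_⟩
      · rw [hX0]
      · rw [hX0]
    · rintro x ⟨⟨h1, h2, h3⟩, hx0, hxT⟩
      -- the weaker strict conditions persist for a short time
      obtain ⟨y, hxy, hyT, hloc⟩ : ∃ y, x < y ∧ y ≤ T ∧ ∀ t ∈ Icc x y, pt β t (X t) ∈ region n P ∧
          lyapAt P W β ℓθ ℓb t (X t) ≤ V₀ + 1 ∧ 0 < P.sgn * (X t).2.2 := by
        have hreg : IsOpen (region n P ×ˢ (univ : Set ℝ)) :=
          (isOpen_region h.valid).prod isOpen_univ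
        have hlr : (low (pt β x (X x)), (X x).2.2) ∈ region n P ×ˢ (univ : Set ℝ) :=
          ⟨(low_mem_region_iff hn1).2 h1, mem_univ _⟩
        have hcx : ContinuousWithinAt (fun t => (low (pt β t (X t)), (X t).2.2)) (Ici x) x :=
          (hlowc x hx0).mono (Ici_subset_Ici.2 hx0)
        have e1 : ∀ᶠ t in 𝓝[≥] x, (low (pt β t (X t)), (X t).2.2) ∈ region n P ×ˢ (univ : Set ℝ) :=
          hcx (hreg.mem_nhds hlr)
        have e2 : ∀ᶠ t in 𝓝[≥] x, lyap P (alpha P W) ℓθ ℓb (low (pt β t (X t)), (X t).2.2)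
            < V₀ + 1 := by
          have hc := ContinuousAt.comp_continuousWithinAt (g := lyap P (alpha P W) ℓθ ℓb)
            (f := fun t => (low (pt β t (X t)), (X t).2.2))
            ((continuousOn_lyap h.valid h.ha ℓθ ℓb).continuousAt (hreg.mem_nhds hlr)) hcx
          refine hc.eventually_lt_const ?_
          simp only [Function.comp]
          rw [lyap_low h.ha]
          have : lyap P (alpha P W) ℓθ ℓb (pt β x (X x), (X x).2.2) ≤ V₀ := h2
          linarith
        have e3 : ∀ᶠ t in 𝓝[≥] x, 0 < P.sgn * (X t).2.2 := by
          have hc : ContinuousWithinAt (fun t => P.sgn * (X t).2.2) (Ici x) x := by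
            have : Continuous fun t => P.sgn * (X t).2.2 := by fun_prop
            exact this.continuousWithinAt
          exact hc.eventually_const_lt (hs₀.trans_le h3)
        obtain ⟨u, hu, hu'⟩ := mem_nhdsGE_iff_exists_Icc_subset.1 ((e1.and e2).and e3)
        refine ⟨min u T, lt_min hu hxT, min_le_right _ _, fun t ht => ?_⟩
        obtain ⟨⟨f1, f2⟩, f3⟩ := hu' ⟨ht.1, ht.2.trans (min_le_left _ _)⟩
        exact ⟨(low_mem_region_iff hn1).1 f1.1, (lyap_low h.ha ℓθ ℓb _ _).symm.trans_le f2.le, f3⟩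
      have hd : ∀ t ∈ Ioo x y, t ∉ S → HasDerivAt X (field P W Ωb β θ b t (X t)) t :=
        fun t ht htS => by
          have ht0 := hx0.trans_lt ht.1
          obtain ⟨f1, f2, -⟩ := hloc t (Ioo_subset_Icc_self ht)
          rw [← hfield t ht0.le f1 f2]
          exact hXd t ht0 htS
      have hdiss : ∀ t ∈ Ioo x y, t ∉ S → HasDerivAt (fun _ : ℝ => (0 : ℝ)) ((fun _ => 0) t) t ∧
          (fun _ => (0 : ℝ)) t ≤ dissAt P W β t (X t) := fun t _ _ =>
        ⟨hasDerivAt_const _ _, Finset.sum_nonneg fun k hk => by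
          have := h.valid.k_pos k (Finset.mem_Icc.1 hk).1 (Finset.mem_Icc.1 hk).2
          positivity⟩
      have hV := h.lyapAt_add_le hS hx0 hxy.le hXc.continuousOn hd (fun t ht => (hloc t ht).1)
        (fun t ht => (hloc t ht).2.2) continuousOn_const hdiss
      have hρ := h.sgn_rho_le hS hx0 hxy.le hXc.continuousOn hd
      refine ⟨y, ⟨(hloc y (right_mem_Icc.2 hxy.le)).1, ?_, h3.trans hρ⟩, hxy, hyT⟩
      simp only [add_zero] at hV
      exact hV.trans h2
  refine ⟨X, ⟨hXc.continuousOn, S, hS, fun t ht _ htS => ?_⟩, hX0, fun t ht => (hmain t ht).1,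
    fun t ht => (hmain t ht).2.1, fun t ht => (hmain t ht).2.2⟩
  obtain ⟨f1, f2, -⟩ := hmain t ht.le
  rw [← hfield t ht.le f1 (by linarith)]
  exact hXd t ht htS

end ClosedLoop

/-! ### Asymptotic behaviour -/

theorem exists_tendsto_of_antitoneOn_Ici {f : ℝ → ℝ} {m : ℝ} (hf : AntitoneOn f (Ici 0))
    (hm : ∀ t, 0 ≤ t → m ≤ f t) : ∃ l, Tendsto f atTop (𝓝 l) := by
  have h1 : Antitone fun t => f (max t 0) := fun s t hst =>
    hf (le_max_right s 0) (le_max_right t 0) (max_le_max hst le_rfl)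
  have h2 : BddBelow (range fun t => f (max t 0)) :=
    ⟨m, forall_mem_range.2 fun t => hm _ (le_max_right _ _)⟩
  refine ⟨_, (tendsto_atTop_ciInf h1 h2).congr' ?_⟩
  filter_upwards [eventually_ge_atTop 0] with t ht
  rw [max_eq_left ht]

theorem lyap_nonneg {P : DesignData q} (hP : P.Valid n) (a : ℕ → Pt n q → ℝ) (ℓθ : Vec q)
    {ℓb : ℝ} (y : Pt n q × ℝ) : 0 ≤ lyap P a ℓθ ℓb y := by
  have h := (lyap_bounds hP a ℓθ (ℓb := ℓb) y).2.2.2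
  have := hP.γ_pos
  exact le_trans (by positivity) h

theorem continuous_gainInv (P : DesignData q) : Continuous (gainInv P) :=
  (LinearMap.toContinuousLinearMap (Matrix.toEuclideanLin P.Γ⁻¹)).continuous

section ClosedLoop

variable {P : DesignData q} {W : Rows q} {Ωb : Pt n q → Fin n → ℝ} {β : ℝ → ℝ}
  {θ : ℝ → Vec q} {b : ℝ → ℝ} {ℓθ : Vec q} {ℓb : ℝ} {X : ℝ → St n q}

/-- Global solutions inside the region along which the Lyapunov function does not exceed its initial
value and `ρ̂` keeps the sign of the input gain. -/
structure IsTrajectory (P : DesignData q) (W : Rows q) (Ωb : Pt n q → Fin n → ℝ) (β : ℝ → ℝ)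
    (θ : ℝ → Vec q) (b : ℝ → ℝ) (ℓθ : Vec q) (ℓb : ℝ) (X : ℝ → St n q) : Prop where
  sol : IsSolution P W Ωb β θ b ⊤ X
  mem : ∀ t, 0 ≤ t → pt β t (X t) ∈ region n P
  lyap_le : ∀ t, 0 ≤ t → lyapAt P W β ℓθ ℓb t (X t) ≤ lyapAt P W β ℓθ ℓb 0 (X 0)
  rho_pos : ∀ t, 0 ≤ t → 0 < P.sgn * (X t).2.2

theorem IsClosedLoop.exists_trajectory (h : IsClosedLoop P W Ωb β θ b ℓθ ℓb) {s₀ : St n q}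
    (hs₀ : 0 < P.sgn * s₀.2.2) : ∃ X, IsTrajectory P W Ωb β θ b ℓθ ℓb X ∧ X 0 = s₀ := by
  obtain ⟨X, h1, h2, h3, h4, h5⟩ := h.exists_solution hs₀
  exact ⟨X, ⟨h1, h3, h2 ▸ h4, fun t ht => hs₀.trans_le (h5 t ht)⟩, h2⟩

theorem IsTrajectory.lyapAt_add_le (h : IsClosedLoop P W Ωb β θ b ℓθ ℓb)
    (hX : IsTrajectory P W Ωb β θ b ℓθ ℓb X) {s t : ℝ} (hs : 0 ≤ s) (hst : s ≤ t) {g g' : ℝ → ℝ}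
    (hgc : ContinuousOn g (Ici 0))
    (hg : ∀ r, 0 < r → HasDerivAt X (field P W Ωb β θ b r (X r)) r → HasDerivAt g (g' r) r ∧
      g' r ≤ dissAt P W β r (X r)) :
    lyapAt P W β ℓθ ℓb t (X t) + g t ≤ lyapAt P W β ℓθ ℓb s (X s) + g s := by
  obtain ⟨hc, S, hS, hd⟩ := hX.sol
  have hI : Icc s t ⊆ Ici 0 := fun r hr => hs.trans hr.1
  have hd' : ∀ r ∈ Ioo s t, r ∉ S → HasDerivAt X (field P W Ωb β θ b r (X r)) r :=
    fun r hr hrS => hd r (hs.trans_lt hr.1) (EReal.coe_lt_top r) hrS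
  exact h.lyapAt_add_le hS hs hst (hc.mono fun r hr => ⟨hI hr, EReal.coe_lt_top r⟩) hd'
    (fun r hr => hX.mem r (hI hr)) (fun r hr => hX.rho_pos r (hI hr)) (hgc.mono hI)
    fun r hr hrS => hg r (hs.trans_lt hr.1) (hd' r hr hrS)

theorem DesignData.Valid.exists_le_k {P : DesignData q} (hP : P.Valid n) (hn : 1 ≤ n) :
    ∃ κ, 0 < κ ∧ ∀ k ∈ Finset.Icc 1 n, κ ≤ P.k k := by
  obtain ⟨j, hj, hmin⟩ := Finset.exists_min_image (Finset.Icc 1 n) P.k ⟨1, by simp [hn]⟩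
  rw [Finset.mem_Icc] at hj
  exact ⟨P.k j, hP.k_pos j hj.1 hj.2, hmin⟩

theorem mul_sum_zf_sq_le_dissAt {κ : ℝ} (hκ : ∀ k ∈ Finset.Icc 1 n, κ ≤ P.k k) (t : ℝ)
    (s : St n q) :
    κ * ∑ k ∈ Finset.Icc 1 n, zf P (alpha P W) k (pt β t s) ^ 2 ≤ dissAt P W β t s := by
  rw [Finset.mul_sum]
  exact Finset.sum_le_sum fun k hk => mul_le_mul_of_nonneg_right (hκ k hk) (sq_nonneg _)

theorem dissAt_nonneg (hP : P.Valid n) (t : ℝ) (s : St n q) : 0 ≤ dissAt P W β t s :=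
  Finset.sum_nonneg fun k hk => by
    have := hP.k_pos k (Finset.mem_Icc.1 hk).1 (Finset.mem_Icc.1 hk).2
    positivity

/-- A trajectory stays in a compact part of the region. -/
theorem IsTrajectory.exists_compact (h : IsClosedLoop P W Ωb β θ b ℓθ ℓb)
    (hX : IsTrajectory P W Ωb β θ b ℓθ ℓb X) :
    ∃ K : Set (Pt n q), IsCompact K ∧ K ⊆ region n P ∧ ∃ M, ∀ t, 0 ≤ t →
      pt β t (X t) ∈ K ∧ |(X t).2.2| ≤ M := by
  obtain ⟨K, hK, hKr, hKm⟩ := h.exists_compact_of_lyapAt_le (lyapAt P W β ℓθ ℓb 0 (X 0))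
  obtain ⟨M, hM⟩ := h.exists_bound_of_lyapAt_le (lyapAt P W β ℓθ ℓb 0 (X 0))
  refine ⟨Prod.fst '' K, hK.image continuous_fst, ?_, M, fun t ht =>
    ⟨⟨_, (hKm t ht _ (hX.mem t ht) (hX.lyap_le t ht)).1, rfl⟩,
      (hM t ht _ (hX.lyap_le t ht)).2.1⟩⟩
  rintro _ ⟨y, hy, rfl⟩
  exact (hKr hy).1

theorem IsTrajectory.exists_tendsto_lyapAt (h : IsClosedLoop P W Ωb β θ b ℓθ ℓb)
    (hX : IsTrajectory P W Ωb β θ b ℓθ ℓb X) :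
    ∃ l, Tendsto (fun t => lyapAt P W β ℓθ ℓb t (X t)) atTop (𝓝 l) := by
  refine exists_tendsto_of_antitoneOn_Ici (m := 0) (fun s hs t _ hst => ?_)
    fun t _ => lyap_nonneg h.valid _ _ _
  have := hX.lyapAt_add_le h hs hst (g := fun _ => 0) (g' := fun _ => 0) continuousOn_const
    fun r _ _ => ⟨hasDerivAt_const _ _, dissAt_nonneg h.valid _ _⟩
  simpa using this

/-- The rate of `θ̂` is dominated by the dissipation, so adding a small multiple of a coordinate of
`θ̂` to the Lyapunov function gives another decreasing function. -/
theorem IsTrajectory.exists_tendsto_theta (h : IsClosedLoop P W Ωb β θ b ℓθ ℓb)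
    (hX : IsTrajectory P W Ωb β θ b ℓθ ℓb X) :
    ∃ θlim, Tendsto (fun t => (X t).2.1) atTop (𝓝 θlim) := by
  have hn := h.two_le
  obtain ⟨K, hK, hKr, _, hKX⟩ := hX.exists_compact h
  obtain ⟨M, hM⟩ := h.exists_bound_of_lyapAt_le (lyapAt P W β ℓθ ℓb 0 (X 0))
  obtain ⟨C, hC0, hC⟩ := exists_norm_tau_le hn h.valid h.factor hK hKr
  obtain ⟨κ, hκ0, hκ⟩ := h.valid.exists_le_k (by omega)
  obtain ⟨v, hv⟩ := hX.exists_tendsto_lyapAt h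
  set c := κ / (C + 1) with hc
  have hc0 : 0 < c := by positivity
  have hcont : ContinuousOn X (Ici 0) := hX.sol.1.mono fun t ht => ⟨ht, EReal.coe_lt_top t⟩
  have hcoord : ∀ (y : Vec q) (i : Fin q), |y i| ≤ ‖y‖ := fun y i => PiLp.norm_apply_le y i
  have hlim : ∀ i : Fin q, ∃ l, Tendsto (fun t => (X t).2.1 i) atTop (𝓝 l) := by
    intro i
    suffices hanti : ∃ l, Tendsto (fun t => lyapAt P W β ℓθ ℓb t (X t) + c * (X t).2.1 i) atTop
        (𝓝 l) by
      obtain ⟨l, hl⟩ := hanti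
      refine ⟨(l - v) / c, ((hl.sub hv).div_const c).congr fun t => ?_⟩
      rw [add_sub_cancel_left, mul_div_cancel_left₀ _ hc0.ne']
    refine exists_tendsto_of_antitoneOn_Ici (m := -(c * M)) (fun s hs t _ hst => ?_)
      fun t ht => ?_
    · refine hX.lyapAt_add_le h hs hst (g := fun t => c * (X t).2.1 i)
        (g' := fun t => c * thetaLaw P W β t (X t) i)
        (continuousOn_const.mul ((EuclideanSpace.proj i).continuous.comp_continuousOn hcont.snd.fst))
        fun r hr hd => ⟨?_, ?_⟩
      · have h1 : HasDerivAt (fun s => (X s).2.1) (thetaLaw P W β r (X r)) r := hd.snd.fst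
        exact ((EuclideanSpace.proj (𝕜 := ℝ) i).hasFDerivAt.comp_hasDerivAt r h1).const_mul c
      · refine le_trans ?_ (mul_sum_zf_sq_le_dissAt hκ r (X r))
        set E := ∑ k ∈ Finset.Icc 1 n, zf P (alpha P W) k (pt β r (X r)) ^ 2
        have hz : 0 ≤ E := Finset.sum_nonneg fun k _ => sq_nonneg _
        have h2 : thetaLaw P W β r (X r) i ≤ (C + 1) * E :=
          ((le_abs_self _).trans (hcoord _ i)).trans
            ((hC _ (hKX r hr.le).1).trans (mul_le_mul_of_nonneg_right (by linarith) hz))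
        calc c * thetaLaw P W β r (X r) i ≤ c * ((C + 1) * E) :=
              mul_le_mul_of_nonneg_left h2 hc0.le
          _ = κ * E := by rw [hc]; field_simp
    · have h1 := lyap_nonneg h.valid (alpha P W) ℓθ (ℓb := ℓb) (pt β t (X t), (X t).2.2)
      have h2 : ‖(X t).2.1‖ ≤ M :=
        (norm_snd_le (pt β t (X t)).2).trans (hM t ht _ (hX.lyap_le t ht)).1
      have h3 := neg_le_of_abs_le ((hcoord _ i).trans h2)
      have h4 := mul_le_mul_of_nonneg_left h3 hc0.le
      change 0 ≤ lyapAt P W β ℓθ ℓb t (X t) at h1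
      simp only
      linarith
  choose l hl using hlim
  exact ⟨WithLp.toLp 2 l, ((PiLp.continuous_toLp 2 _).tendsto l).comp (tendsto_pi_nhds.2 hl)⟩

theorem IsTrajectory.exists_tendsto_rho (h : IsClosedLoop P W Ωb β θ b ℓθ ℓb)
    (hX : IsTrajectory P W Ωb β θ b ℓθ ℓb X) :
    ∃ ρlim, Tendsto (fun t => (X t).2.2) atTop (𝓝 ρlim) := by
  obtain ⟨_, _, _, M, hM⟩ := hX.exists_compact h
  obtain ⟨hc, S, hS, hd⟩ := hX.sol
  suffices hanti : ∃ l, Tendsto (fun t => -(P.sgn * (X t).2.2)) atTop (𝓝 l) by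
    obtain ⟨l, hl⟩ := hanti
    refine ⟨_, (hl.const_mul (-P.sgn)).congr fun t => ?_⟩
    rw [neg_mul_neg, ← mul_assoc, ← sq, h.sgn_sq, one_mul]
  refine exists_tendsto_of_antitoneOn_Ici (m := -(|P.sgn| * M))
    (fun s (hs : 0 ≤ s) t _ hst => ?_) fun t ht => ?_
  · exact neg_le_neg (h.sgn_rho_le hS hs hst
      (hc.mono fun r hr => ⟨hs.trans hr.1, EReal.coe_lt_top r⟩)
      fun r hr hrS => hd r (hs.trans_lt hr.1) (EReal.coe_lt_top r) hrS)
  · refine neg_le_neg ((le_abs_self _).trans ?_)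
    rw [abs_mul]
    exact mul_le_mul_of_nonneg_left (hM t ht).2 (abs_nonneg _)

/-- The Lyapunov function and the estimates converge, so `∑ zᵢ²` does; a positive limit would make
the Lyapunov function decrease linearly. -/
theorem IsTrajectory.tendsto_sum_zf_sq (h : IsClosedLoop P W Ωb β θ b ℓθ ℓb)
    (hX : IsTrajectory P W Ωb β θ b ℓθ ℓb X) :
    Tendsto (fun t => ∑ k ∈ Finset.Icc 1 n, zf P (alpha P W) k (pt β t (X t)) ^ 2) atTop (𝓝 0) := by
  obtain ⟨v, hv⟩ := hX.exists_tendsto_lyapAt h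
  obtain ⟨θl, hθ⟩ := hX.exists_tendsto_theta h
  obtain ⟨ρl, hρ⟩ := hX.exists_tendsto_rho h
  obtain ⟨κ, hκ0, hκ⟩ := h.valid.exists_le_k (by have := h.two_le; omega)
  set f := fun t => ∑ k ∈ Finset.Icc 1 n, zf P (alpha P W) k (pt β t (X t)) ^ 2 with hf
  have hf0 : ∀ t, 0 ≤ f t := fun t => Finset.sum_nonneg fun k _ => sq_nonneg _
  obtain ⟨L, hL⟩ : ∃ L, Tendsto f atTop (𝓝 L) := by
    have h1 : Tendsto (fun t => inner ℝ ((X t).2.1 - ℓθ) (gainInv P ((X t).2.1 - ℓθ))) atTop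
        (𝓝 (inner ℝ (θl - ℓθ) (gainInv P (θl - ℓθ)))) :=
      (hθ.sub_const ℓθ).inner (((continuous_gainInv P).tendsto _).comp (hθ.sub_const ℓθ))
    have h2 := ((hρ.sub_const (1 / ℓb)).pow 2).const_mul (|ℓb| / (2 * P.γ))
    refine ⟨_, (((hv.sub h2).sub (h1.const_mul (1 / 2))).const_mul 2).congr fun t => ?_⟩
    simp only [lyapAt, lyap, hf, pt]
    ring
  rcases (ge_of_tendsto' hL hf0).eq_or_lt with h0 | h0
  · rwa [h0]
  · exfalso
    obtain ⟨T, hT⟩ := eventually_atTop.1 (hL.eventually_const_lt (half_lt_self h0))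
    have hκL : 0 < κ * (L / 2) := by positivity
    set T₀ := max T 0 with hT₀
    set V₀ := lyapAt P W β ℓθ ℓb T₀ (X T₀) with hV₀
    have hVn : ∀ t, 0 ≤ lyapAt P W β ℓθ ℓb t (X t) := fun t => lyap_nonneg h.valid _ _ _
    -- the comparison function vanishes up to `T₀` and then has slope `κ L / 2`
    have hge : T₀ ≤ T₀ + (V₀ + 1) / (κ * (L / 2)) := by
      have := hVn T₀
      exact le_add_of_nonneg_right (by positivity)
    obtain ⟨hc, S, hS, hd⟩ := hX.sol
    have hI : ∀ r, T₀ ≤ r → 0 ≤ r := fun r hr => (le_max_right T 0).trans hr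
    have key := h.lyapAt_add_le hS (le_max_right T 0) hge (X := X)
      (g := fun t => κ * (L / 2) * t) (g' := fun _ => κ * (L / 2))
      (hc.mono fun r hr => ⟨hI r hr.1, EReal.coe_lt_top r⟩)
      (fun r hr hrS => hd r ((le_max_right T 0).trans_lt hr.1) (EReal.coe_lt_top r) hrS)
      (fun r hr => hX.mem r (hI r hr.1)) (fun r hr => hX.rho_pos r (hI r hr.1))
      (by fun_prop) (fun r hr _ => ⟨by simpa using (hasDerivAt_id r).const_mul (κ * (L / 2)), ?_⟩)
    · have h1 := hVn (T₀ + (V₀ + 1) / (κ * (L / 2)))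
      have h2 : κ * (L / 2) * (T₀ + (V₀ + 1) / (κ * (L / 2))) = κ * (L / 2) * T₀ + (V₀ + 1) := by
        field_simp
      rw [h2, ← hT₀, ← hV₀] at key
      linarith
    · exact (mul_le_mul_of_nonneg_left (hT r ((le_max_left T 0).trans hr.1.le)).le hκ0.le).trans
        (mul_sum_zf_sq_le_dissAt hκ r (X r))

theorem IsTrajectory.tendsto_x (h : IsClosedLoop P W Ωb β θ b ℓθ ℓb)
    (hX : IsTrajectory P W Ωb β θ b ℓθ ℓb X) : Tendsto (fun t => (X t).1) atTop (𝓝 0) := by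
  obtain ⟨K, hK, hKr, _, hKX⟩ := hX.exists_compact h
  refine Metric.tendsto_nhds.2 fun r hr => ?_
  obtain ⟨μ, hμ0, hμ⟩ := exists_norm_lt_of_sum_zf_sq_lt h.valid h.ha hK hKr hr
  filter_upwards [(hX.tendsto_sum_zf_sq h).eventually_lt_const hμ0, eventually_ge_atTop 0]
    with t ht ht0
  rw [dist_zero_right]
  exact hμ _ (hKX t ht0).1 ht

theorem IsTrajectory.exists_bound (h : IsClosedLoop P W Ωb β θ b ℓθ ℓb)
    (hX : IsTrajectory P W Ωb β θ b ℓθ ℓb X) :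
    ∃ C : ℝ, ∀ t : ℝ, 0 ≤ t → |control P W Ωb β t (X t)| ≤ C ∧ ‖thetaLaw P W β t (X t)‖ ≤ C ∧
      |rhoLaw P W Ωb β t (X t)| ≤ C := by
  have hn := h.two_le
  obtain ⟨K, hK, hKr, M, hKX⟩ := hX.exists_compact h
  have hu := (h.factor.contDiffOn_ubar hn h.valid).continuousOn.mono hKr
  have hz := (contDiffOn_zf h.valid h.ha (k := n) (by omega) le_rfl).continuousOn.mono hKr
  have hτ := (contDiffOn_tau h.valid (by omega) le_rfl h.ha le_rfl).continuousOn.mono hKr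
  obtain ⟨C₁, h1⟩ := hK.exists_bound_of_continuousOn hu
  obtain ⟨C₂, h2⟩ := hK.exists_bound_of_continuousOn hτ
  obtain ⟨C₃, h3⟩ := hK.exists_bound_of_continuousOn
    ((continuousOn_const (c := -P.γ * P.sgn)).mul hz |>.mul hu)
  refine ⟨max (M * C₁) (max C₂ C₃), fun t ht => ⟨le_max_of_le_left ?_,
    le_max_of_le_right (le_max_of_le_left (h2 _ (hKX t ht).1)),
    le_max_of_le_right (le_max_of_le_right (h3 _ (hKX t ht).1))⟩⟩
  rw [control, abs_mul]
  exact mul_le_mul (hKX t ht).2 (h1 _ (hKX t ht).1) (abs_nonneg _)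
    ((abs_nonneg _).trans (hKX t ht).2)

/-! ### The prescribed funnel -/

theorem coe_lt_extInv (hP : P.Valid n) {x y : ℝ} (hxy : P.ψ x < y) :
    (x : EReal) < extInv P.ψ y := by
  have h1 : ∀ᶠ r in 𝓝[>] x, P.ψ r < y :=
    ((continuous_psi hP).continuousAt.eventually_lt_const hxy).filter_mono nhdsWithin_le_nhds
  obtain ⟨r, hr, hxr⟩ := (h1.and self_mem_nhdsWithin).exists
  exact (EReal.coe_lt_coe_iff.2 hxr).trans_le (le_sSup ⟨r, hr, rfl⟩)

theorem extInv_lt_coe (hP : P.Valid n) {x y : ℝ} (hxy : y < P.ψ x) :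
    extInv P.ψ y < (x : EReal) := by
  have h1 : ∀ᶠ r in 𝓝[<] x, y < P.ψ r :=
    ((continuous_psi hP).continuousAt.eventually_const_lt hxy).filter_mono nhdsWithin_le_nhds
  obtain ⟨r, hr, hxr⟩ := (h1.and self_mem_nhdsWithin).exists
  refine (sSup_le ?_).trans_lt (EReal.coe_lt_coe_iff.2 hxr)
  rintro _ ⟨s, hs, rfl⟩
  exact EReal.coe_le_coe_iff.2 ((strictMono_psi hP).lt_iff_lt.1 (hs.trans hr)).le

theorem abs_psi_lt_of_mem_region {β : ℝ → ℝ} {t : ℝ} {s : St n q} (hn : 0 < n)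
    (hp : pt β t s ∈ region n P) : |P.ψ (s.1 ⟨0, hn⟩)| < β t := by
  have h := hp.2
  rwa [xc_pt β t s (j := 1) (by omega), bc_pt β t s (Nat.zero_le n),
    IsPerformanceFunction.timeDeriv_zero] at h

/-! ### Stability and equilibria -/

theorem IsTrajectory.eq (h : IsClosedLoop P W Ωb β θ b ℓθ ℓb)
    (hX : IsTrajectory P W Ωb β θ b ℓθ ℓb X) {T : EReal} {Y : ℝ → St n q}
    (hY : IsSolution P W Ωb β θ b T Y) (h0 : Y 0 = X 0) {t : ℝ} (ht : 0 ≤ t)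
    (htT : (t : EReal) < T) : Y t = X t :=
  h.unique hX.sol hX.mem hX.lyap_le hY h0 ht htT

theorem pt_mem_region_of_eq_zero (hP : P.Valid n) (hn : 1 ≤ n) (hβ : IsPerformanceFunction n β)
    {t : ℝ} (ht : 0 ≤ t) {s : St n q} (hs : s.1 = 0) : pt β t s ∈ region n P := by
  have h1 : bc (pt β t s) 0 = β t := by
    rw [bc_pt β t s (Nat.zero_le n), IsPerformanceFunction.timeDeriv_zero]
  have h2 : xc (pt β t s) 1 = 0 := by rw [xc_pt β t s (by omega), hs]; rfl
  have h3 := hβ.pos t ht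
  show 0 < bc (pt β t s) 0 ∧ |P.ψ (xc (pt β t s) 1)| < bc (pt β t s) 0
  rw [h1, h2, hP.ψ_normalized.map_zero, abs_zero]
  exact ⟨h3, h3⟩

theorem xc_eq_zero {p : Pt n q} (hp : p.1 = 0) (j : ℕ) : xc p j = 0 := by
  simp [xc, hp]

theorem IsClosedLoop.lyapAt_equilibrium (h : IsClosedLoop P W Ωb β θ b ℓθ ℓb) :
    lyapAt P W β ℓθ ℓb 0 ((0, ℓθ, 1 / ℓb) : St n q) = 0 := by
  have hp : pt β 0 ((0, ℓθ, 1 / ℓb) : St n q) ∈ region n P := pt_zero_mem_region h.valid h.perf _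
  simp only [lyapAt, lyap]
  rw [Finset.sum_eq_zero fun k hk => ?_]
  · simp [pt]
  · rw [Finset.mem_Icc] at hk
    rw [zf_eq_zero h.valid h.ha hk.1 hk.2 hp fun j _ _ => xc_eq_zero rfl j, sq, zero_mul]

theorem IsClosedLoop.sgn_div_pos (h : IsClosedLoop P W Ωb β θ b ℓθ ℓb) {c : ℝ} (hc : 0 < c) :
    0 < P.sgn * (c / ℓb) := by
  have h1 := h.gain_level.1
  obtain ⟨h2, h3⟩ := sign_facts h1 h.gain_level.2.1
  have h4 : P.sgn ≠ 0 := fun h0 => by simp [h0] at h3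
  have h5 : P.sgn * (c / ℓb) = c / |ℓb| := by
    conv_lhs => rw [← h2]
    field_simp
  rw [h5]; positivity

/-- `V` is continuous at the equilibrium at time `0` and does not increase afterwards. -/
theorem IsClosedLoop.stable (h : IsClosedLoop P W Ωb β θ b ℓθ ℓb) {r : ℝ} (hr : 0 < r) :
    ∃ η : ℝ, 0 < η ∧ ∀ X : ℝ → St n q, IsSolution P W Ωb β θ b ⊤ X →
      ‖X 0 - ((0, ℓθ, 1 / ℓb) : St n q)‖ < η →
      ∀ t : ℝ, 0 ≤ t → ‖X t - ((0, ℓθ, 1 / ℓb) : St n q)‖ < r := by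
  obtain ⟨K, hK, hKr, hKm⟩ := h.exists_compact_of_lyapAt_le 1
  obtain ⟨μ, hμ0, hμ⟩ := exists_norm_lt_of_sum_zf_sq_lt h.valid h.ha (hK.image continuous_fst)
    (by rintro _ ⟨y, hy, rfl⟩; exact (hKr hy).1) hr
  obtain ⟨d, hd0, hd⟩ := exists_norm_sq_le_inner_gainInv h.valid
  have hℓ := h.gain_level.1
  have hγ := h.valid.γ_pos
  set e : St n q := (0, ℓθ, 1 / ℓb) with he
  set ν := min (min 1 (μ / 2)) (min (r ^ 2 / (2 * d)) (|ℓb| / (2 * P.γ) * r ^ 2)) with hν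
  have hν0 : 0 < ν := by positivity
  have hcont : ContinuousAt (fun s : St n q => lyapAt P W β ℓθ ℓb 0 s) e := by
    have h1 : Continuous fun s : St n q => (pt β 0 s, s.2.2) := by unfold pt; fun_prop
    exact ContinuousAt.comp (g := lyap P (alpha P W) ℓθ ℓb)
      (f := fun s : St n q => (pt β 0 s, s.2.2))
      ((continuousOn_lyap h.valid h.ha ℓθ ℓb).continuousAt
        (((isOpen_region h.valid).prod isOpen_univ).mem_nhds
          ⟨pt_zero_mem_region h.valid h.perf e, mem_univ _⟩)) h1.continuousAt
  have e1 : ∀ᶠ s in 𝓝 e, lyapAt P W β ℓθ ℓb 0 s < ν :=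
    hcont.eventually_lt_const (h.lyapAt_equilibrium.trans_lt hν0)
  have e2 : ∀ᶠ s : St n q in 𝓝 e, 0 < P.sgn * s.2.2 :=
    (by fun_prop : Continuous fun s : St n q => P.sgn * s.2.2).continuousAt.eventually_const_lt
      (h.sgn_div_pos one_pos)
  obtain ⟨η, hη0, hη⟩ := Metric.eventually_nhds_iff.1 (e1.and e2)
  refine ⟨η, hη0, fun Y hY hY0 t ht => ?_⟩
  obtain ⟨f1, f2⟩ := hη ((dist_eq_norm _ _).trans_lt hY0)
  obtain ⟨X, hX, hX0⟩ := h.exists_trajectory f2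
  rw [hX.eq h hY hX0.symm ht (EReal.coe_lt_top t)]
  have hV : lyapAt P W β ℓθ ℓb t (X t) < ν := (hX.lyap_le t ht).trans_lt (by rwa [hX0])
  obtain ⟨-, g1, g2, g3⟩ := lyap_bounds h.valid (alpha P W) ℓθ (ℓb := ℓb)
    (pt β t (X t), (X t).2.2)
  change _ ≤ 2 * lyapAt P W β ℓθ ℓb t (X t) at g1 g2
  change _ ≤ lyapAt P W β ℓθ ℓb t (X t) at g3
  have hν1 : ν ≤ 1 := (min_le_left _ _).trans (min_le_left _ _)
  have hν2 : ν ≤ μ / 2 := (min_le_left _ _).trans (min_le_right _ _)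
  have hν3 : ν ≤ r ^ 2 / (2 * d) := (min_le_right _ _).trans (min_le_left _ _)
  have hν4 : ν ≤ |ℓb| / (2 * P.γ) * r ^ 2 := (min_le_right _ _).trans (min_le_right _ _)
  refine max_lt ?_ (max_lt ?_ ?_)
  · show ‖(X t).1 - 0‖ < r
    rw [sub_zero]
    exact hμ (pt β t (X t)) ⟨_, (hKm t ht _ (hX.mem t ht) (hV.le.trans hν1)).1, rfl⟩
      (g1.trans_lt (by linarith))
  · show ‖(X t).2.1 - ℓθ‖ < r
    refine lt_of_pow_lt_pow_left₀ 2 hr.le ((hd _).trans_lt ?_)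
    calc d * inner ℝ ((X t).2.1 - ℓθ) (gainInv P ((X t).2.1 - ℓθ))
        ≤ d * (2 * lyapAt P W β ℓθ ℓb t (X t)) := mul_le_mul_of_nonneg_left g2 hd0.le
      _ < d * (2 * (r ^ 2 / (2 * d))) := by
          refine mul_lt_mul_of_pos_left ?_ hd0
          linarith
      _ = r ^ 2 := by field_simp
  · show |(X t).2.2 - 1 / ℓb| < r
    refine abs_lt_of_sq_lt_sq ?_ hr.le
    exact lt_of_mul_lt_mul_left (g3.trans_lt (hV.trans_le hν4)) (by positivity)

/-- At `x = 0` the closed loop is at rest, whatever the estimates are. -/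
theorem IsClosedLoop.isSolution_const (h : IsClosedLoop P W Ωb β θ b ℓθ ℓb) (v : Vec q) (ρ : ℝ) :
    IsSolution P W Ωb β θ b ⊤ fun _ => ((0, v, ρ) : St n q) := by
  have hn := h.two_le
  refine ⟨continuousOn_const, ∅, fun R => by simp, fun t ht _ _ => ?_⟩
  set s : St n q := (0, v, ρ) with hs
  have hp : pt β t s ∈ region n P := pt_mem_region_of_eq_zero h.valid (by omega) h.perf ht.le rfl
  have hx : ∀ j, xc (pt β t s) j = 0 := xc_eq_zero rfl
  have hz : zf P (alpha P W) n (pt β t s) = 0 :=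
    zf_eq_zero h.valid h.ha (by omega) le_rfl hp fun j _ _ => hx j
  have hτ : tau P (alpha P W) n (pt β t s) = 0 :=
    tau_eq_zero h.valid le_rfl (by omega) le_rfl fun j _ _ => hx j
  have hf : field P W Ωb β θ b t s = 0 := by
    refine Prod.ext (funext fun i => ?_) (Prod.ext hτ ?_)
    · have hreg : reg P (i.val + 1) (pt β t s) = 0 :=
        reg_eq_zero h.valid (by omega) (by omega) fun j _ _ => hx j
      simp [field, hreg, hx, control, ubar, hz]
    · simp [field, rhoLaw, hz]
  rw [hf]
  exact hasDerivAt_const _ _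

end ClosedLoop

end Backstepping

theorem theorem2 {n q : ℕ} (hn : 2 ≤ n)
    (P : Backstepping.DesignData q) (hP : P.Valid n) :
    -- the factors used by the design exist,
    (∃ (W : Backstepping.Rows q) (Ωb : Backstepping.Pt n q → Fin n → ℝ),
      Backstepping.IsFactorization n P W Ωb) ∧
    -- and whichever are chosen, the resulting closed loop has the stated properties
    ∀ (W : Backstepping.Rows q) (Ωb : Backstepping.Pt n q → Fin n → ℝ),
      Backstepping.IsFactorization n P W Ωb →
    ∀ β : ℝ → ℝ, Backstepping.IsPerformanceFunction n β →
    ∀ (Θ₀ : Set (Backstepping.Vec q)) (θ : ℝ → Backstepping.Vec q) (b : ℝ → ℝ),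
      IsCompact Θ₀ → (∃ ℓθ : Backstepping.Vec q, Θ₀ ⊆ Metric.closedBall ℓθ P.δ) →
      Backstepping.PiecewiseContinuous θ → (∀ t : ℝ, 0 ≤ t → θ t ∈ Θ₀) →
      Backstepping.PiecewiseContinuous b → (∃ ℓb : ℝ, Backstepping.IsGainLevel P.sgn b ℓb) →
    -- for every initial condition: global existence, uniqueness, funnel, convergence, boundedness
    (∀ s₀ : Backstepping.St n q, 0 < P.sgn * s₀.2.2 →
      ∃ X : ℝ → Backstepping.St n q,
        Backstepping.IsSolution P W Ωb β θ b ⊤ X ∧ X 0 = s₀ ∧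
        (∀ (T : EReal) (Y : ℝ → Backstepping.St n q),
          Backstepping.IsSolution P W Ωb β θ b T Y → Y 0 = s₀ →
          ∀ t : ℝ, 0 ≤ t → (t : EReal) < T → Y t = X t) ∧
        (∀ t : ℝ, 0 ≤ t →
          Backstepping.extInv P.ψ (-β t) < (((X t).1 ⟨0, by omega⟩ : ℝ) : EReal) ∧
          (((X t).1 ⟨0, by omega⟩ : ℝ) : EReal) < Backstepping.extInv P.ψ (β t)) ∧
        ((∀ r : ℝ, P.ψ (-r) = -P.ψ r) → ∀ t : ℝ, 0 ≤ t →
          ((|(X t).1 ⟨0, by omega⟩| : ℝ) : EReal) < Backstepping.extInv P.ψ (β t)) ∧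
        Filter.Tendsto (fun t => (X t).1) Filter.atTop (nhds 0) ∧
        (∃ θlim : Backstepping.Vec q,
          Filter.Tendsto (fun t => (X t).2.1) Filter.atTop (nhds θlim)) ∧
        (∃ ρlim : ℝ, Filter.Tendsto (fun t => (X t).2.2) Filter.atTop (nhds ρlim)) ∧
        (∃ C : ℝ, ∀ t : ℝ, 0 ≤ t →
          |Backstepping.control P W Ωb β t (X t)| ≤ C ∧
          ‖Backstepping.thetaLaw P W β t (X t)‖ ≤ C ∧
          |Backstepping.rhoLaw P W Ωb β t (X t)| ≤ C)) ∧
    -- Lyapunov stability of `(x, θ̂, ρ̂) = (0, ℓθ, 1/ℓb)`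
    (∀ (ℓθ : Backstepping.Vec q) (ℓb : ℝ), (∀ t : ℝ, 0 ≤ t → ‖θ t - ℓθ‖ ≤ P.δ) →
      Backstepping.IsGainLevel P.sgn b ℓb →
      ∀ r : ℝ, 0 < r → ∃ η : ℝ, 0 < η ∧ ∀ X : ℝ → Backstepping.St n q,
        Backstepping.IsSolution P W Ωb β θ b ⊤ X →
        ‖X 0 - ((0, ℓθ, 1 / ℓb) : Backstepping.St n q)‖ < η →
        ∀ t : ℝ, 0 ≤ t → ‖X t - ((0, ℓθ, 1 / ℓb) : Backstepping.St n q)‖ < r) ∧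
    -- the limits of the estimates need not be `ℓθ` and `1/ℓb`
    (∀ (ℓθ : Backstepping.Vec q) (ℓb : ℝ), (∀ t : ℝ, 0 ≤ t → ‖θ t - ℓθ‖ ≤ P.δ) →
      Backstepping.IsGainLevel P.sgn b ℓb →
      ∃ (X : ℝ → Backstepping.St n q) (θlim : Backstepping.Vec q) (ρlim : ℝ),
        Backstepping.IsSolution P W Ωb β θ b ⊤ X ∧ 0 < P.sgn * (X 0).2.2 ∧
        Filter.Tendsto (fun t => (X t).2.1) Filter.atTop (nhds θlim) ∧
        Filter.Tendsto (fun t => (X t).2.2) Filter.atTop (nhds ρlim) ∧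
        (0 < q → θlim ≠ ℓθ) ∧ ρlim ≠ 1 / ℓb) := by
  refine ⟨Backstepping.exists_isFactorization hn hP, ?_⟩
  intro W Ωb hF β hβ Θ₀ θ b _ hball hθ hθΘ hb hgain
  have hloop : ∀ ℓθ ℓb, (∀ t : ℝ, 0 ≤ t → ‖θ t - ℓθ‖ ≤ P.δ) →
      Backstepping.IsGainLevel P.sgn b ℓb →
      Backstepping.IsClosedLoop P W Ωb β θ b ℓθ ℓb := fun ℓθ ℓb h1 h2 =>
    ⟨hn, hP, hF, hβ, hθ, hb, h1, h2⟩
  refine ⟨fun s₀ hs₀ => ?_, fun ℓθ ℓb h1 h2 r hr => (hloop ℓθ ℓb h1 h2).stable hr,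
    fun ℓθ ℓb h1 h2 => ?_⟩
  · obtain ⟨ℓθ, hℓθ⟩ := hball
    obtain ⟨ℓb, hℓb⟩ := hgain
    have h := hloop ℓθ ℓb (fun t ht => mem_closedBall_iff_norm.1 (hℓθ (hθΘ t ht))) hℓb
    obtain ⟨X, hX, rfl⟩ := h.exists_trajectory hs₀
    have hψ : ∀ t, 0 ≤ t → |P.ψ ((X t).1 ⟨0, by omega⟩)| < β t := fun t ht =>
      Backstepping.abs_psi_lt_of_mem_region (by omega) (hX.mem t ht)
    refine ⟨X, hX.sol, rfl, fun T Y hY hY0 t ht htT => hX.eq h hY hY0 ht htT,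
      fun t ht => ⟨Backstepping.extInv_lt_coe hP (abs_lt.1 (hψ t ht)).1,
        Backstepping.coe_lt_extInv hP (abs_lt.1 (hψ t ht)).2⟩,
      fun hodd t ht => Backstepping.coe_lt_extInv hP ?_, hX.tendsto_x h,
      hX.exists_tendsto_theta h, hX.exists_tendsto_rho h, hX.exists_bound h⟩
    rcases abs_choice ((X t).1 ⟨0, by omega⟩) with h0 | h0
    · rw [h0]; exact (abs_lt.1 (hψ t ht)).2
    · rw [h0, hodd]; linarith [(abs_lt.1 (hψ t ht)).1]
  · have h := hloop ℓθ ℓb h1 h2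
    have hℓ : ℓb ≠ 0 := abs_pos.1 h2.1
    refine ⟨_, _, _, h.isSolution_const (ℓθ + WithLp.toLp 2 fun _ => 1) (2 / ℓb),
      h.sgn_div_pos two_pos, tendsto_const_nhds, tendsto_const_nhds, fun hq h0 => ?_, fun h0 => ?_⟩
    · have h3 := congrArg (fun v : Backstepping.Vec q => v ⟨0, hq⟩) h0
      simp at h3
    · field_simp at h0
      norm_num at h0
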